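/- Theorem 1.2. There is an integer $N$ such that the following holds for every integer $n \ge N$. Let $G$ be a multigraph (parallel edges are allowed, and $G$ need not be bipartite) whose edges are coloured with $n$ colours, each edge receiving one colour, such that for each of the $n$ colours the set of edges of that colour is a matching (a set of non-loop edges no two of which share a vertex) consisting of at least $n + 20\,n^{1-1/16}$ edges. Then $G$ contains a full rainbow matching, that is, a matching that contains exactly one edge of each of the $n$ colours. -/

import Mathlib

open scoped ENNReal

/-- A set `M` of edges of the multigraph `G` is a matching: its members are edges of `G`, none of
them is a loop, and no vertex is an end of two different members. -/
def Graph.IsMatching {α β : Type*} (G : Graph α β) (M : Set β) : Prop :=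
  M ⊆ G.edgeSet ∧ (∀ e ∈ M, ∀ x, ¬ G.IsLoopAt e x) ∧
    ∀ e ∈ M, ∀ f ∈ M, ∀ x, G.Inc e x → G.Inc f x → e = f

/-- The class of the colour `i`: the edges of `G` that receive colour `i` in the edge colouring `c`.
The values of `c` outside the edge set of `G` play no role. -/
def Graph.colourClass {α β κ : Type*} (G : Graph α β) (c : β → κ) (i : κ) : Set β :=
  {e | e ∈ G.edgeSet ∧ c e = i}

/-- A full rainbow matching of `G` with respect to the edge colouring `c`: a matching whose edges
have pairwise distinct colours and in which every colour occurs. -/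
def Graph.IsFullRainbowMatching {α β κ : Type*} (G : Graph α β) (c : β → κ) (M : Set β) : Prop :=
  G.IsMatching M ∧ Set.InjOn c M ∧ ∀ i, ∃ e ∈ M, c e = i

/-! Let Q = ⌈n^(1/16)⌉, so that every colour class has at least n(1 + 20/Q) edges. A random vertex
set F, containing each vertex with probability 1/Q, spans at least 2Q^12 edges of each colour while
more than n(1 + 1/Q) edges of each colour avoid F (`exists_splitting`). A rainbow matching outside F
that misses fewer than Q^12 colours is completed greedily inside F (`IsRainbow.complete`). It
remains to find such an almost full matching when all classes have at least n(1 + 1/Q) edges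
(`exists_rainbow_almost_full`).

Take a rainbow matching σ of maximum size and let R be the set of unused colours. Let K consist of
the edges of σ and of the pairs joined in at least t colours of R. A change of σ on at most t
vertices needs prescribed colours only on its edges outside K, since the other new edges can be
coloured greedily from R (`IsPatch.exists_colouring`). By maximality no such change covers more
vertices (`NoAug`).

A vertex is freed if a small change, losing no coverage, leaves it uncovered. A growing set X of
covered vertices is maintained, such that uncovered vertices and partners of vertices of X can be
freed while avoiding any given small set of vertices and colours (`Stage`). Two vertices freed by
disjoint means cannot be joined in an unused colour (`Stage.no_edge`).

In K - X the matching σ is nearly maximum, since otherwise a short augmenting path would exist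
(`exists_shortAug`, `Stage.not_shortAug`). The Berge formula with factor-critical parts (`berge`)
then gives a barrier A and odd parts. After large parts and a deficient subset of A with its
neighbouring parts are discarded, the rest expands (`exists_parts`), so alternating paths of length
polynomial in Q reach all but few parts even when a small set is forbidden, and a factor-critical
part lets the path end at any of its vertices (`Parts.card_not_patchable`).

As the parts are odd, each unused colour has about n/Q edges leaving a part without entering X or A
(`Parts.card_moved_le`). Few of these join two parts, or lead to a vertex that can already be freed.
The others end at σ-covered vertices, many of which must then receive edges in a great number of
unused colours. Rematching such a vertex y along one of these edges frees its partner, so half of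
these vertices y can be added to X (`Parts.stage_union`). Thus X grows by order n/Q per step, which
cannot go on for 8Q steps as |X| ≤ n, unless |R| < Q^12 (`NoAug.iterate`, `NoAug.card_lt`). -/

section
open scoped Classical

/-! ### Matchings as involutions and the exchange of maximum matchings -/

namespace RainbowMatching

variable {V : Type*}

/-- The involution `m` encodes a matching of `K[S]`; its fixed points are the uncovered vertices. -/
structure IsMat (K : SimpleGraph V) (S : Finset V) (m : V → V) : Prop where
  invol : ∀ v, m (m v) = v
  adj : ∀ v, m v ≠ v → K.Adj v (m v)
  mem : ∀ v, m v ≠ v → v ∈ S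

/-- The points of `S` fixed by `m`. -/
noncomputable def fixedIn (S : Finset V) (m : V → V) : Finset V := S.filter (fun v => m v = v)

theorem mem_fixedIn {S : Finset V} {m : V → V} {v : V} : v ∈ fixedIn S m ↔ v ∈ S ∧ m v = v := by
  simp [fixedIn]

/-- A matching of `K[S]` of maximum size. -/
def IsMaxMat (K : SimpleGraph V) (S : Finset V) (m : V → V) : Prop :=
  IsMat K S m ∧ ∀ m', IsMat K S m' → (fixedIn S m).card ≤ (fixedIn S m').card

/-- Conjugation of `m` by the transposition of `a` and `c`. -/
noncomputable def conjSwap (a c : V) (m : V → V) : V → V :=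
  fun v => Equiv.swap a c (m (Equiv.swap a c v))

theorem conjSwap_of_ne {a c v : V} {m : V → V} (h1 : v ≠ a) (h2 : v ≠ c) (h3 : m v ≠ a)
    (h4 : m v ≠ c) : conjSwap a c m v = m v := by
  simp [conjSwap, Equiv.swap_apply_of_ne_of_ne, *]

theorem IsMat.inj {K : SimpleGraph V} {S : Finset V} {m : V → V} (h : IsMat K S m) {v w : V}
    (hvw : m v = m w) : v = w := by
  rw [← h.invol v, hvw, h.invol]

theorem IsMat.mem' {K : SimpleGraph V} {S : Finset V} {m : V → V} (h : IsMat K S m) {v : V}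
    (hv : m v ≠ v) : m v ∈ S := by
  apply h.mem
  rw [h.invol]; exact hv.symm

/-- Moving a matching edge `ab` to `bc`, where `c` is uncovered. -/
theorem IsMat.conj {K : SimpleGraph V} {S : Finset V} {m : V → V} (h : IsMat K S m) {a b c : V}
    (hab : m a = b) (hne : b ≠ a) (hc : m c = c) (hcS : c ∈ S) (hbc : K.Adj b c) :
    IsMat K S (conjSwap a c m) ∧ conjSwap a c m a = a ∧ conjSwap a c m c = b ∧
      conjSwap a c m b = c ∧ (fixedIn S (conjSwap a c m)).card = (fixedIn S m).card := by
  have haS : a ∈ S := h.mem a (by rw [hab]; exact hne)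
  have hac : a ≠ c := by rintro rfl; exact hne (hab.symm.trans hc)
  have hbc' : b ≠ c := hbc.ne
  have hba : m b = a := by rw [← hab, h.invol]
  have e1 : conjSwap a c m a = a := by simp [conjSwap, hc]
  have e2 : conjSwap a c m c = b := by
    simp [conjSwap, hab, Equiv.swap_apply_of_ne_of_ne hne hbc']
  have e3 : conjSwap a c m b = c := by
    simp [conjSwap, Equiv.swap_apply_of_ne_of_ne hne hbc', hba]
  have inv : ∀ v, conjSwap a c m (conjSwap a c m v) = v := by
    intro v; simp [conjSwap, h.invol]
  have oth : ∀ v, v ≠ a → v ≠ b → v ≠ c → conjSwap a c m v = m v := by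
    intro v h1 h2 h3
    apply conjSwap_of_ne h1 h3
    · intro hh; exact h2 (h.inj (hh.trans hba.symm))
    · intro hh; exact h3 (h.inj (hh.trans hc.symm))
  refine ⟨⟨inv, ?_, ?_⟩, e1, e2, e3, ?_⟩
  · intro v hv
    by_cases h1 : v = a
    · subst h1; exact absurd e1 hv
    by_cases h2 : v = b
    · subst h2; rw [e3]; exact hbc
    by_cases h3 : v = c
    · subst h3; rw [e2]; exact hbc.symm
    rw [oth v h1 h2 h3] at hv ⊢
    exact h.adj v hv
  · intro v hv
    by_cases h1 : v = a
    · subst h1; exact haS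
    by_cases h2 : v = b
    · subst h2; exact h.mem _ (by rw [hba]; exact hne.symm)
    by_cases h3 : v = c
    · subst h3; exact hcS
    rw [oth v h1 h2 h3] at hv
    exact h.mem v hv
  · apply Finset.card_bij (fun v _ => Equiv.swap a c v)
    · intro v hv
      rw [mem_fixedIn] at hv ⊢
      obtain ⟨hv1, hv2⟩ := hv
      refine ⟨?_, ?_⟩
      · by_cases h1 : v = a
        · subst h1; simpa using hcS
        by_cases h3 : v = c
        · subst h3; simpa using haS
        rwa [Equiv.swap_apply_of_ne_of_ne h1 h3]
      · have := congrArg (Equiv.swap a c) hv2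
        simpa [conjSwap] using this
    · intro v _ w _ hvw; exact (Equiv.swap a c).injective hvw
    · intro v hv
      rw [mem_fixedIn] at hv
      obtain ⟨hv1, hv2⟩ := hv
      refine ⟨Equiv.swap a c v, ?_, by simp⟩
      rw [mem_fixedIn]
      refine ⟨?_, by simp [conjSwap, hv2]⟩
      by_cases h1 : v = a
      · subst h1; simpa using hcS
      by_cases h3 : v = c
      · subst h3; simpa using haS
      rwa [Equiv.swap_apply_of_ne_of_ne h1 h3]

/-- Adding an edge between two uncovered vertices. -/
theorem IsMat.add {K : SimpleGraph V} {S : Finset V} {m : V → V} (h : IsMat K S m) {a c : V}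
    (ha : m a = a) (hc : m c = c) (haS : a ∈ S) (hcS : c ∈ S) (hac : K.Adj a c) :
    ∃ m', IsMat K S m' ∧ (fixedIn S m').card < (fixedIn S m).card := by
  have hne := hac.ne
  set m' : V → V := fun v => if v = a then c else if v = c then a else m v with hm'
  have e1 : m' a = c := by simp [hm']
  have e2 : m' c = a := by simp [hm', hne.symm]
  have e3 : ∀ v, v ≠ a → v ≠ c → m' v = m v := by intro v h1 h2; simp [hm', h1, h2]
  refine ⟨m', ⟨?_, ?_, ?_⟩, ?_⟩
  · intro v
    by_cases h1 : v = a
    · subst h1; rw [e1, e2]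
    by_cases h2 : v = c
    · subst h2; rw [e2, e1]
    rw [e3 v h1 h2, e3, h.invol]
    · intro hh; exact h1 (h.inj (hh.trans ha.symm))
    · intro hh; exact h2 (h.inj (hh.trans hc.symm))
  · intro v hv
    by_cases h1 : v = a
    · subst h1; rw [e1]; exact hac
    by_cases h2 : v = c
    · subst h2; rw [e2]; exact hac.symm
    rw [e3 v h1 h2] at hv ⊢; exact h.adj v hv
  · intro v hv
    by_cases h1 : v = a
    · subst h1; exact haS
    by_cases h2 : v = c
    · subst h2; exact hcS
    rw [e3 v h1 h2] at hv; exact h.mem v hv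
  · apply Finset.card_lt_card
    rw [Finset.ssubset_iff_of_subset]
    · refine ⟨a, mem_fixedIn.2 ⟨haS, ha⟩, ?_⟩
      rw [mem_fixedIn, e1]; exact fun hh => hne hh.2.symm
    · intro v hv
      rw [mem_fixedIn] at hv ⊢
      refine ⟨hv.1, ?_⟩
      by_cases h1 : v = a
      · subst h1; exact ha
      by_cases h2 : v = c
      · subst h2; exact hc
      rw [← e3 v h1 h2]; exact hv.2

/-- The exchange property of maximum matchings behind Gallai's lemma. -/
theorem exchange [Fintype V] {K : SimpleGraph V} {S : Finset V} {m₁ : V → V}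
    (h₁ : IsMaxMat K S m₁) : ∀ (d : ℕ) (m₂ : V → V) (w : V), IsMaxMat K S m₂ → w ∈ S → m₂ w = w →
      (Finset.univ.filter (fun v => m₁ v ≠ m₂ v)).card = d →
      ∃ m, IsMaxMat K S m ∧ m w = w ∧ (∃ e, ∀ v, m₁ v = v → v ≠ e → m v = v) ∧
        ∀ v, m₁ v = m₂ v → m v = m₁ v := by
  intro d
  induction d using Nat.strong_induction_on with
  | _ d ih =>
  intro m₂ w h₂ hwS hw hd
  by_cases hw1 : m₁ w = w
  · exact ⟨m₁, h₁, hw1, ⟨w, fun v hv _ => hv⟩, fun v _ => rfl⟩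
  obtain ⟨w1, hww1⟩ : ∃ w1, m₁ w = w1 := ⟨_, rfl⟩
  have hw1w : w1 ≠ w := by rw [← hww1]; exact hw1
  have hm1w1 : m₁ w1 = w := by rw [← hww1, h₁.1.invol]
  have hadj : K.Adj w w1 := by rw [← hww1]; exact h₁.1.adj w hw1
  have hw1S : w1 ∈ S := by rw [← hww1]; exact h₁.1.mem' hw1
  have hm2w1 : m₂ w1 ≠ w1 := by
    intro hh
    obtain ⟨m', hm', hlt⟩ := h₂.1.add hw hh hwS hw1S hadj
    exact absurd (h₂.2 m' hm') (not_le.2 hlt)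
  obtain ⟨w2, hw2⟩ : ∃ w2, m₂ w1 = w2 := ⟨_, rfl⟩
  have hm2w2 : m₂ w2 = w1 := by rw [← hw2, h₂.1.invol]
  have hw2w1 : w2 ≠ w1 := by rw [← hw2]; exact hm2w1
  have hw2w : w2 ≠ w := by
    rintro rfl; exact hw1w (hm2w2.symm.trans hw)
  have hadj2 : K.Adj w1 w2 := by rw [← hw2]; exact h₂.1.adj w1 hm2w1
  have hw2S : w2 ∈ S := by rw [← hw2]; exact h₂.1.mem' hm2w1
  have agree : ∀ v, m₁ v = m₂ v → v ≠ w ∧ v ≠ w1 ∧ v ≠ w2 := by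
    intro v hv
    refine ⟨?_, ?_, ?_⟩
    · rintro rfl; exact hw1 (hv.trans hw)
    · rintro rfl; exact hw2w (hw2.symm.trans (hv.symm.trans hm1w1))
    · rintro rfl
      have : m₁ v = m₁ w := by rw [hv, hm2w2, hww1]
      exact hw2w (h₁.1.inj this)
  -- Follow the alternating path w, w1 = m₁ w, w2 = m₂ w1. If m₁ misses w2, shifting its edge from w
  -- w1 to w1 w2 frees w at the cost of w2 alone.
  by_cases hw2f : m₁ w2 = w2
  · obtain ⟨c1, c2, c3, c4, c5⟩ := h₁.1.conj hww1 hw1w hw2f hw2S hadj2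
    refine ⟨_, ⟨c1, fun m' hm' => c5.le.trans (h₁.2 m' hm')⟩, c2, ⟨w2, ?_⟩, ?_⟩
    · intro v hv hve
      have hvw : v ≠ w := by rintro rfl; exact hw1 hv
      rw [conjSwap_of_ne hvw hve (by rwa [hv]) (by rwa [hv]), hv]
    · intro v hv
      obtain ⟨a1, a2, a3⟩ := agree v hv
      apply conjSwap_of_ne a1 a3
      · intro hh; exact a2 (h₁.1.inj (hh.trans hm1w1.symm))
      · intro hh; exact a3 (h₁.1.inj (hh.trans hw2f.symm))
  -- Otherwise shift the m₂-edge w1 w2 to w w1. The two matchings now agree at w, so induction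
  -- applies with w2 in place of w; the matching it returns still contains w w1, and shifting that
  -- edge to w1 w2 frees w.
  · obtain ⟨c1, c2, c3, c4, c5⟩ := h₂.1.conj (a := w2) hm2w2 hw2w1.symm hw hwS hadj.symm
    have hmax2 : IsMaxMat K S (conjSwap w2 w m₂) :=
      ⟨c1, fun m' hm' => c5.le.trans (h₂.2 m' hm')⟩
    have same : ∀ v, v ≠ w → v ≠ w1 → v ≠ w2 → conjSwap w2 w m₂ v = m₂ v := by
      intro v a1 a2 a3
      apply conjSwap_of_ne a3 a1
      · intro hh; exact a2 (h₂.1.inj (hh.trans hw2.symm))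
      · intro hh; exact a1 (h₂.1.inj (hh.trans hw.symm))
    have hlt : (Finset.univ.filter (fun v => m₁ v ≠ conjSwap w2 w m₂ v)).card < d := by
      rw [← hd]
      apply Finset.card_lt_card
      rw [Finset.ssubset_iff_of_subset]
      · refine ⟨w, ?_, ?_⟩
        · simp only [Finset.mem_filter, Finset.mem_univ, true_and]
          rw [hw]; exact hw1
        · simp [c3, hww1]
      · intro v hv
        simp only [Finset.mem_filter, Finset.mem_univ, true_and] at hv ⊢
        intro hh
        obtain ⟨a1, a2, a3⟩ := agree v hh
        exact hv (by rw [same v a1 a2 a3, hh])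
    obtain ⟨m, hm, hmw2, ⟨e, he⟩, hag⟩ := ih _ hlt _ w2 hmax2 hw2S c2 rfl
    have hmw : m w = w1 := by rw [hag w (by rw [c3, hww1]), hww1]
    have hmw1 : m w1 = w := by rw [← hmw, hm.1.invol]
    obtain ⟨b1, b2, b3, b4, b5⟩ := hm.1.conj hmw hw1w hmw2 hw2S hadj2
    refine ⟨_, ⟨b1, fun m' hm' => b5.le.trans (hm.2 m' hm')⟩, b2, ⟨e, ?_⟩, ?_⟩
    · intro v hv hve
      have hvw : v ≠ w := by rintro rfl; exact hw1 hv
      have hvw2 : v ≠ w2 := by rintro rfl; exact hw2f hv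
      have hmv := he v hv hve
      rw [conjSwap_of_ne hvw hvw2 (by rwa [hmv]) (by rwa [hmv]), hmv]
    · intro v hv
      obtain ⟨a1, a2, a3⟩ := agree v hv
      have hmv : m v = m₁ v := hag v (by rw [same v a1 a2 a3, hv])
      rw [conjSwap_of_ne a1 a3, hmv]
      · intro hh; exact a2 (hm.1.inj (hh.trans hmw1.symm))
      · intro hh; exact a3 (hm.1.inj (hh.trans hmw2.symm))

/-! ### Gallai's lemma and the Berge formula -/

theorem exists_isMaxMat [Fintype V] (K : SimpleGraph V) (S : Finset V) : ∃ m, IsMaxMat K S m := by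
  have hid : IsMat K S id := ⟨fun _ => rfl, fun v h => absurd rfl h, fun v h => absurd rfl h⟩
  have hex : ∃ d, ∃ m, IsMat K S m ∧ (fixedIn S m).card = d := ⟨_, id, hid, rfl⟩
  obtain ⟨m, hm, hd⟩ := Nat.find_spec hex
  exact ⟨m, hm, fun m' hm' => hd.le.trans (Nat.find_min' hex ⟨m', hm', rfl⟩)⟩

/-- An involution without fixed points lives on a set of even size. -/
theorem even_card_of_invol {S : Finset V} {m : V → V} (h1 : ∀ v ∈ S, m v ∈ S)
    (h2 : ∀ v ∈ S, m (m v) = v) (h3 : ∀ v ∈ S, m v ≠ v) : Even S.card := by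
  have : (S.card : ZMod 2) = 0 := by
    have := Finset.sum_involution (s := S) (f := fun _ => (1 : ZMod 2)) (fun v _ => m v)
      (fun a _ => by decide) (fun a ha _ => h3 a ha) (fun a ha => h1 a ha) (fun a ha => h2 a ha)
    simpa using this
  exact (ZMod.natCast_eq_zero_iff_even).1 this

theorem even_card_add_fixed {S : Finset V} {m : V → V} (h1 : ∀ v ∈ S, m v ∈ S)
    (h2 : ∀ v ∈ S, m (m v) = v) : Even (S.card + (fixedIn S m).card) := by
  have h := even_card_of_invol (S := S.filter (fun v => m v ≠ v)) (m := m) ?_ ?_ ?_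
  · have := Finset.card_filter_add_card_filter_not (s := S) (fun v => m v = v)
    rw [← this]
    unfold fixedIn
    obtain ⟨k, hk⟩ := h
    exact ⟨(S.filter (fun v => m v = v)).card + k, by simp only [ne_eq] at hk; omega⟩
  · intro v hv
    rw [Finset.mem_filter] at hv ⊢
    exact ⟨h1 v hv.1, by rw [h2 v hv.1]; exact hv.2.symm⟩
  · intro v hv; exact h2 v (Finset.mem_filter.1 hv).1
  · intro v hv; exact (Finset.mem_filter.1 hv).2

theorem IsMat.maps {K : SimpleGraph V} {S : Finset V} {m : V → V} (h : IsMat K S m) :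
    ∀ v ∈ S, m v ∈ S := by
  intro v hv
  by_cases hh : m v = v
  · rwa [hh]
  · exact h.mem' hh

/-- `K[B]` is factor-critical: for each `x ∈ B` the graph `K[B - x]` has a perfect matching. -/
def FactorCritical (K : SimpleGraph V) (B : Finset V) : Prop :=
  ∀ x ∈ B, ∃ θ : V → V, IsMat K B θ ∧ θ x = x ∧ ∀ v ∈ B, v ≠ x → θ v ≠ v

/-- The Berge formula with a barrier all of whose parts are factor-critical. -/
theorem berge [Fintype V] (K : SimpleGraph V) : ∀ (d : ℕ) (S : Finset V), S.card = d →
    ∃ (A : Finset V) (P : Finset (Finset V)) (m : V → V),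
      A ⊆ S ∧ (∀ B ∈ P, B ⊆ S ∧ Disjoint B A ∧ FactorCritical K B ∧ B.Nonempty) ∧
      (∀ v ∈ S, v ∉ A → ∃ B ∈ P, v ∈ B) ∧
      (∀ B ∈ P, ∀ B' ∈ P, ∀ v ∈ B, ∀ v' ∈ B', v = v' ∨ K.Adj v v' → B = B') ∧
      IsMaxMat K S m ∧ (fixedIn S m).card + A.card = P.card := by
  intro d
  induction d using Nat.strong_induction_on with
  | _ d ih =>
  intro S hS
  obtain ⟨m, hm⟩ := exists_isMaxMat K S
  by_cases hcov : ∃ v ∈ S, ∀ m', IsMaxMat K S m' → m' v ≠ v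
  · obtain ⟨v, hvS, hv⟩ := hcov
    obtain ⟨A, P, m', hA, hP, hcover, hsep, hm', hcard⟩ :=
      ih (S.erase v).card (by rw [← hS]; exact Finset.card_erase_lt_of_mem hvS) (S.erase v) rfl
    have hvA : v ∉ A := fun h => (Finset.notMem_erase v S) (hA h)
    have hm'v : m' v = v := by
      by_contra h; exact Finset.notMem_erase v S (hm'.1.mem v h)
    have hm'S : IsMat K S m' :=
      ⟨hm'.1.invol, hm'.1.adj, fun x hx => Finset.mem_of_mem_erase (hm'.1.mem x hx)⟩
    have hfix' : (fixedIn S m').card = (fixedIn (S.erase v) m').card + 1 := by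
      have : fixedIn S m' = insert v (fixedIn (S.erase v) m') := by
        ext x; simp only [mem_fixedIn, Finset.mem_insert, Finset.mem_erase]
        by_cases hx : x = v
        · subst hx; simp [hvS, hm'v]
        · simp [hx]
      rw [this, Finset.card_insert_of_notMem]
      simp [mem_fixedIn]
    -- deleting `v` from `m`
    have hle : (fixedIn (S.erase v) m').card ≤ (fixedIn S m).card + 1 := by
      have hmv := hv m hm
      set u := m v with hu
      have hmu : m u = v := hm.1.invol v
      set m'' : V → V := fun x => if x = v ∨ x = u then x else m x with hm''
      have hmat : IsMat K (S.erase v) m'' := by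
        refine ⟨?_, ?_, ?_⟩
        · intro x
          by_cases hx : x = v ∨ x = u
          · simp [hm'', hx]
          · have h2 : ¬ (m x = v ∨ m x = u) := by
              push Not at hx ⊢
              exact ⟨fun h => hx.2 (hm.1.inj (h.trans hmu.symm)), fun h => hx.1 (hm.1.inj h)⟩
            simp only [hm'', if_neg hx, if_neg h2, hm.1.invol]
        · intro x hx
          by_cases hxx : x = v ∨ x = u
          · simp [hm'', hxx] at hx
          · simp only [hm'', if_neg hxx] at hx ⊢; exact hm.1.adj x hx
        · intro x hx
          by_cases hxx : x = v ∨ x = u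
          · simp [hm'', hxx] at hx
          · simp only [hm'', if_neg hxx] at hx
            push Not at hxx
            exact Finset.mem_erase.2 ⟨hxx.1, hm.1.mem x hx⟩
      refine (hm'.2 _ hmat).trans ?_
      have : fixedIn (S.erase v) m'' ⊆ insert u (fixedIn S m) := by
        intro x hx
        simp only [mem_fixedIn, Finset.mem_insert, Finset.mem_erase] at hx ⊢
        by_cases hxu : x = u
        · exact Or.inl hxu
        · right
          refine ⟨hx.1.2, ?_⟩
          have hne : ¬ (x = v ∨ x = u) := fun h => h.elim hx.1.1 hxu
          have := hx.2
          simpa only [hm'', if_neg hne] using this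
      exact (Finset.card_le_card this).trans (Finset.card_insert_le _ _)
    -- Matchings of S leave uncovered sets of equal parity. If deleting v did not raise the
    -- deficiency, `m'` would be a maximum matching of S that misses v.
    have hge : (fixedIn S m).card + 1 ≤ (fixedIn (S.erase v) m').card := by
      by_contra hlt
      have p1 := even_card_add_fixed hm.1.maps (fun v _ => hm.1.invol v)
      have p2 := even_card_add_fixed hm'S.maps (fun v _ => hm'S.invol v)
      have : (fixedIn S m').card ≤ (fixedIn S m).card := by
        rw [Nat.even_iff] at p1 p2; omega
      exact hv m' ⟨hm'S, fun m₀ hm₀ => this.trans (hm.2 m₀ hm₀)⟩ hm'v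
    refine ⟨insert v A, P, m, ?_, ?_, ?_, hsep, hm, ?_⟩
    · intro x hx
      rcases Finset.mem_insert.1 hx with rfl | hx
      · exact hvS
      · exact Finset.mem_of_mem_erase (hA hx)
    · intro B hB
      obtain ⟨b1, b2, b3⟩ := hP B hB
      refine ⟨fun x hx => Finset.mem_of_mem_erase (b1 hx), ?_, b3⟩
      rw [Finset.disjoint_insert_right]
      exact ⟨fun h => Finset.notMem_erase v S (b1 h), b2⟩
    · intro x hx hxA
      rw [Finset.mem_insert] at hxA
      push Not at hxA
      exact hcover x (Finset.mem_erase.2 ⟨hxA.1, hx⟩) hxA.2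
    · rw [Finset.card_insert_of_notMem hvA]; omega
  · push Not at hcov
    -- the relation "no maximum matching misses both" is an equivalence relation
    let r : V → V → Prop := fun u v => u = v ∨ ∀ m', IsMaxMat K S m' → m' u = u → m' v ≠ v
    have hrefl : ∀ u, r u u := fun u => Or.inl rfl
    have hsymm : ∀ u v, r u v → r v u := by
      rintro u v (h | h)
      · exact Or.inl h.symm
      · right; intro m' hm' h1 h2; exact h m' hm' h2 h1
    have htrans : ∀ u v w, v ∈ S → r u v → r v w → r u w := by
      intro u v w hvS huv hvw
      rcases huv with rfl | huv
      · exact hvw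
      rcases hvw with rfl | hvw
      · exact Or.inr huv
      by_cases huw : u = w
      · exact Or.inl huw
      right
      intro m₁ hm₁ hu hw
      obtain ⟨m₂, hm₂, hv⟩ := hcov v hvS
      -- Gallai's argument: the exchanged matching misses v and all but one of the vertices missed
      -- by `m₁`, hence v together with u or w.
      obtain ⟨m', hm', hv', ⟨e, he⟩, -⟩ := exchange hm₁ _ m₂ v hm₂ hvS hv rfl
      by_cases hue : u = e
      · exact hvw m' hm' hv' (he w hw (fun h => huw (hue.trans h.symm)))
      · exact huv m' hm' (he u hu hue) hv'
    have hadj : ∀ u v, u ∈ S → v ∈ S → K.Adj u v → r u v := by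
      intro u v hu hv huv
      right
      intro m' hm' h1 h2
      obtain ⟨m'', h'', hlt⟩ := hm'.1.add h1 h2 hu hv huv
      exact absurd (hm'.2 _ h'') (not_le.2 hlt)
    let cls : V → Finset V := fun u => S.filter (fun v => r u v)
    have hcls : ∀ u v, u ∈ S → v ∈ S → r u v → cls u = cls v := by
      intro u v hu hv huv
      ext x
      simp only [cls, Finset.mem_filter, and_congr_right_iff]
      intro hx
      exact ⟨fun h => htrans _ _ _ hu (hsymm _ _ huv) h, fun h => htrans _ _ _ hv huv h⟩
    have hself : ∀ u, u ∈ S → u ∈ cls u := fun u hu => Finset.mem_filter.2 ⟨hu, hrefl u⟩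
    have hcrit : ∀ u ∈ S, ∀ x ∈ cls u, ∀ m', IsMaxMat K S m' → m' x = x →
        ∃ θ : V → V, IsMat K (cls u) θ ∧ θ x = x ∧ ∀ v ∈ cls u, v ≠ x → θ v ≠ v := by
      intro u hu x hx m' hm' hx'
      have hxS : x ∈ S := (Finset.mem_filter.1 hx).1
      have hclosed : ∀ v ∈ cls u, m' v ∈ cls u := by
        intro v hv
        by_cases hvf : m' v = v
        · rwa [hvf]
        have hvS := (Finset.mem_filter.1 hv).1
        exact Finset.mem_filter.2 ⟨hm'.1.maps v hvS,
          htrans _ _ _ hvS (Finset.mem_filter.1 hv).2 (hadj _ _ hvS (hm'.1.maps v hvS)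
            (hm'.1.adj v hvf))⟩
      refine ⟨fun v => if v ∈ cls u then m' v else v, ⟨?_, ?_, ?_⟩, ?_, ?_⟩
      · intro v
        by_cases hv : v ∈ cls u
        · simp [hv, hclosed v hv, hm'.1.invol]
        · simp [hv]
      · intro v hv
        by_cases hvc : v ∈ cls u
        · simp only [hvc, if_true] at hv ⊢; exact hm'.1.adj v hv
        · simp [hvc] at hv
      · intro v hv
        by_contra hvc
        simp [hvc] at hv
      · simp [hx']
      · intro v hv hvx
        simp only [hv, if_true]
        have : r x v := htrans _ _ _ hu (hsymm _ _ (Finset.mem_filter.1 hx).2)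
          (Finset.mem_filter.1 hv).2
        rcases this with h | h
        · exact absurd h.symm hvx
        · exact h m' hm' hx'
    refine ⟨∅, S.image cls, m, by simp, ?_, ?_, ?_, hm, ?_⟩
    · intro B hB
      obtain ⟨u, hu, rfl⟩ := Finset.mem_image.1 hB
      refine ⟨Finset.filter_subset _ _, by simp, ?_, ⟨u, hself u hu⟩⟩
      intro x hx
      obtain ⟨m', hm', hx'⟩ := hcov x (Finset.mem_filter.1 hx).1
      exact hcrit u hu x hx m' hm' hx'
    · intro v hv _
      exact ⟨cls v, Finset.mem_image_of_mem _ hv, hself v hv⟩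
    · intro B hB B' hB' v hv v' hv' h
      obtain ⟨u, hu, rfl⟩ := Finset.mem_image.1 hB
      obtain ⟨u', hu', rfl⟩ := Finset.mem_image.1 hB'
      obtain ⟨hvS, huv⟩ := Finset.mem_filter.1 hv
      obtain ⟨hvS', huv'⟩ := Finset.mem_filter.1 hv'
      rw [hcls u v hu hvS huv, hcls u' v' hu' hvS' huv']
      apply hcls v v' hvS hvS'
      rcases h with h | h
      · exact Or.inl h
      · exact hadj v v' hvS hvS' h
    -- The barrier is empty here, and m misses exactly one vertex of each class: no two by the
    -- definition of the relation, and at least one by parity.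
    · rw [Finset.card_empty, add_zero]
      apply Finset.card_bij (fun v _ => cls v)
      · intro v hv; exact Finset.mem_image_of_mem _ (mem_fixedIn.1 hv).1
      · intro v hv w hw hvw
        obtain ⟨hvS, hvf⟩ := mem_fixedIn.1 hv
        obtain ⟨hwS, hwf⟩ := mem_fixedIn.1 hw
        have hvw' : cls v = cls w := hvw
        have : w ∈ cls v := by rw [hvw']; exact hself w hwS
        rcases (Finset.mem_filter.1 this).2 with h | h
        · exact h
        · exact absurd hwf (h m hm hvf)
      · intro B hB
        obtain ⟨u, hu, rfl⟩ := Finset.mem_image.1 hB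
        obtain ⟨m', hm', hu'⟩ := hcov u hu
        obtain ⟨θ, hθ, hθu, hθ'⟩ := hcrit u hu u (hself u hu) m' hm' hu'
        -- the class has odd size, so `m` fixes one of its points
        have hone : (fixedIn (cls u) θ) = {u} := by
          ext x
          rw [mem_fixedIn, Finset.mem_singleton]
          constructor
          · rintro ⟨h1, h2⟩
            by_contra hne; exact hθ' x h1 hne h2
          · rintro rfl; exact ⟨hself _ hu, hθu⟩
        have p1 := even_card_add_fixed hθ.maps (fun v _ => hθ.invol v)
        rw [hone, Finset.card_singleton] at p1
        have hclosed : ∀ v ∈ cls u, m v ∈ cls u := by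
          intro v hv
          by_cases hvf : m v = v
          · rwa [hvf]
          have hvS := (Finset.mem_filter.1 hv).1
          exact Finset.mem_filter.2 ⟨hm.1.maps v hvS,
            htrans _ _ _ hvS (Finset.mem_filter.1 hv).2 (hadj _ _ hvS (hm.1.maps v hvS)
              (hm.1.adj v hvf))⟩
        have p2 := even_card_add_fixed hclosed (fun v _ => hm.1.invol v)
        have hpos : (fixedIn (cls u) m).Nonempty := by
          rw [← Finset.card_pos]
          rw [Nat.even_iff] at p1 p2; omega
        obtain ⟨v, hv⟩ := hpos
        obtain ⟨hvc, hvf⟩ := mem_fixedIn.1 hv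
        have hvS := (Finset.mem_filter.1 hvc).1
        exact ⟨v, mem_fixedIn.2 ⟨hvS, hvf⟩, (hcls u v hu hvS (Finset.mem_filter.1 hvc).2).symm⟩

end RainbowMatching

/-! ### Short augmenting paths -/

namespace RainbowMatching

variable {V : Type*}

/-- The alternating step x ↦ ρ (m x) can be undone, and a walk that has not stopped never returns to
a vertex missed by ρ. Running two coinciding walks backwards therefore leads to the same start after
the same number of steps: alternating walks are disjoint and do not repeat vertices. -/
theorem iterate_injOn_of_not_stop {ρ m : V → V} (hρ : ∀ v, ρ (ρ v) = v) (hm : ∀ v, m (m v) = v) :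
    ∀ (i j : ℕ) (u u' : V), ρ u = u → ρ u' = u' →
      (∀ t < i, ρ (m ((fun x => ρ (m x))^[t] u)) ≠ m ((fun x => ρ (m x))^[t] u)) →
      (∀ t < j, ρ (m ((fun x => ρ (m x))^[t] u')) ≠ m ((fun x => ρ (m x))^[t] u')) →
      (fun x => ρ (m x))^[i] u = (fun x => ρ (m x))^[j] u' → i = j ∧ u = u' := by
  have aux : ∀ (j : ℕ) (u u' : V), ρ u = u →
      (∀ t < j + 1, ρ (m ((fun x => ρ (m x))^[t] u')) ≠ m ((fun x => ρ (m x))^[t] u')) →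
      u ≠ (fun x => ρ (m x))^[j + 1] u' := by
    intro j u u' hu hs h
    rw [Function.iterate_succ_apply'] at h
    apply hs j (Nat.lt_succ_self j)
    have : ρ u = m ((fun x => ρ (m x))^[j] u') := by rw [h]; exact hρ _
    rw [← this, hu, hu]
  intro i
  induction i with
  | zero =>
    intro j u u' hu hu' h1 h2 h
    cases j with
    | zero => exact ⟨rfl, h⟩
    | succ j => exact absurd h (aux j u u' hu h2)
  | succ i ih =>
    intro j u u' hu hu' h1 h2 h
    cases j with
    | zero => exact absurd h.symm (aux i u' u hu' h1)
    | succ j =>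
      rw [Function.iterate_succ_apply', Function.iterate_succ_apply'] at h
      have h3 : (fun x => ρ (m x))^[i] u = (fun x => ρ (m x))^[j] u' := by
        have := congrArg m (congrArg ρ h)
        simpa [hρ, hm] using this
      obtain ⟨a, b⟩ := ih j u u' hu hu' (fun t ht => h1 t (ht.trans (Nat.lt_succ_self i)))
        (fun t ht => h2 t (ht.trans (Nat.lt_succ_self j))) h3
      exact ⟨by rw [a], b⟩

/-- A short augmenting path of `ρ` inside `ρ ∪ m`, given as its vertex set. -/
def ShortAug (S : Finset V) (ρ m : V → V) (b : ℕ) : Prop :=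
  ∃ (u u' : V) (C : Finset V), u ≠ u' ∧ u ∈ C ∧ u' ∈ C ∧ C ⊆ S ∧ (∀ v ∈ C, ρ v ∈ C) ∧
    (∀ v ∈ C, m v ∈ C) ∧ (∀ v ∈ C, m v ≠ v) ∧ ρ u = u ∧ ρ u' = u' ∧
    (∀ v ∈ C, ρ v = v → v = u ∨ v = u') ∧ C.card ≤ b

/-- The first i + 1 edges of m on the walk form the augmenting path: it starts at u, missed by ρ,
and stops because ρ misses the far end of the last m-edge. -/
theorem shortAug_of_stop {K : SimpleGraph V} {S : Finset V} {ρ m : V → V} (hρ : IsMat K S ρ)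
    (hm : IsMat K S m) {u : V} (huS : u ∈ S) (hu : ρ u = u) {i : ℕ}
    (hs : ∀ t < i, m ((fun x => ρ (m x))^[t] u) ≠ (fun x => ρ (m x))^[t] u ∧
      ρ (m ((fun x => ρ (m x))^[t] u)) ≠ m ((fun x => ρ (m x))^[t] u))
    (h1 : m ((fun x => ρ (m x))^[i] u) ≠ (fun x => ρ (m x))^[i] u)
    (h2 : ρ (m ((fun x => ρ (m x))^[i] u)) = m ((fun x => ρ (m x))^[i] u)) :
    ShortAug S ρ m (2 * (i + 1)) := by
  set w : ℕ → V := fun t => (fun x => ρ (m x))^[t] u with hw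
  have hw0 : w 0 = u := rfl
  have hws : ∀ t, w (t + 1) = ρ (m (w t)) := fun t => Function.iterate_succ_apply' _ _ _
  have hs' : ∀ t < i, m (w t) ≠ w t ∧ ρ (m (w t)) ≠ m (w t) := hs
  have h1' : m (w i) ≠ w i := h1
  have h2' : ρ (m (w i)) = m (w i) := h2
  have hnf : ∀ t ≤ i, m (w t) ≠ w t := by
    intro t ht
    rcases Nat.lt_or_eq_of_le ht with h | rfl
    · exact (hs' t h).1
    · exact h1'
  have hwS : ∀ t, w t ∈ S := by
    intro t
    induction t with
    | zero => exact huS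
    | succ t ih => rw [hws]; exact hρ.maps _ (hm.maps _ ih)
  set C : Finset V := (Finset.range (i + 1)).image w ∪ (Finset.range (i + 1)).image (fun t => m (w t))
    with hC
  have hmemC : ∀ v, v ∈ C ↔ (∃ t, t ≤ i ∧ w t = v) ∨ (∃ t, t ≤ i ∧ m (w t) = v) := by
    intro v
    simp only [hC, Finset.mem_union, Finset.mem_image, Finset.mem_range, Nat.lt_succ_iff]
  have hρC : ∀ v ∈ C, ρ v ∈ C := by
    intro v hv
    rw [hmemC] at hv ⊢
    rcases hv with ⟨t, ht, rfl⟩ | ⟨t, ht, rfl⟩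
    · cases t with
      | zero => left; exact ⟨0, ht, by rw [hw0, hu]⟩
      | succ t => right; exact ⟨t, by omega, by rw [hws, hρ.invol]⟩
    · rcases Nat.lt_or_eq_of_le ht with h | rfl
      · left; exact ⟨t + 1, h, hws t⟩
      · right; exact ⟨t, le_rfl, h2'.symm⟩
  have hmC : ∀ v ∈ C, m v ∈ C := by
    intro v hv
    rw [hmemC] at hv ⊢
    rcases hv with ⟨t, ht, rfl⟩ | ⟨t, ht, rfl⟩
    · right; exact ⟨t, ht, rfl⟩
    · left; exact ⟨t, ht, (hm.invol _).symm⟩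
  have hfix : ∀ v ∈ C, m v ≠ v := by
    intro v hv
    rw [hmemC] at hv
    rcases hv with ⟨t, ht, rfl⟩ | ⟨t, ht, rfl⟩
    · exact hnf t ht
    · rw [hm.invol]; exact (hnf t ht).symm
  have hρfix : ∀ v ∈ C, ρ v = v → v = u ∨ v = m (w i) := by
    intro v hv hvf
    rw [hmemC] at hv
    rcases hv with ⟨t, ht, rfl⟩ | ⟨t, ht, rfl⟩
    · cases t with
      | zero => left; rfl
      | succ t =>
        exfalso
        apply (hs' t (by omega)).2
        have : ρ (w (t + 1)) = m (w t) := by rw [hws, hρ.invol]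
        rw [← hws, ← this, hvf]
    · rcases Nat.lt_or_eq_of_le ht with h | rfl
      · exact absurd hvf (hs' t h).2
      · right; rfl
  have huC : u ∈ C := (hmemC u).2 (Or.inl ⟨0, Nat.zero_le _, rfl⟩)
  have hu'C : m (w i) ∈ C := (hmemC _).2 (Or.inr ⟨i, le_rfl, rfl⟩)
  refine ⟨u, m (w i), C, ?_, huC, hu'C, ?_, hρC, hmC, hfix, hu, h2', hρfix, ?_⟩
  -- The two ends differ by parity: m pairs up all of C, so |C| is even, whereas ρ would miss
  -- exactly one point of C if they coincided.
  · intro heq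
    have p1 := even_card_of_invol hmC (fun v _ => hm.invol v) hfix
    have p2 := even_card_add_fixed hρC (fun v _ => hρ.invol v)
    have : fixedIn C ρ = {u} := by
      ext v
      rw [mem_fixedIn, Finset.mem_singleton]
      constructor
      · rintro ⟨a, b⟩
        rcases hρfix v a b with h | h
        · exact h
        · rw [h, ← heq]
      · rintro rfl; exact ⟨huC, hu⟩
    rw [this, Finset.card_singleton] at p2
    rw [Nat.even_iff] at p1 p2; omega
  · intro v hv
    rw [hmemC] at hv
    rcases hv with ⟨t, ht, rfl⟩ | ⟨t, ht, rfl⟩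
    · exact hwS t
    · exact hm.maps _ (hwS t)
  · refine (Finset.card_union_le _ _).trans ?_
    have c1 := Finset.card_image_le (s := Finset.range (i + 1)) (f := w)
    have c2 := Finset.card_image_le (s := Finset.range (i + 1)) (f := fun t => m (w t))
    rw [Finset.card_range] at c1 c2
    omega

theorem ShortAug.mono {S : Finset V} {ρ m : V → V} {b b' : ℕ} (h : ShortAug S ρ m b)
    (hb : b ≤ b') : ShortAug S ρ m b' := by
  obtain ⟨u, u', C, h1, h2, h3, h4, h5, h6, h7, h8, h9, h10, h11⟩ := h
  exact ⟨u, u', C, h1, h2, h3, h4, h5, h6, h7, h8, h9, h10, h11.trans hb⟩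

/-- If `m` is a sufficiently larger matching than `ρ`, then there is a short augmenting path. -/
theorem exists_shortAug {K : SimpleGraph V} {S : Finset V} {ρ m : V → V} (hρ : IsMat K S ρ)
    (hm : IsMat K S m) (l : ℕ)
    (hlt : (l + 1) * (fixedIn S m).card + S.card < (l + 2) * (fixedIn S ρ).card) :
    ShortAug S ρ m (2 * (l + 1)) := by
  by_contra hno
  set w : V → ℕ → V := fun u t => (fun x => ρ (m x))^[t] u with hw
  set U := fixedIn S ρ with hU
  -- Without a short augmenting path, the walk from a vertex missed by ρ either reaches a vertex
  -- missed by m within l steps or uses l + 1 edges of m whose far ends ρ covers. Walks are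
  -- disjoint, so the first kind is bounded by the deficiency of m and the second by the number of
  -- covered vertices over l + 1.
  let Lg : Finset V := U.filter (fun u => ∀ t ≤ l, m (w u t) ≠ w u t ∧ ρ (m (w u t)) ≠ m (w u t))
  let Sh : Finset V :=
    U.filter (fun u => ¬ ∀ t ≤ l, m (w u t) ≠ w u t ∧ ρ (m (w u t)) ≠ m (w u t))
  have hsum : Lg.card + Sh.card = U.card := Finset.card_filter_add_card_filter_not _
  have hwS : ∀ u ∈ S, ∀ t, w u t ∈ S := by
    intro u huS t
    induction t with
    | zero => exact huS
    | succ t ih =>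
      have : w u (t + 1) = ρ (m (w u t)) := Function.iterate_succ_apply' _ _ _
      rw [this]; exact hρ.maps _ (hm.maps _ ih)
  have hshort : ∀ u ∈ Sh, ∃ i, i ≤ l ∧ m (w u i) = w u i ∧ ∀ t < i, ρ (m (w u t)) ≠ m (w u t) := by
    intro u hu
    obtain ⟨huU, hnl⟩ := Finset.mem_filter.1 hu
    obtain ⟨huS, huf⟩ := mem_fixedIn.1 huU
    have hex : ∃ t, t ≤ l ∧ ¬ (m (w u t) ≠ w u t ∧ ρ (m (w u t)) ≠ m (w u t)) := by
      by_contra h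
      push Not at h
      exact hnl (fun t ht => h t ht)
    set i := Nat.find hex with hi
    obtain ⟨hil, hist⟩ := Nat.find_spec hex
    have hbef : ∀ t < i, m (w u t) ≠ w u t ∧ ρ (m (w u t)) ≠ m (w u t) := by
      intro t ht
      have := Nat.find_min hex ht
      by_contra hcon
      exact this ⟨(ht.le).trans hil, hcon⟩
    refine ⟨i, hil, ?_, fun t ht => (hbef t ht).2⟩
    by_contra hne
    have h2 : ρ (m (w u i)) = m (w u i) := by
      by_contra h2; exact hist ⟨hne, h2⟩
    exact hno ((shortAug_of_stop hρ hm huS huf hbef hne h2).mono (by omega))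
  choose! idx hidx using hshort
  have hSh : Sh.card ≤ (fixedIn S m).card := by
    apply Finset.card_le_card_of_injOn (fun u => w u (idx u))
    · intro u hu
      have hu' := Finset.mem_coe.1 hu
      exact Finset.mem_coe.2 (mem_fixedIn.2
        ⟨hwS u (mem_fixedIn.1 (Finset.mem_filter.1 hu').1).1 _, (hidx u hu').2.1⟩)
    · intro u hu u' hu' h
      have hu1 := Finset.mem_coe.1 hu
      have hu2 := Finset.mem_coe.1 hu'
      exact (iterate_injOn_of_not_stop hρ.invol hm.invol _ _ u u'
        (mem_fixedIn.1 (Finset.mem_filter.1 hu1).1).2 (mem_fixedIn.1 (Finset.mem_filter.1 hu2).1).2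
        (hidx u hu1).2.2 (hidx u' hu2).2.2 h).2
  have hLg : Lg.card * (l + 1) + U.card ≤ S.card := by
    have h1 := Finset.card_filter_add_card_filter_not (s := S) (fun v => ρ v = v)
    have h2 : (Lg ×ˢ Finset.range (l + 1)).card ≤ (S.filter (fun v => ¬ ρ v = v)).card := by
      apply Finset.card_le_card_of_injOn (fun p => m (w p.1 p.2))
      · rintro ⟨u, t⟩ hp
        obtain ⟨hu, ht⟩ := Finset.mem_product.1 (Finset.mem_coe.1 hp)
        obtain ⟨huU, hlong⟩ := Finset.mem_filter.1 hu
        exact Finset.mem_coe.2 (Finset.mem_filter.2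
          ⟨hm.maps _ (hwS u (mem_fixedIn.1 huU).1 t), (hlong t (by simpa [Nat.lt_succ_iff] using ht)).2⟩)
      · rintro ⟨u, t⟩ hp ⟨u', t'⟩ hp' h
        obtain ⟨hu, ht⟩ := Finset.mem_product.1 (Finset.mem_coe.1 hp)
        obtain ⟨hu', ht'⟩ := Finset.mem_product.1 (Finset.mem_coe.1 hp')
        obtain ⟨huU, hlong⟩ := Finset.mem_filter.1 hu
        obtain ⟨huU', hlong'⟩ := Finset.mem_filter.1 hu'
        have ht1 : t ≤ l := by simpa [Nat.lt_succ_iff] using ht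
        have ht2 : t' ≤ l := by simpa [Nat.lt_succ_iff] using ht'
        obtain ⟨a, b⟩ := iterate_injOn_of_not_stop hρ.invol hm.invol t t' u u'
          (mem_fixedIn.1 huU).2 (mem_fixedIn.1 huU').2
          (fun s hs => (hlong s (by omega)).2) (fun s hs => (hlong' s (by omega)).2) (hm.inj h)
        simp [a, b]
    rw [Finset.card_product, Finset.card_range] at h2
    have : (fixedIn S ρ).card = (S.filter (fun v => ρ v = v)).card := rfl
    rw [hU, this]; omega
  nlinarith
end RainbowMatching

/-! ### Local modifications of a rainbow matching -/

namespace RainbowMatching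

/-- A matching `σ` together with colour classes `μ r` (all encoded by involutions), a set `R` of
colours not used by `σ` and a threshold `t` above which a multiplicity counts as large. -/
structure Config (V ι : Type*) where
  σ : V → V
  R : Finset ι
  μ : ι → V → V
  t : ℕ
  σ_invol : ∀ v, σ (σ v) = v
  μ_invol : ∀ r v, μ r (μ r v) = v

namespace Config

variable {V ι : Type*} (c : Config V ι)

/-- The graph of the pairs that are matched by `σ` or have large multiplicity in the colours `R`. -/
noncomputable def K : SimpleGraph V where
  Adj x y := x ≠ y ∧ (c.σ x = y ∨ c.t ≤ (c.R.filter (fun r => c.μ r x = y)).card)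
  symm := ⟨by
    rintro x y ⟨hne, h⟩
    refine ⟨hne.symm, ?_⟩
    rcases h with h | h
    · left; rw [← h, c.σ_invol]
    · right
      have : c.R.filter (fun r => c.μ r y = x) = c.R.filter (fun r => c.μ r x = y) := by
        apply Finset.filter_congr
        intro r _
        constructor
        · intro h; rw [← h, c.μ_invol]
        · intro h; rw [← h, c.μ_invol]
      rwa [this]⟩
  loopless := ⟨fun x h => h.1 rfl⟩

/-- `v` lies on an edge of `τ` outside the graph `K`. -/
def Thin (τ : V → V) (v : V) : Prop := τ v ≠ v ∧ ¬ c.K.Adj v (τ v)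

/-- A matching on `S` all of whose edges outside `K` are given distinct colours of `R`. -/
structure IsPre (S : Finset V) (τ : V → V) (γ : V → ι) : Prop where
  maps : ∀ v ∈ S, τ v ∈ S
  invol : ∀ v ∈ S, τ (τ v) = v
  thin : ∀ v ∈ S, c.Thin τ v → γ v ∈ c.R ∧ c.μ (γ v) v = τ v ∧ γ (τ v) = γ v
  inj : ∀ v ∈ S, ∀ w ∈ S, c.Thin τ v → c.Thin τ w → γ v = γ w → w = v ∨ w = τ v

/-- A local modification of `σ`, on a set closed under `σ`. -/
structure IsPatch (W : Finset V) (τ : V → V) (γ : V → ι) : Prop extends c.IsPre W τ γ where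
  closed : ∀ v ∈ W, c.σ v ∈ W

/-- No small local modification of `σ` covers more vertices. -/
def NoAug : Prop := ∀ (W : Finset V) (τ : V → V) (γ : V → ι), c.IsPatch W τ γ → W.card ≤ c.t →
  (fixedIn W c.σ).card ≤ (fixedIn W τ).card

variable {c}

theorem thin_congr {τ τ' : V → V} {v : V} (h : τ v = τ' v) : c.Thin τ v ↔ c.Thin τ' v := by
  unfold Thin; rw [h]

/-- This is the tool for composing changes: on S the new matching θ takes over, which breaks no edge
of τ because τ leaves every point of W ∩ S uncovered. Only the colours of edges outside K have to be
kept apart. -/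
theorem IsPatch.glue {W S : Finset V} {τ θ : V → V} {γ δ : V → ι} (hW : c.IsPatch W τ γ)
    (hS : c.IsPre S θ δ) (hcl : ∀ v ∈ S, v ∉ W → c.σ v ∈ S) (hfix : ∀ v ∈ S, v ∈ W → τ v = v)
    (hcol : ∀ v ∈ W, c.Thin τ v → ∀ w ∈ S, c.Thin θ w → γ v ≠ δ w) :
    c.IsPatch (W ∪ S) (fun v => if v ∈ S then θ v else τ v) (fun v => if v ∈ S then δ v else γ v) := by
  have hτS : ∀ v ∈ W, v ∉ S → τ v ∉ S := by
    intro v hv hvS hh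
    have := hfix _ hh (hW.maps v hv)
    rw [hW.invol v hv] at this
    rw [← this] at hh; exact hvS hh
  have hWof : ∀ v, v ∈ W ∪ S → v ∉ S → v ∈ W := fun v hv hvS =>
    (Finset.mem_union.1 hv).resolve_right hvS
  have tS : ∀ v ∈ S, (c.Thin (fun v => if v ∈ S then θ v else τ v) v ↔ c.Thin θ v) :=
    fun v hv => thin_congr (by simp [hv])
  have tW : ∀ v, v ∉ S → (c.Thin (fun v => if v ∈ S then θ v else τ v) v ↔ c.Thin τ v) :=
    fun v hv => thin_congr (by simp [hv])
  refine ⟨⟨?_, ?_, ?_, ?_⟩, ?_⟩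
  · intro v hv
    by_cases hvS : v ∈ S
    · simp only [hvS, if_true]; exact Finset.mem_union_right _ (hS.maps v hvS)
    · simp only [hvS, if_false]; exact Finset.mem_union_left _ (hW.maps v (hWof v hv hvS))
  · intro v hv
    by_cases hvS : v ∈ S
    · simp only [hvS, if_true, hS.maps v hvS]; exact hS.invol v hvS
    · have hvW := hWof v hv hvS
      simp only [hvS, if_false, hτS v hvW hvS]; exact hW.invol v hvW
  · intro v hv ht
    by_cases hvS : v ∈ S
    · rw [tS v hvS] at ht
      simp only [hvS, if_true, hS.maps v hvS]; exact hS.thin v hvS ht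
    · have hvW := hWof v hv hvS
      rw [tW v hvS] at ht
      simp only [hvS, if_false, hτS v hvW hvS]; exact hW.thin v hvW ht
  · intro v hv w hw htv htw h
    by_cases hvS : v ∈ S
    · rw [tS v hvS] at htv
      by_cases hwS : w ∈ S
      · rw [tS w hwS] at htw
        simp only [hvS, hwS, if_true] at h ⊢
        exact hS.inj v hvS w hwS htv htw h
      · rw [tW w hwS] at htw
        simp only [hvS, hwS, if_true, if_false] at h
        exact absurd h.symm (hcol w (hWof w hw hwS) htw v hvS htv)
    · rw [tW v hvS] at htv
      by_cases hwS : w ∈ S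
      · rw [tS w hwS] at htw
        simp only [hvS, hwS, if_true, if_false] at h
        exact absurd h (hcol v (hWof v hv hvS) htv w hwS htw)
      · rw [tW w hwS] at htw
        simp only [hvS, hwS, if_false] at h ⊢
        exact hW.inj v (hWof v hv hvS) w (hWof w hw hwS) htv htw h
  · intro v hv
    by_cases hvW : v ∈ W
    · exact Finset.mem_union_left _ (hW.closed v hvW)
    · exact Finset.mem_union_right _ (hcl v ((Finset.mem_union.1 hv).resolve_left hvW) hvW)

/-- Points of W ∩ S are uncovered by τ, so each of them is counted once too often when the two
deficiencies are added. -/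
theorem card_fixed_glue {W S : Finset V} {τ θ : V → V} (hfix : ∀ v ∈ S, v ∈ W → τ v = v) :
    (fixedIn (W ∪ S) (fun v => if v ∈ S then θ v else τ v)).card + (W ∩ S).card =
      (fixedIn S θ).card + (fixedIn W τ).card := by
  have h1 : fixedIn (W ∪ S) (fun v => if v ∈ S then θ v else τ v) =
      fixedIn S θ ∪ (fixedIn W τ \ S) := by
    ext v
    simp only [mem_fixedIn, Finset.mem_union, Finset.mem_sdiff]
    by_cases hvS : v ∈ S <;> simp [hvS]
  have h2 : Disjoint (fixedIn S θ) (fixedIn W τ \ S) := by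
    rw [Finset.disjoint_left]
    intro v hv hv'
    exact (Finset.mem_sdiff.1 hv').2 (mem_fixedIn.1 hv).1
  have h3 : W ∩ S = fixedIn W τ ∩ S := by
    ext v
    simp only [mem_fixedIn, Finset.mem_inter]
    exact ⟨fun h => ⟨⟨h.1, hfix v h.2 h.1⟩, h.2⟩, fun h => ⟨h.1.1, h.2⟩⟩
  rw [h1, Finset.card_union_of_disjoint h2, h3, add_assoc, Finset.card_sdiff_add_card_inter]

theorem card_fixed_le_union {W S : Finset V} {τ : V → V} :
    (fixedIn W τ).card ≤ (fixedIn (W ∪ S) τ).card := by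
  apply Finset.card_le_card
  intro v hv
  rw [mem_fixedIn] at hv ⊢
  exact ⟨Finset.mem_union_left _ hv.1, hv.2⟩

theorem card_fixed_union {W S : Finset V} {τ : V → V} (h : Disjoint W S) :
    (fixedIn (W ∪ S) τ).card = (fixedIn W τ).card + (fixedIn S τ).card := by
  rw [← Finset.card_union_of_disjoint]
  · congr 1
    ext v; simp only [mem_fixedIn, Finset.mem_union]; tauto
  · rw [Finset.disjoint_left] at h ⊢
    intro v hv hv'; exact h (mem_fixedIn.1 hv).1 (mem_fixedIn.1 hv').1

/-! ### Freeing vertices: stages and pieces -/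

variable (c)

/-- Some small local modification of `σ`, disjoint from `Z` and avoiding the colours `Φ`, covers no
fewer vertices than `σ` and leaves `x` uncovered. -/
def Freed (Z : Finset V) (Φ : Finset ι) (b : ℕ) (x : V) : Prop :=
  ∃ (W : Finset V) (τ : V → V) (γ : V → ι), c.IsPatch W τ γ ∧ Disjoint W Z ∧ W.card ≤ b ∧
    (∀ v ∈ W, c.Thin τ v → γ v ∉ Φ) ∧ x ∈ W ∧ τ x = x ∧
    (fixedIn W τ).card ≤ (fixedIn W c.σ).card

/-- After deleting `X`, every vertex left unmatched by `σ` can be freed robustly. -/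
structure Stage (X : Finset V) (z b : ℕ) : Prop where
  moved : ∀ a ∈ X, c.σ a ≠ a
  single : ∀ a ∈ X, c.σ a ∉ X
  freed : ∀ u, u ∉ X → (c.σ u = u ∨ c.σ u ∈ X) → ∀ (Z : Finset V) (Φ : Finset ι),
    (∀ v ∈ Z, c.σ v ∈ Z) → Z.card ≤ z → Φ.card ≤ z → u ∉ Z → c.Freed Z Φ b u

/-- A matching of `K[W]` missing only `x`, where `W` is closed under `σ` apart from one root `u`. -/
structure IsPiece (X W : Finset V) (θ : V → V) (u x : V) : Prop where
  mat : IsMat c.K W θ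
  x_mem : x ∈ W
  fix : θ x = x
  nofix : ∀ v ∈ W, v ≠ x → θ v ≠ v
  u_mem : u ∈ W
  root : c.σ u = u ∨ c.σ u ∈ X
  closed : ∀ v ∈ W, v ≠ u → c.σ v ∈ W
  notMem : ∀ v ∈ W, v ∉ X

variable {c}

theorem σ_inj {v w : V} (h : c.σ v = c.σ w) : v = w := by
  rw [← c.σ_invol v, h, c.σ_invol]

theorem not_thin_of_isMat {S : Finset V} {θ : V → V} (h : IsMat c.K S θ) (v : V) :
    ¬ c.Thin θ v := fun ht => ht.2 (h.adj v ht.1)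

theorem isPre_of_isMat {S : Finset V} {θ : V → V} (h : IsMat c.K S θ) (δ : V → ι) :
    c.IsPre S θ δ :=
  ⟨h.maps, fun v _ => h.invol v, fun v _ ht => absurd ht (not_thin_of_isMat h v),
    fun v _ _ _ ht => absurd ht (not_thin_of_isMat h v)⟩

/-- The partner of the root, if there is one, lies in X and hence outside W. This makes the rest of
the piece admissible as a forbidden set in `Stage.freed`, which must be closed under σ. -/
theorem IsPiece.closed_erase {X W : Finset V} {θ : V → V} {u x : V} (h : c.IsPiece X W θ u x) :
    ∀ v ∈ W.erase u, c.σ v ∈ W.erase u := by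
  intro v hv
  obtain ⟨hvu, hvW⟩ := Finset.mem_erase.1 hv
  refine Finset.mem_erase.2 ⟨?_, h.closed v hvW hvu⟩
  intro hh
  have : c.σ u = v := by rw [← hh, c.σ_invol]
  rcases h.root with h1 | h1
  · exact hvu (this.symm.trans h1)
  · rw [this] at h1; exact h.notMem v hvW h1

theorem IsPiece.fixed_card {X W : Finset V} {θ : V → V} {u x : V} (h : c.IsPiece X W θ u x) :
    (fixedIn W θ).card = 1 := by
  rw [Finset.card_eq_one]
  refine ⟨x, ?_⟩
  ext v
  rw [mem_fixedIn, Finset.mem_singleton]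
  constructor
  · rintro ⟨h1, h2⟩
    by_contra hne; exact h.nofix v h1 hne h2
  · rintro rfl; exact ⟨h.x_mem, h.fix⟩

/-- Free the root u by a change that avoids the rest of the piece, then let θ take over on W: the
hole moves from u to x. The edges of θ lie in K, so no colours are spent. -/
theorem Stage.freed_of_piece {X W : Finset V} {z b : ℕ} {θ : V → V} {u x : V}
    (hX : c.Stage X z b) (hp : c.IsPiece X W θ u x) {Z : Finset V} {Φ : Finset ι}
    (hZ : ∀ v ∈ Z, c.σ v ∈ Z) (hdis : Disjoint W Z) (h1 : Z.card + W.card ≤ z)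
    (h2 : Φ.card ≤ z) : c.Freed Z Φ (b + W.card) x := by
  have hex :=
    hX.freed u (hp.notMem u hp.u_mem) hp.root (Z ∪ W.erase u) Φ ?_ ?_ h2 ?_
  · obtain ⟨W', τ, γ, hpat, hd, hcard, hav, huW, huf, hfix⟩ := hex
    have hdZ : Disjoint W' Z := Disjoint.mono_right Finset.subset_union_left hd
    have hdW : ∀ v ∈ W, v ∈ W' → v = u := by
      intro v hv hv'
      by_contra hne
      exact Finset.disjoint_left.1 hd hv' (Finset.mem_union_right _ (Finset.mem_erase.2 ⟨hne, hv⟩))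
    have hfixW : ∀ v ∈ W, v ∈ W' → τ v = v := by
      intro v hv hv'; rw [hdW v hv hv', huf]
    have hg := hpat.glue (isPre_of_isMat hp.mat γ) (fun v hv hv' => hp.closed v hv
      (fun h => hv' (h ▸ huW))) hfixW (fun v _ _ w _ htw => absurd htw (not_thin_of_isMat hp.mat w))
    refine ⟨_, _, _, hg, ?_, ?_, ?_, Finset.mem_union_right _ hp.x_mem, ?_, ?_⟩
    · rw [Finset.disjoint_union_left]; exact ⟨hdZ, hdis⟩
    · exact (Finset.card_union_le _ _).trans (by omega)
    · intro v hv ht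
      by_cases hvW : v ∈ W
      · rw [thin_congr (τ' := θ) (by simp [hvW])] at ht
        exact absurd ht (not_thin_of_isMat hp.mat v)
      · rw [thin_congr (τ' := τ) (by simp [hvW])] at ht
        simp only [hvW, if_false]
        exact hav v ((Finset.mem_union.1 hv).resolve_right hvW) ht
    · simp [hp.x_mem, hp.fix]
    · have h3 := card_fixed_glue (θ := θ) hfixW
      rw [hp.fixed_card] at h3
      have h4 : 1 ≤ (W' ∩ W).card :=
        Finset.card_pos.2 ⟨u, Finset.mem_inter.2 ⟨huW, hp.u_mem⟩⟩
      have h5 := card_fixed_le_union (W := W') (S := W) (τ := c.σ)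
      omega
  · intro v hv
    rcases Finset.mem_union.1 hv with h | h
    · exact Finset.mem_union_left _ (hZ v h)
    · exact Finset.mem_union_right _ (hp.closed_erase v h)
  · exact (Finset.card_union_le _ _).trans
      ((Nat.add_le_add_left (Finset.card_le_card (Finset.erase_subset _ _)) _).trans h1)
  · intro h
    rcases Finset.mem_union.1 h with h | h
    · exact Finset.disjoint_left.1 hdis hp.u_mem h
    · exact Finset.notMem_erase _ _ h

/-- The ends of two disjoint pieces can be freed simultaneously. -/
theorem Stage.freed_two {X W₁ W₂ : Finset V} {z b : ℕ} {θ₁ θ₂ : V → V} {u₁ u₂ x y : V}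
    (hX : c.Stage X z b) (hp₁ : c.IsPiece X W₁ θ₁ u₁ x) (hp₂ : c.IsPiece X W₂ θ₂ u₂ y)
    (hdis : Disjoint W₁ W₂) {Z : Finset V} {Φ : Finset ι} (hZ : ∀ v ∈ Z, c.σ v ∈ Z)
    (hd₁ : Disjoint W₁ Z) (hd₂ : Disjoint W₂ Z) (hu₂ : c.σ u₂ ∉ Z)
    (h1 : Z.card + W₁.card + W₂.card + b + 1 ≤ z) (h2 : Φ.card + b + W₁.card ≤ z) :
    ∃ (W : Finset V) (τ : V → V) (γ : V → ι), c.IsPatch W τ γ ∧ Disjoint W Z ∧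
      W.card ≤ 2 * b + W₁.card + W₂.card ∧ (∀ v ∈ W, c.Thin τ v → γ v ∉ Φ) ∧
      x ∈ W ∧ y ∈ W ∧ x ≠ y ∧ τ x = x ∧ τ y = y ∧
      (fixedIn W τ).card ≤ (fixedIn W c.σ).card := by
  have hxy : x ≠ y := by
    rintro rfl; exact Finset.disjoint_left.1 hdis hp₁.x_mem hp₂.x_mem
  -- The second piece is protected while x is freed. The partner of `u₂` is included because
  -- forbidden sets must be closed under σ.
  have hex :=
    hX.freed_of_piece hp₁ (Z := Z ∪ (insert (c.σ u₂) W₂)) (Φ := Φ) ?_ ?_ ?_ (by omega)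
  · obtain ⟨W, τ, γ, hpat, hd, hcard, hav, hxW, hxf, hfix⟩ := hex
    have hdZ : Disjoint W Z := Disjoint.mono_right Finset.subset_union_left hd
    have hdW : Disjoint W W₂ := Disjoint.mono_right
      ((Finset.subset_insert _ _).trans Finset.subset_union_right) hd
    -- The second change avoids both the vertices of the first and the colours of its edges, so that
    -- the two can be glued.
    have hex :=
      hX.freed_of_piece hp₂ (Z := Z ∪ W) (Φ := Φ ∪ (W.image γ)) ?_ ?_ ?_ ?_
    · obtain ⟨W', τ', γ', hpat', hd', hcard', hav', hyW, hyf, hfix'⟩ := hex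
      have hdWW : Disjoint W' W := Disjoint.mono_right Finset.subset_union_right hd'
      have hno : ∀ v ∈ W', v ∈ W → τ v = v := fun v hv hv' =>
        absurd hv' (Finset.disjoint_left.1 hdWW hv)
      have hxW' : x ∉ W' := fun h => Finset.disjoint_left.1 hdWW h hxW
      have hg := hpat.glue hpat'.toIsPre (fun v hv _ => hpat'.closed v hv) hno (by
        intro v hv _ w hw htw heq
        exact hav' w hw htw (Finset.mem_union_right _ (Finset.mem_image.2 ⟨v, hv, heq⟩)))
      refine ⟨_, _, _, hg, ?_, ?_, ?_, Finset.mem_union_left _ hxW, Finset.mem_union_right _ hyW,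
        hxy, ?_, ?_, ?_⟩
      · rw [Finset.disjoint_union_left]
        exact ⟨hdZ, Disjoint.mono_right Finset.subset_union_left hd'⟩
      · exact (Finset.card_union_le _ _).trans (by omega)
      · intro v hv ht
        by_cases hvW : v ∈ W'
        · rw [thin_congr (τ' := τ') (by simp [hvW])] at ht
          simp only [hvW, if_true]
          exact fun h => hav' v hvW ht (Finset.mem_union_left _ h)
        · rw [thin_congr (τ' := τ) (by simp [hvW])] at ht
          simp only [hvW, if_false]
          exact hav v ((Finset.mem_union.1 hv).resolve_right hvW) ht
      · simp [hxW', hxf]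
      · simp [hyW, hyf]
      · have h3 := card_fixed_glue (θ := τ') hno
        have h4 := card_fixed_union (τ := c.σ) hdWW.symm
        omega
    · intro v hv
      rcases Finset.mem_union.1 hv with h | h
      · exact Finset.mem_union_left _ (hZ v h)
      · exact Finset.mem_union_right _ (hpat.closed v h)
    · rw [Finset.disjoint_union_right]; exact ⟨hd₂, hdW.symm⟩
    · have := Finset.card_union_le Z W
      omega
    · have := Finset.card_union_le Φ (W.image γ)
      have := Finset.card_image_le (s := W) (f := γ)
      omega
  · intro v hv
    rcases Finset.mem_union.1 hv with h | h
    · exact Finset.mem_union_left _ (hZ v h)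
    · apply Finset.mem_union_right
      rcases Finset.mem_insert.1 h with rfl | h
      · rw [c.σ_invol]; exact Finset.mem_insert_of_mem hp₂.u_mem
      · by_cases hvu : v = u₂
        · subst hvu; exact Finset.mem_insert_self _ _
        · exact Finset.mem_insert_of_mem (hp₂.closed v h hvu)
  · rw [Finset.disjoint_union_right, Finset.disjoint_insert_right]
    refine ⟨hd₁, ?_, hdis⟩
    rcases hp₂.root with h | h
    · rw [h]; exact fun h' => Finset.disjoint_left.1 hdis h' hp₂.u_mem
    · exact fun h' => hp₁.notMem _ h' h
  · have := Finset.card_union_le Z (insert (c.σ u₂) W₂)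
    have := Finset.card_insert_le (c.σ u₂) W₂
    omega

theorem swap_isPre {S : Finset V} {x y : V} (hx : x ∈ S) (hy : y ∈ S) {r : ι}
    (hr : r ∈ c.R) (hμ : c.μ r x = y) : c.IsPre S (Equiv.swap x y) (fun _ => r) := by
  have hμ' : c.μ r y = x := by rw [← hμ, c.μ_invol]
  have key : ∀ v, c.Thin (Equiv.swap x y) v → v = x ∨ v = y := by
    intro v hv
    by_contra h
    push Not at h
    exact hv.1 (Equiv.swap_apply_of_ne_of_ne h.1 h.2)
  refine ⟨?_, fun v _ => by simp, ?_, ?_⟩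
  · intro v hv
    by_cases h1 : v = x
    · subst h1; simpa using hy
    by_cases h2 : v = y
    · subst h2; simpa using hx
    rwa [Equiv.swap_apply_of_ne_of_ne h1 h2]
  · intro v _ ht
    refine ⟨hr, ?_, rfl⟩
    rcases key v ht with rfl | rfl
    · simpa using hμ
    · simpa using hμ'
  · intro v _ w _ htv htw _
    rcases key v htv with rfl | rfl <;> rcases key w htw with rfl | rfl <;> simp

/-- There is no edge of an unused colour between the ends of two disjoint pieces. -/
theorem Stage.no_edge {X W₁ W₂ : Finset V} {z b : ℕ} {θ₁ θ₂ : V → V} {u₁ u₂ x y : V}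
    (hna : c.NoAug) (hX : c.Stage X z b) (hp₁ : c.IsPiece X W₁ θ₁ u₁ x)
    (hp₂ : c.IsPiece X W₂ θ₂ u₂ y) (hdis : Disjoint W₁ W₂)
    (h1 : W₁.card + W₂.card + b + 1 ≤ z) (h3 : 2 * b + W₁.card + W₂.card ≤ c.t)
    {r : ι} (hr : r ∈ c.R) (hμ : c.μ r x = y) : False := by
  -- Free both ends with the colour r kept in reserve. Adding the edge x y in colour r then covers
  -- two more vertices, against `NoAug`.
  obtain ⟨W, τ, γ, hpat, -, hcard, hav, hxW, hyW, hxy, hxf, hyf, hfix⟩ :=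
    hX.freed_two hp₁ hp₂ hdis (Z := ∅) (Φ := {r}) (by simp) (by simp) (by simp) (by simp)
      (by simpa using h1) (by
        have := Finset.card_pos.2 ⟨y, hp₂.x_mem⟩
        rw [Finset.card_singleton]; omega)
  have hsub : ({x, y} : Finset V) ⊆ W := by
    intro v hv
    rcases Finset.mem_insert.1 hv with rfl | hv
    · exact hxW
    · rw [Finset.mem_singleton.1 hv]; exact hyW
  have hfx : ∀ v ∈ ({x, y} : Finset V), v ∈ W → τ v = v := by
    intro v hv _
    rcases Finset.mem_insert.1 hv with rfl | hv
    · exact hxf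
    · rw [Finset.mem_singleton.1 hv]; exact hyf
  have hpre : c.IsPre ({x, y} : Finset V) (Equiv.swap x y) (fun _ => r) :=
    swap_isPre (by simp) (by simp) hr hμ
  have hg := hpat.glue hpre (fun v hv hv' => absurd (hsub hv) hv') hfx (by
    intro v hv ht w _ _ heq
    exact hav v hv ht (by simp [heq]))
  have h4 := card_fixed_glue (θ := Equiv.swap x y) hfx
  have h5 : (fixedIn ({x, y} : Finset V) (Equiv.swap x y)).card = 0 := by
    rw [Finset.card_eq_zero, Finset.eq_empty_iff_forall_notMem]
    intro v hv
    rw [mem_fixedIn] at hv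
    rcases Finset.mem_insert.1 hv.1 with rfl | h
    · exact hxy (by simpa using hv.2.symm)
    · rw [Finset.mem_singleton] at h
      subst h
      exact hxy (by simpa using hv.2)
  have h6 := hna _ _ _ hg (by rw [Finset.union_eq_left.2 hsub]; omega)
  rw [Finset.inter_eq_right.2 hsub, h5, Finset.card_pair hxy] at h4
  rw [Finset.union_eq_left.2 hsub] at h4 h6
  omega

/-- The restriction of `σ` to the complement of `X`. -/
noncomputable def ρ (c : Config V ι) (X : Finset V) : V → V :=
  fun v => if v ∈ X ∨ c.σ v ∈ X then v else c.σ v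

theorem ρ_isMat [Fintype V] (X : Finset V) : IsMat c.K (Finset.univ \ X) (c.ρ X) := by
  refine ⟨?_, ?_, ?_⟩
  · intro v
    by_cases h : v ∈ X ∨ c.σ v ∈ X
    · simp [ρ, h]
    · have h' : ¬ (c.σ v ∈ X ∨ c.σ (c.σ v) ∈ X) := by
        rw [c.σ_invol]; tauto
      simp only [ρ, if_neg h]
      rw [if_neg h', c.σ_invol]
  · intro v hv
    by_cases h : v ∈ X ∨ c.σ v ∈ X
    · simp [ρ, h] at hv
    · simp only [ρ, if_neg h] at hv ⊢
      exact ⟨hv.symm, Or.inl rfl⟩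
  · intro v hv
    by_cases h : v ∈ X ∨ c.σ v ∈ X
    · simp [ρ, h] at hv
    · simp; tauto

theorem ρ_root {X : Finset V} {u : V} (hu : u ∉ X) (h : c.ρ X u = u) :
    c.σ u = u ∨ c.σ u ∈ X := by
  by_cases h' : c.σ u ∈ X
  · exact Or.inr h'
  · left; simpa [ρ, hu, h'] using h

theorem ρ_eq {X : Finset V} {v : V} (h : c.ρ X v ≠ v) : c.ρ X v = c.σ v ∧ v ∉ X ∧ c.σ v ∉ X := by
  by_cases h' : v ∈ X ∨ c.σ v ∈ X
  · simp [ρ, h'] at h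
  · push Not at h'
    exact ⟨by simp [ρ, h'], h'⟩

theorem singleton_isPiece {X : Finset V} {u : V} (hu : u ∉ X) (h : c.σ u = u ∨ c.σ u ∈ X) :
    c.IsPiece X {u} id u u :=
  ⟨⟨fun _ => rfl, fun _ h => absurd rfl h, fun _ h => absurd rfl h⟩, by simp, rfl,
    fun v hv hne => absurd (Finset.mem_singleton.1 hv) hne, by simp, h,
    fun v hv hne => absurd (Finset.mem_singleton.1 hv) hne,
    fun v hv => by rw [Finset.mem_singleton.1 hv]; exact hu⟩

/-- The ends of the path miss the restricted matching `ρ`, so they are roots and can be freed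
together while the rest of the path is forbidden. Following m along the path then covers more
vertices than σ. -/
theorem Stage.not_shortAug [Fintype V] {X : Finset V} {z b l : ℕ} {m : V → V}
    (hna : c.NoAug) (hX : c.Stage X z b) (hm : IsMat c.K (Finset.univ \ X) m)
    (h1 : l + b + 3 ≤ z) (h2 : 2 * b + 2 + l ≤ c.t) :
    ¬ ShortAug (Finset.univ \ X) (c.ρ X) m l := by
  rintro ⟨u, u', C, hne, hu, hu', hCS, hρC, hmC, hmf, hρu, hρu', hroots, hcard⟩
  have hCX : ∀ v ∈ C, v ∉ X := fun v hv => (Finset.mem_sdiff.1 (hCS hv)).2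
  have hin : ∀ v ∈ C, v ≠ u → v ≠ u' → c.σ v ∈ C ∧ c.σ v ≠ u ∧ c.σ v ≠ u' := by
    intro v hv hvu hvu'
    have hnf : c.ρ X v ≠ v := fun h => (hroots v hv h).elim hvu hvu'
    obtain ⟨e, -, -⟩ := ρ_eq hnf
    have hρi : ∀ {v w}, c.ρ X v = c.ρ X w → v = w := fun h => (ρ_isMat (c := c) X).inj h
    rw [← e]
    exact ⟨hρC v hv, fun h => hvu (hρi (h.trans hρu.symm)), fun h => hvu' (hρi (h.trans hρu'.symm))⟩
  have hσroot : ∀ w ∈ C, c.ρ X w = w → c.σ w ∉ (C.erase u).erase u' := by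
    intro w hw hρw h
    simp only [Finset.mem_erase] at h
    obtain ⟨h1, h2, h3⟩ := h
    have := hin _ h3 h2 h1
    rw [c.σ_invol] at this
    exact (hroots w hw hρw).elim this.2.1 this.2.2
  have hex :=
    hX.freed_two (singleton_isPiece (hCX u hu) (ρ_root (hCX u hu) hρu))
      (singleton_isPiece (hCX u' hu') (ρ_root (hCX u' hu') hρu')) (by simpa using hne)
      (Z := (C.erase u).erase u') (Φ := ∅) ?_ (by simp) (by simp) (hσroot u' hu' hρu') ?_ ?_
  · obtain ⟨W, τ, γ, hpat, hd, hWc, -, huW, hu'W, -, huf, huf', hfix⟩ := hex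
    have hWC : ∀ v ∈ C, v ∈ W → v = u ∨ v = u' := by
      intro v hv hvW
      by_contra h
      push Not at h
      exact Finset.disjoint_left.1 hd hvW (by simp [h, hv])
    have hfx : ∀ v ∈ C, v ∈ W → τ v = v := by
      intro v hv hvW
      rcases hWC v hv hvW with rfl | rfl
      · exact huf
      · exact huf'
    have hpre : c.IsPre C m γ :=
      ⟨hmC, fun v _ => hm.invol v, fun v _ ht => absurd ht (not_thin_of_isMat hm v),
        fun v _ _ _ ht => absurd ht (not_thin_of_isMat hm v)⟩
    have hg := hpat.glue hpre (fun v hv hvW => (hin v hv (fun h => hvW (h ▸ huW))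
      (fun h => hvW (h ▸ hu'W))).1) hfx (fun v _ _ w _ htw => absurd htw (not_thin_of_isMat hm w))
    have h4 := card_fixed_glue (θ := m) hfx
    have h5 : (fixedIn C m).card = 0 := by
      rw [Finset.card_eq_zero, Finset.eq_empty_iff_forall_notMem]
      intro v hv
      rw [mem_fixedIn] at hv
      exact hmf v hv.1 hv.2
    have h6 : 1 ≤ (W ∩ C).card := Finset.card_pos.2 ⟨u, Finset.mem_inter.2 ⟨huW, hu⟩⟩
    have h7 := hna _ _ _ hg (by
      have := Finset.card_union_le W C
      simp only [Finset.card_singleton] at hWc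
      omega)
    have h8 := card_fixed_le_union (W := W) (S := C) (τ := c.σ)
    omega
  · intro v hv
    simp only [Finset.mem_erase] at hv ⊢
    obtain ⟨a, b, d⟩ := hin v hv.2.2 hv.2.1 hv.1
    exact ⟨d, b, a⟩
  · have : ((C.erase u).erase u').card ≤ C.card :=
      Finset.card_le_card ((Finset.erase_subset _ _).trans (Finset.erase_subset _ _))
    simp only [Finset.card_singleton]; omega
  · simp only [Finset.card_empty, Finset.card_singleton]; omega

/-- A vertex whose partner sends an edge of an unused colour to the end of a piece can be freed. -/
theorem Stage.freed_partner {X W : Finset V} {z b : ℕ} {θ : V → V} {u x y : V}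
    (hX : c.Stage X z b) (hp : c.IsPiece X W θ u x) (hy : c.σ y ≠ y)
    (hyW : y ∉ W) (hsW : c.σ y ∉ W) {Z : Finset V} {Φ : Finset ι} (hZ : ∀ v ∈ Z, c.σ v ∈ Z)
    (hyZ : y ∉ Z) (hdis : Disjoint W Z) (h1 : Z.card + W.card + 2 ≤ z) (h2 : Φ.card + 1 ≤ z)
    {r : ι} (hr : r ∈ c.R) (hrΦ : r ∉ Φ) (hμ : c.μ r y = x) :
    c.Freed Z Φ (b + W.card + 3) (c.σ y) := by
  have hex :=
    hX.freed_of_piece hp (Z := Z ∪ {y, c.σ y}) (Φ := insert r Φ) ?_ ?_ ?_ ?_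
  · obtain ⟨W', τ, γ, hpat, hd, hcard, hav, hxW, hxf, hfix⟩ := hex
    have hdZ : Disjoint W' Z := Disjoint.mono_right Finset.subset_union_left hd
    have hyW' : y ∉ W' := fun h => Finset.disjoint_left.1 hd h (by simp)
    have hsW' : c.σ y ∉ W' := fun h => Finset.disjoint_left.1 hd h (by simp)
    have hxy : x ≠ y := by rintro rfl; exact hyW' hxW
    have hxs : x ≠ c.σ y := by rintro rfl; exact hsW' hxW
    -- The edge at y is replaced by y x. The vertex σ y belongs to S although the swap fixes it: the
    -- patch must be closed under σ, and σ y is the new hole.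
    set S : Finset V := {y, c.σ y, x} with hS
    have hfx : ∀ v ∈ S, v ∈ W' → τ v = v := by
      intro v hv hvW
      simp only [hS, Finset.mem_insert, Finset.mem_singleton] at hv
      rcases hv with rfl | rfl | rfl
      · exact absurd hvW hyW'
      · exact absurd hvW hsW'
      · exact hxf
    have hpre : c.IsPre S (Equiv.swap y x) (fun _ => r) :=
      swap_isPre (by simp [hS]) (by simp [hS]) hr hμ
    have hg := hpat.glue hpre (by
      intro v hv hvW
      simp only [hS, Finset.mem_insert, Finset.mem_singleton] at hv ⊢
      rcases hv with rfl | rfl | rfl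
      · simp
      · simp [c.σ_invol]
      · exact absurd hxW hvW) hfx (by
      intro v hv ht w _ _ heq
      exact hav v hv ht (by simp [heq]))
    have hfs : Equiv.swap y x (c.σ y) = c.σ y := Equiv.swap_apply_of_ne_of_ne hy hxs.symm
    refine ⟨_, _, _, hg, ?_, ?_, ?_, Finset.mem_union_right _ (by simp [hS]), ?_, ?_⟩
    · rw [Finset.disjoint_union_left]
      refine ⟨hdZ, ?_⟩
      rw [Finset.disjoint_left]
      intro v hv
      simp only [hS, Finset.mem_insert, Finset.mem_singleton] at hv
      rcases hv with rfl | rfl | rfl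
      · exact hyZ
      · intro h; apply hyZ; have := hZ _ h; rwa [c.σ_invol] at this
      · exact Finset.disjoint_left.1 hdZ hxW
    · have := Finset.card_union_le W' S
      have h3 : S.card ≤ 3 := Finset.card_le_three
      omega
    · intro v hv ht
      by_cases hvS : v ∈ S
      · simp only [hvS, if_true]; exact hrΦ
      · rw [thin_congr (τ' := τ) (by simp [hvS])] at ht
        simp only [hvS, if_false]
        exact fun h => hav v ((Finset.mem_union.1 hv).resolve_right hvS) ht (Finset.mem_insert_of_mem h)
    · simp only [show c.σ y ∈ S by simp [hS], if_true]
      exact hfs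
    · have h4 := card_fixed_glue (θ := Equiv.swap y x) hfx
      have h5 : (fixedIn S (Equiv.swap y x)).card ≤ 1 := by
        have : fixedIn S (Equiv.swap y x) ⊆ {c.σ y} := by
          intro v hv
          rw [mem_fixedIn] at hv
          simp only [hS, Finset.mem_insert, Finset.mem_singleton] at hv ⊢
          obtain ⟨hv1, hv2⟩ := hv
          rcases hv1 with rfl | rfl | rfl
          · exact absurd (by simpa using hv2) hxy
          · rfl
          · exact absurd (by simpa using hv2.symm) hxy
        simpa using Finset.card_le_card this
      have h6 : 1 ≤ (W' ∩ S).card := Finset.card_pos.2 ⟨x, by simp [hS, hxW]⟩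
      have h8 := card_fixed_le_union (W := W') (S := S) (τ := c.σ)
      omega
  · intro v hv
    simp only [Finset.mem_union, Finset.mem_insert, Finset.mem_singleton] at hv ⊢
    rcases hv with h | rfl | rfl
    · exact Or.inl (hZ v h)
    · simp
    · simp [c.σ_invol]
  · rw [Finset.disjoint_union_right]
    refine ⟨hdis, ?_⟩
    simp [hyW, hsW]
  · have := Finset.card_union_le Z {y, c.σ y}
    have h3 : ({y, c.σ y} : Finset V).card ≤ 2 := Finset.card_le_two
    omega
  · have := Finset.card_insert_le r Φ
    omega

end Config
end RainbowMatching

/-! ### Alternating search through factor-critical parts -/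

namespace RainbowMatching
namespace Config

variable {V ι : Type*} {c : Config V ι}

/-- The hole moves from v into B: match a to v, drop the σ-edge a b, and use factor-criticality to
rematch B without x, for any x in B. The set `insert a B` is closed under σ because b is the only
vertex of B whose partner may lie outside B. -/
theorem IsPiece.extend {X W B : Finset V} {θ : V → V} {u v a b x : V} (h : c.IsPiece X W θ u v)
    (hB : FactorCritical c.K B) (hd : Disjoint B W) (haW : a ∉ W) (haB : a ∉ B) (haX : a ∉ X)
    (hBX : ∀ y ∈ B, y ∉ X) (hav : c.K.Adj a v) (hb : b ∈ B) (hσ : c.σ b = a)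
    (hcl : ∀ y ∈ B, y ≠ b → c.σ y ∈ B) (hx : x ∈ B) :
    ∃ θ', c.IsPiece X (W ∪ insert a B) θ' u x := by
  obtain ⟨φ, hφ, hφx, hφn⟩ := hB x hx
  have hWB : ∀ y ∈ W, y ∉ B := fun y hy hy' => Finset.disjoint_left.1 hd hy' hy
  have hav' := hav.ne
  have hvW := h.x_mem
  have hvB := hWB v hvW
  have hθa : θ a = a := by by_contra hh; exact haW (h.mat.mem a hh)
  have hθB : ∀ y ∈ B, θ y = y := fun y hy => by
    by_contra hh; exact hWB y (h.mat.mem y hh) hy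
  set θ' : V → V := fun y => if y ∈ B then φ y else if y = a then v else if y = v then a else θ y
    with hθ'
  have eB : ∀ y ∈ B, θ' y = φ y := fun y hy => by simp [hθ', hy]
  have ea : θ' a = v := by simp [hθ', haB]
  have ev : θ' v = a := by simp [hθ', hvB, hav'.symm]
  have eo : ∀ y, y ∉ B → y ≠ a → y ≠ v → θ' y = θ y := fun y h1 h2 h3 => by
    simp [hθ', h1, h2, h3]
  have hoW : ∀ y, θ y ≠ y → y ∉ B ∧ y ≠ a ∧ y ≠ v := fun y hy =>
    ⟨fun hh => hy (hθB y hh), by rintro rfl; exact hy hθa, by rintro rfl; exact hy h.fix⟩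
  refine ⟨θ', ⟨?_, ?_, ?_⟩, ?_, ?_, ?_, Finset.mem_union_left _ h.u_mem, h.root, ?_, ?_⟩
  · intro y
    by_cases h1 : y ∈ B
    · rw [eB y h1, eB _ (hφ.maps y h1), hφ.invol]
    by_cases h2 : y = a
    · rw [h2, ea, ev]
    by_cases h3 : y = v
    · rw [h3, ev, ea]
    rw [eo y h1 h2 h3]
    by_cases h4 : θ y = y
    · rw [h4, eo y h1 h2 h3, h4]
    · obtain ⟨k1, k2, k3⟩ := hoW (θ y) (by rw [h.mat.invol]; exact Ne.symm h4)
      rw [eo _ k1 k2 k3, h.mat.invol]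
  · intro y hy
    by_cases h1 : y ∈ B
    · rw [eB y h1] at hy ⊢; exact hφ.adj y hy
    by_cases h2 : y = a
    · rw [h2, ea]; exact hav
    by_cases h3 : y = v
    · rw [h3, ev]; exact hav.symm
    rw [eo y h1 h2 h3] at hy ⊢; exact h.mat.adj y hy
  · intro y hy
    simp only [Finset.mem_union, Finset.mem_insert]
    by_cases h1 : y ∈ B
    · simp [h1]
    by_cases h2 : y = a
    · simp [h2]
    by_cases h3 : y = v
    · left; rw [h3]; exact hvW
    rw [eo y h1 h2 h3] at hy; exact Or.inl (h.mat.mem y hy)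
  · exact Finset.mem_union_right _ (Finset.mem_insert_of_mem hx)
  · rw [eB x hx, hφx]
  · intro y hy hyx
    by_cases h1 : y ∈ B
    · rw [eB y h1]; exact hφn y h1 hyx
    by_cases h2 : y = a
    · rw [h2, ea]; exact hav'.symm
    by_cases h3 : y = v
    · rw [h3, ev]; exact hav'
    rw [eo y h1 h2 h3]
    simp only [Finset.mem_union, Finset.mem_insert] at hy
    exact h.nofix y (by tauto) h3
  · intro y hy hyu
    simp only [Finset.mem_union, Finset.mem_insert] at hy ⊢
    rcases hy with hy | rfl | hy
    · exact Or.inl (h.closed y hy hyu)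
    · right; right; rw [← hσ, c.σ_invol]; exact hb
    · right
      by_cases hyb : y = b
      · left; rw [hyb, hσ]
      · right; exact hcl y hy hyb
  · intro y hy
    simp only [Finset.mem_union, Finset.mem_insert] at hy
    rcases hy with hy | rfl | hy
    · exact h.notMem y hy
    · exact haX
    · exact hBX y hy

theorem FactorCritical.isPiece {X B : Finset V} {b x : V} (hB : FactorCritical c.K B)
    (hBX : ∀ y ∈ B, y ∉ X) (hb : b ∈ B) (hroot : c.σ b = b ∨ c.σ b ∈ X)
    (hcl : ∀ y ∈ B, y ≠ b → c.σ y ∈ B) (hx : x ∈ B) : ∃ θ, c.IsPiece X B θ b x := by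
  obtain ⟨φ, hφ, hφx, hφn⟩ := hB x hx
  exact ⟨φ, hφ, hx, hφx, hφn, hb, hroot, hcl, hBX⟩

variable (c)

/-- A family of disjoint small factor-critical parts, each almost closed under `σ`, that expands
from the side of `A`. -/
structure Parts (X A : Finset V) (D : Finset (Finset V)) (base : Finset V → V) (β q : ℕ) :
    Prop where
  disj : ∀ B ∈ D, ∀ B' ∈ D, ∀ v ∈ B, v ∈ B' → B = B'
  card_le : ∀ B ∈ D, B.card ≤ β
  fc : ∀ B ∈ D, FactorCritical c.K B
  notX : ∀ B ∈ D, ∀ v ∈ B, v ∉ X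
  notA : ∀ B ∈ D, ∀ v ∈ B, v ∉ A
  base_mem : ∀ B ∈ D, base B ∈ B
  closed : ∀ B ∈ D, ∀ v ∈ B, v ≠ base B → c.σ v ∈ B
  base_or : ∀ B ∈ D, (c.σ (base B) = base B ∨ c.σ (base B) ∈ X) ∨ c.σ (base B) ∈ A
  A_notX : ∀ a ∈ A, a ∉ X
  expand : ∀ A' ⊆ A, (q + 1) * A'.card ≤
    q * (D.filter (fun B => ∃ a ∈ A', ∃ v ∈ B, c.K.Adj a v)).card

/-- Every vertex of `B` is the end of a small piece inside `Y` that avoids `Z`. -/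
def Patchable (X Y Z : Finset V) (w : ℕ) (B : Finset V) : Prop :=
  ∀ x ∈ B, ∃ (W : Finset V) (θ : V → V) (u : V), c.IsPiece X W θ u x ∧ Disjoint W Z ∧
    W.card ≤ w ∧ W ⊆ Y

/-- The part `B` is met by `Z`, or the `σ`-partner of its base is in `Z`. -/
def Hit (Z : Finset V) (base : Finset V → V) (B : Finset V) : Prop :=
  (∃ v ∈ B, v ∈ Z) ∨ c.σ (base B) ∈ Z

/-- The parts reachable from the roots by at most `t` alternating steps that avoid `Z`. -/
def Reach (X A Z : Finset V) (D : Finset (Finset V)) (base : Finset V → V) : ℕ → Finset V → Prop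
  | 0, B => B ∈ D ∧ ¬ c.Hit Z base B ∧ (c.σ (base B) = base B ∨ c.σ (base B) ∈ X)
  | t + 1, B => Reach X A Z D base t B ∨ (B ∈ D ∧ ¬ c.Hit Z base B ∧ c.σ (base B) ∈ A ∧
      ∃ B', Reach X A Z D base t B' ∧ ∃ v ∈ B', c.K.Adj (c.σ (base B)) v)

variable {c}

section
variable {X A Z : Finset V} {D : Finset (Finset V)} {base : Finset V → V} {β q : ℕ}

theorem Reach.mem {t : ℕ} {B : Finset V} (h : c.Reach X A Z D base t B) : B ∈ D := by
  induction t with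
  | zero => exact h.1
  | succ t ih => exact h.elim ih fun h => h.1

theorem Parts.base_inj (hP : c.Parts X A D base β q) {B B' : Finset V} (hB : B ∈ D) (hB' : B' ∈ D)
    (h : c.σ (base B) = c.σ (base B')) : B = B' :=
  hP.disj B hB B' hB' _ (hP.base_mem B hB) (by rw [σ_inj h]; exact hP.base_mem B' hB')

/-- Each step of the search appends one part and the partner of its base to a piece found earlier.
The last clause records that a piece uses only parts reached so far and partners of their bases;
hence a newly reached part and the partner of its base are disjoint from the piece it extends. -/
theorem Parts.piece_of_reach (hP : c.Parts X A D base β q) (t : ℕ) : ∀ (B : Finset V),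
    c.Reach X A Z D base t B → ∀ x ∈ B, ∃ (W : Finset V) (θ : V → V) (u : V),
      c.IsPiece X W θ u x ∧ Disjoint W Z ∧ W.card ≤ (t + 1) * (β + 1) ∧
      ∀ v ∈ W, (∃ B', c.Reach X A Z D base t B' ∧ v ∈ B') ∨
        (v ∈ A ∧ ∃ B', c.Reach X A Z D base t B' ∧ c.σ (base B') = v) := by
  induction t with
  | zero =>
    intro B hR x hx
    obtain ⟨hBD, hhit, hroot⟩ := id hR
    obtain ⟨θ, hθ⟩ := FactorCritical.isPiece (hP.fc B hBD) (hP.notX B hBD) (hP.base_mem B hBD)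
      hroot (hP.closed B hBD) hx
    refine ⟨B, θ, _, hθ, ?_, ?_, fun v hv => Or.inl ⟨B, hR, hv⟩⟩
    · rw [Finset.disjoint_left]; exact fun v hv hvZ => hhit (Or.inl ⟨v, hv, hvZ⟩)
    · have := hP.card_le B hBD; omega
  | succ t ih =>
    intro B hR x hx
    by_cases hRt : c.Reach X A Z D base t B
    · obtain ⟨W, θ, u, h1, h2, h3, h4⟩ := ih B hRt x hx
      refine ⟨W, θ, u, h1, h2, h3.trans (Nat.mul_le_mul_right _ (by omega)), ?_⟩
      intro v hv
      rcases h4 v hv with ⟨B', k1, k2⟩ | ⟨k0, B', k1, k2⟩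
      · exact Or.inl ⟨B', Or.inl k1, k2⟩
      · exact Or.inr ⟨k0, B', Or.inl k1, k2⟩
    · obtain ⟨hBD, hhit, hA, B', hB', v, hv, hadj⟩ := hR.resolve_left hRt
      obtain ⟨W, θ, u, h1, h2, h3, h4⟩ := ih B' hB' v hv
      have hd : Disjoint B W := by
        rw [Finset.disjoint_left]
        intro y hy hyW
        rcases h4 y hyW with ⟨B'', k1, k2⟩ | ⟨k0, -⟩
        · exact hRt (hP.disj B hBD B'' k1.mem y hy k2 ▸ k1)
        · exact hP.notA B hBD y hy k0
      have haW : c.σ (base B) ∉ W := by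
        intro ha
        rcases h4 _ ha with ⟨B'', k1, k2⟩ | ⟨-, B'', k1, k2⟩
        · exact hP.notA B'' k1.mem _ k2 hA
        · exact hRt (hP.base_inj k1.mem hBD k2 ▸ k1)
      obtain ⟨θ', hθ'⟩ := h1.extend (hP.fc B hBD) hd haW (fun h => hP.notA B hBD _ h hA)
        (hP.A_notX _ hA) (hP.notX B hBD) hadj (hP.base_mem B hBD) rfl (hP.closed B hBD) hx
      refine ⟨_, θ', u, hθ', ?_, ?_, ?_⟩
      · rw [Finset.disjoint_union_left]
        refine ⟨h2, ?_⟩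
        rw [Finset.disjoint_insert_left]
        exact ⟨fun h => hhit (Or.inr h), Finset.disjoint_left.2
          fun y hy hyZ => hhit (Or.inl ⟨y, hy, hyZ⟩)⟩
      · have e1 := Finset.card_union_le W (insert (c.σ (base B)) B)
        have e2 := Finset.card_insert_le (c.σ (base B)) B
        have e3 := hP.card_le B hBD
        rw [Nat.add_mul (t + 1) 1, one_mul]; omega
      · intro y hy
        simp only [Finset.mem_union, Finset.mem_insert] at hy
        rcases hy with hy | rfl | hy
        · rcases h4 y hy with ⟨B'', k1, k2⟩ | ⟨k0, B'', k1, k2⟩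
          · exact Or.inl ⟨B'', Or.inl k1, k2⟩
          · exact Or.inr ⟨k0, B'', Or.inl k1, k2⟩
        · exact Or.inr ⟨hA, B, hR, rfl⟩
        · exact Or.inl ⟨B, hR, hy⟩

theorem Parts.patchable_of_reach (hP : c.Parts X A D base β q) {t : ℕ} {B : Finset V}
    (h : c.Reach X A Z D base t B) :
    c.Patchable X (A ∪ D.biUnion id) Z ((t + 1) * (β + 1)) B := by
  intro x hx
  obtain ⟨W, θ, u, h1, h2, h3, h4⟩ := hP.piece_of_reach t B h x hx
  refine ⟨W, θ, u, h1, h2, h3, fun v hv => ?_⟩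
  rcases h4 v hv with ⟨B', k1, k2⟩ | ⟨k0, -⟩
  · exact Finset.mem_union_right _ (Finset.mem_biUnion.2 ⟨B', k1.mem, k2⟩)
  · exact Finset.mem_union_left _ k0

/-- A vertex of Z lies in at most one part and is the partner of at most one base. -/
theorem Parts.card_hit (hP : c.Parts X A D base β q) (Z : Finset V) :
    (D.filter (fun B => c.Hit Z base B)).card ≤ 2 * Z.card := by
  have h1 : (D.filter (fun B => ∃ v ∈ B, v ∈ Z)).card ≤ Z.card := by
    have hch : ∀ B, ∃ v, B ∈ D.filter (fun B => ∃ v ∈ B, v ∈ Z) → v ∈ B ∧ v ∈ Z := by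
      intro B
      by_cases hB : B ∈ D.filter (fun B => ∃ v ∈ B, v ∈ Z)
      · obtain ⟨v, hv⟩ := (Finset.mem_filter.1 hB).2
        exact ⟨v, fun _ => hv⟩
      · exact ⟨base B, fun h => absurd h hB⟩
    choose f hf using hch
    refine Finset.card_le_card_of_injOn f (fun B hB => (hf B hB).2) ?_
    intro B hB B' hB' h
    exact hP.disj B (Finset.mem_filter.1 hB).1 B' (Finset.mem_filter.1 hB').1 _ (hf B hB).1
      (h ▸ (hf B' hB').1)
  have h2 : (D.filter (fun B => c.σ (base B) ∈ Z)).card ≤ Z.card := by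
    refine Finset.card_le_card_of_injOn (fun B => c.σ (base B)) (fun B hB =>
      (Finset.mem_filter.1 hB).2) ?_
    intro B hB B' hB' h
    exact hP.base_inj (Finset.mem_filter.1 hB).1 (Finset.mem_filter.1 hB').1 h
  have h3 : D.filter (fun B => c.Hit Z base B) ⊆
      D.filter (fun B => ∃ v ∈ B, v ∈ Z) ∪ D.filter (fun B => c.σ (base B) ∈ Z) := by
    intro B hB
    rw [Finset.mem_filter] at hB
    rw [Finset.mem_union, Finset.mem_filter, Finset.mem_filter]
    exact hB.2.elim (fun h => Or.inl ⟨hB.1, h⟩) (fun h => Or.inr ⟨hB.1, h⟩)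
  have := (Finset.card_le_card h3).trans (Finset.card_union_le _ _)
  omega

/-- An unhit part that remains unreached has the partner of its base in A, and no part adjacent to
that partner was reached one step before. Expansion applied to these distinct partners makes the
unreached family shrink. -/
theorem Parts.card_unreached_succ (hP : c.Parts X A D base β q) (Z : Finset V) (t : ℕ) :
    (q + 1) * (D.filter (fun B => ¬ c.Reach X A Z D base (t + 1) B)).card ≤
      q * (D.filter (fun B => ¬ c.Reach X A Z D base t B)).card + (q + 1) * (2 * Z.card) := by
  set U := D.filter (fun B => ¬ c.Reach X A Z D base (t + 1) B ∧ ¬ c.Hit Z base B) with hU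
  have h1 : D.filter (fun B => ¬ c.Reach X A Z D base (t + 1) B) ⊆
      U ∪ D.filter (fun B => c.Hit Z base B) := by
    intro B hB
    rw [Finset.mem_filter] at hB
    by_cases hh : c.Hit Z base B
    · exact Finset.mem_union_right _ (Finset.mem_filter.2 ⟨hB.1, hh⟩)
    · exact Finset.mem_union_left _ (Finset.mem_filter.2 ⟨hB.1, hB.2, hh⟩)
  have h2 := (Finset.card_le_card h1).trans (Finset.card_union_le _ _)
  have h3 := hP.card_hit Z
  have r0 : ∀ (s : ℕ) (B : Finset V), c.Reach X A Z D base 0 B → c.Reach X A Z D base s B := by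
    intro s B h
    induction s with
    | zero => exact h
    | succ s ih => exact Or.inl ih
  have hA : ∀ B ∈ U, c.σ (base B) ∈ A := by
    intro B hB
    obtain ⟨hBD, hnr, hnh⟩ := Finset.mem_filter.1 hB
    exact (hP.base_or B hBD).resolve_left fun h => hnr (r0 _ B ⟨hBD, hnh, h⟩)
  have h4 : (U.image (fun B => c.σ (base B))).card = U.card := by
    apply Finset.card_image_of_injOn
    intro B hB B' hB' h
    exact hP.base_inj (Finset.mem_filter.1 hB).1 (Finset.mem_filter.1 hB').1 h
  have h5 := hP.expand (U.image (fun B => c.σ (base B))) (by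
    intro a ha
    obtain ⟨B, hB, rfl⟩ := Finset.mem_image.1 ha
    exact hA B hB)
  have h6 : D.filter (fun B => ∃ a ∈ U.image (fun B => c.σ (base B)), ∃ v ∈ B, c.K.Adj a v) ⊆
      D.filter (fun B => ¬ c.Reach X A Z D base t B) := by
    intro B' hB'
    obtain ⟨hD', a, ha, v, hv, hadj⟩ := Finset.mem_filter.1 hB'
    obtain ⟨B, hB, rfl⟩ := Finset.mem_image.1 ha
    obtain ⟨hBD, hnr, hnh⟩ := Finset.mem_filter.1 hB
    exact Finset.mem_filter.2 ⟨hD', fun hr => hnr (Or.inr ⟨hBD, hnh, hA B hB, B', hr, v, hv, hadj⟩)⟩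
  rw [h4] at h5
  have h7 := Nat.mul_le_mul_left q (Finset.card_le_card h6)
  have h8 : (q + 1) * (D.filter (fun B => ¬ c.Reach X A Z D base (t + 1) B)).card ≤
      (q + 1) * (U.card + 2 * Z.card) := Nat.mul_le_mul_left _ (by omega)
  rw [Nat.mul_add] at h8
  omega

/-- A part whose base is uncovered by σ is reached at once unless it is hit. The search thus starts
with an unreached family bounded in terms of M and |Z|, independently of the number of vertices. -/
theorem Parts.card_unreached_zero [Fintype V] (hP : c.Parts X A D base β q) (Z : Finset V) :
    (D.filter (fun B => ¬ c.Reach X A Z D base 0 B)).card ≤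
      (Finset.univ.filter (fun v => c.σ v ≠ v)).card + 2 * Z.card := by
  have h1 : D.filter (fun B => ¬ c.Reach X A Z D base 0 B) ⊆
      D.filter (fun B => c.σ (base B) ≠ base B) ∪ D.filter (fun B => c.Hit Z base B) := by
    intro B hB
    rw [Finset.mem_filter] at hB
    by_cases hh : c.Hit Z base B
    · exact Finset.mem_union_right _ (Finset.mem_filter.2 ⟨hB.1, hh⟩)
    · exact Finset.mem_union_left _ (Finset.mem_filter.2 ⟨hB.1, fun h => hB.2 ⟨hB.1, hh, Or.inl h⟩⟩)
  have h2 := (Finset.card_le_card h1).trans (Finset.card_union_le _ _)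
  have h3 := hP.card_hit Z
  have h4 : (D.filter (fun B => c.σ (base B) ≠ base B)).card ≤
      (Finset.univ.filter (fun v => c.σ v ≠ v)).card := by
    refine Finset.card_le_card_of_injOn base (fun B hB => by
      simpa using (Finset.mem_filter.1 hB).2) ?_
    intro B hB B' hB' h
    exact hP.base_inj (Finset.mem_filter.1 hB).1 (Finset.mem_filter.1 hB').1 (congrArg c.σ h)
  omega

/-- All but few parts have pieces avoiding a given small set. -/
theorem Parts.card_not_patchable [Fintype V] (hP : c.Parts X A D base β q) {z M L : ℕ}
    (hM : (Finset.univ.filter (fun v => c.σ v ≠ v)).card ≤ M)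
    (hL : (2 * q) ^ L * (M + 2 * z) < (2 * q + 1) ^ L) (hZ : Z.card ≤ z) :
    (D.filter (fun B => ¬ c.Patchable X (A ∪ D.biUnion id) Z ((L + 1) * (β + 1)) B)).card ≤
      4 * z * (q + 1) := by
  have h1 : (D.filter (fun B => ¬ c.Patchable X (A ∪ D.biUnion id) Z ((L + 1) * (β + 1)) B)).card ≤
      (D.filter (fun B => ¬ c.Reach X A Z D base L B)).card := by
    apply Finset.card_le_card
    intro B hB
    rw [Finset.mem_filter] at hB ⊢
    exact ⟨hB.1, fun h => hB.2 (hP.patchable_of_reach h)⟩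
  refine h1.trans ?_
  by_contra hlt
  push Not at hlt
  set N : ℕ → ℕ := fun t => (D.filter (fun B => ¬ c.Reach X A Z D base t B)).card with hN
  -- As long as more than 4z(q + 1) parts are unreached, the loss through Z is at most half of the
  -- newly unreached count divided by q + 1, so each step shrinks the family by the factor 2q/(2q +
  -- 1). By the choice of L this cannot last for L steps.
  have key : ∀ t ≤ L, (2 * q + 1) ^ (L - t) * N L ≤ (2 * q) ^ (L - t) * N t ∧ 4 * z * (q + 1) < N t := by
    intro t ht
    induction ht using Nat.decreasingInduction with
    | self => simp; exact hlt
    | of_succ t ht ih =>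
      obtain ⟨ih1, ih2⟩ := ih
      have e := hP.card_unreached_succ Z t
      have e' : (q + 1) * N (t + 1) ≤ q * N t + (q + 1) * (2 * z) := by
        refine e.trans ?_
        gcongr
      have e2 : (2 * q + 1) * N (t + 1) ≤ 2 * q * N t := by nlinarith
      have e3 : L - t = (L - (t + 1)) + 1 := by omega
      refine ⟨?_, ?_⟩
      · rw [e3, pow_succ, pow_succ]
        calc (2 * q + 1) ^ (L - (t + 1)) * (2 * q + 1) * N L
            = (2 * q + 1) * ((2 * q + 1) ^ (L - (t + 1)) * N L) := by ring
          _ ≤ (2 * q + 1) * ((2 * q) ^ (L - (t + 1)) * N (t + 1)) := by gcongr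
          _ = (2 * q) ^ (L - (t + 1)) * ((2 * q + 1) * N (t + 1)) := by ring
          _ ≤ (2 * q) ^ (L - (t + 1)) * (2 * q * N t) := by gcongr
          _ = _ := by ring
      · refine ih2.trans_le (Finset.card_le_card ?_)
        intro B hB
        rw [Finset.mem_filter] at hB ⊢
        exact ⟨hB.1, fun h => hB.2 (Or.inl h)⟩
  obtain ⟨k1, -⟩ := key 0 (Nat.zero_le _)
  have k2 : N 0 ≤ M + 2 * z := (hP.card_unreached_zero Z).trans (by omega)
  have k3 : 1 ≤ N L := (Nat.zero_le _).trans_lt hlt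
  rw [Nat.sub_zero] at k1
  have k4 : (2 * q + 1) ^ L * 1 ≤ (2 * q + 1) ^ L * N L := by gcongr
  have k5 : (2 * q) ^ L * N 0 ≤ (2 * q) ^ L * (M + 2 * z) := by gcongr
  omega

end
end Config
end RainbowMatching

/-! ### The expanding part of the barrier decomposition -/

namespace RainbowMatching

theorem FactorCritical.odd {V : Type*} {K : SimpleGraph V} {B : Finset V} (h : FactorCritical K B)
    (hB : B.Nonempty) : Odd B.card := by
  obtain ⟨x, hx⟩ := hB
  obtain ⟨θ, h1, h2, h3⟩ := h x hx
  have h4 : fixedIn B θ = {x} := by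
    ext v
    rw [mem_fixedIn, Finset.mem_singleton]
    exact ⟨fun h => by_contra fun hn => h3 v h.1 hn h.2, by rintro rfl; exact ⟨hx, h2⟩⟩
  have := even_card_add_fixed (S := B) (m := θ) h1.maps (fun v _ => h1.invol v)
  rw [h4, Finset.card_singleton] at this
  exact (Nat.even_add_one.1 this |> Nat.not_even_iff_odd.1)

namespace Config

variable {V ι : Type*} {c : Config V ι}

/-- The vertices moved by σ are those moved by its restriction, the set X and the partners of X, and
these three sets are disjoint. -/
theorem card_fixedIn_ρ [Fintype V] {X : Finset V} (hm : ∀ a ∈ X, c.σ a ≠ a)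
    (hs : ∀ a ∈ X, c.σ a ∉ X) :
    (fixedIn (Finset.univ \ X) (c.ρ X)).card + (Finset.univ.filter (fun v => c.σ v ≠ v)).card =
      Fintype.card V + X.card := by
  have h1 : (Finset.univ.filter (fun v => c.σ v ≠ v)) =
      ((Finset.univ \ X).filter (fun v => ¬ c.ρ X v = v)) ∪ (X ∪ X.image c.σ) := by
    ext v
    rw [Finset.mem_union, Finset.mem_filter, Finset.mem_filter, Finset.mem_union, Finset.mem_image,
      Finset.mem_sdiff]
    simp only [Finset.mem_univ, true_and, ρ]
    constructor
    · intro h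
      by_cases h1 : v ∈ X
      · simp [h1]
      by_cases h2 : c.σ v ∈ X
      · right; right; exact ⟨_, h2, c.σ_invol v⟩
      · left; simp [h1, h2, h]
    · rintro (⟨h1, h2⟩ | h | ⟨a, ha, rfl⟩)
      · split_ifs at h2 with h3
        · exact absurd rfl h2
        · exact h2
      · exact hm v h
      · rw [c.σ_invol]; exact (hm a ha).symm
  have h2 : Disjoint ((Finset.univ \ X).filter (fun v => ¬ c.ρ X v = v)) (X ∪ X.image c.σ) := by
    rw [Finset.disjoint_left]
    intro v hv hv'
    rw [Finset.mem_filter] at hv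
    obtain ⟨-, h1, h2⟩ := ρ_eq hv.2
    rcases Finset.mem_union.1 hv' with h | h
    · exact h1 h
    · obtain ⟨a, ha, rfl⟩ := Finset.mem_image.1 h
      rw [c.σ_invol] at h2; exact h2 ha
  have h3 : Disjoint X (X.image c.σ) := by
    rw [Finset.disjoint_left]
    intro v hv hv'
    obtain ⟨a, ha, rfl⟩ := Finset.mem_image.1 hv'
    exact hs a ha hv
  have h4 : (X.image c.σ).card = X.card :=
    Finset.card_image_of_injective _ (fun _ _ h => σ_inj h)
  have h5 := Finset.card_filter_add_card_filter_not (s := Finset.univ \ X) (fun v => c.ρ X v = v)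
  have h6 := Finset.card_sdiff_add_card_eq_card (Finset.subset_univ X)
  rw [Finset.card_univ] at h6
  rw [h1, Finset.card_union_of_disjoint h2, Finset.card_union_of_disjoint h3, h4]
  unfold fixedIn
  omega

/-- Take a largest subset of A that fails to expand strictly. A non-expanding set in the remainder
could be added to it, since the neighbourhoods left over are counted separately. -/
theorem exists_max_deficient {α γ : Type*} (A : Finset α) (Pt : Finset γ) (adj : α → γ → Prop)
    (q : ℕ) : ∃ A₀ ⊆ A, q * (Pt.filter (fun B => ∃ a ∈ A₀, adj a B)).card ≤ (q + 1) * A₀.card ∧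
      ∀ A' ⊆ A \ A₀, (q + 1) * A'.card ≤ q * ((Pt.filter (fun B => ¬ ∃ a ∈ A₀, adj a B)).filter
        (fun B => ∃ a ∈ A', adj a B)).card := by
  obtain ⟨A₀, h0, hmax⟩ := Finset.exists_max_image
    (A.powerset.filter (fun A₀ => q * (Pt.filter (fun B => ∃ a ∈ A₀, adj a B)).card ≤
      (q + 1) * A₀.card)) Finset.card ⟨∅, by simp⟩
  rw [Finset.mem_filter, Finset.mem_powerset] at h0
  refine ⟨A₀, h0.1, h0.2, ?_⟩
  intro A' hA'
  rcases A'.eq_empty_or_nonempty with rfl | hne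
  · simp
  have hdis : Disjoint A₀ A' := by
    rw [Finset.disjoint_left]; exact fun a ha ha' => (Finset.mem_sdiff.1 (hA' ha')).2 ha
  have h1 : A₀ ∪ A' ∉ A.powerset.filter (fun A₀ => q * (Pt.filter (fun B => ∃ a ∈ A₀, adj a B)).card ≤
      (q + 1) * A₀.card) := by
    intro h
    have := hmax _ h
    rw [Finset.card_union_of_disjoint hdis] at this
    have := hne.card_pos
    omega
  rw [Finset.mem_filter, Finset.mem_powerset, not_and] at h1
  have h2 := h1 (Finset.union_subset h0.1 (hA'.trans Finset.sdiff_subset))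
  push Not at h2
  have h3 : Pt.filter (fun B => ∃ a ∈ A₀ ∪ A', adj a B) ⊆ Pt.filter (fun B => ∃ a ∈ A₀, adj a B) ∪
      (Pt.filter (fun B => ¬ ∃ a ∈ A₀, adj a B)).filter (fun B => ∃ a ∈ A', adj a B) := by
    intro B hB
    simp only [Finset.mem_union, Finset.mem_filter] at hB ⊢
    obtain ⟨hB, a, ha, hadj⟩ := hB
    by_cases h : ∃ a ∈ A₀, adj a B
    · exact Or.inl ⟨hB, h⟩
    · exact Or.inr ⟨⟨hB, h⟩, a, ha.resolve_left (fun h' => h ⟨a, h', hadj⟩), hadj⟩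
  have h4 := Nat.mul_le_mul_left q ((Finset.card_le_card h3).trans (Finset.card_union_le _ _))
  rw [Finset.card_union_of_disjoint hdis] at h2
  rw [Nat.mul_add] at h2 h4
  have := h0.2
  omega

set_option maxHeartbeats 2000000 in
/-- After deleting `X`, the graph has an expanding family of small parts that accounts for almost
all the deficiency of `σ`. -/
theorem exists_parts [Fintype V] [Nonempty V] {X : Finset V} (hm : ∀ a ∈ X, c.σ a ≠ a)
    (hs : ∀ a ∈ X, c.σ a ∉ X) {M : ℕ}
    (hM : (Finset.univ.filter (fun v => c.σ v ≠ v)).card = M) (β q G : ℕ)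
    (hG : ∀ m, IsMat c.K (Finset.univ \ X) m → (fixedIn (Finset.univ \ X) (c.ρ X)).card ≤
      (fixedIn (Finset.univ \ X) m).card + G) :
    ∃ (A : Finset V) (D : Finset (Finset V)) (base : Finset V → V), c.Parts X A D base β q ∧
      (∀ B ∈ D, ∀ v ∈ B, ∀ y, y ∉ B → y ∉ A → y ∉ X → ¬ c.K.Adj y v) ∧
      β * q * (Fintype.card V + X.card + A.card) ≤
        β * q * (D.card + M + 2 * G) + q * M + β * (M + G) := by
  set S := Finset.univ \ X with hS
  obtain ⟨A, P, m, hAS, hP, hcov, hPP, hmax, hdef⟩ := berge c.K S.card S rfl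
  have hρ : IsMat c.K S (c.ρ X) := ρ_isMat X
  set U := fixedIn S (c.ρ X) with hU
  have hUm : U.card + A.card ≤ P.card + G := by have := hG m hmax.1; omega
  have hcard : U.card + M = Fintype.card V + X.card := by rw [← hM]; exact card_fixedIn_ρ hm hs
  -- These are the vertices of a part that the restriction of σ does not match inside the part.
  -- Oddness of a factor-critical part gives at least one; when there is exactly one, it is the
  -- base.
  set sg : Finset V → Finset V := fun B => B.filter (fun v => c.ρ X v = v ∨ c.ρ X v ∉ B) with hsg
  have hPd : ∀ B ∈ P, ∀ B' ∈ P, ∀ v ∈ B, v ∈ B' → B = B' := fun B hB B' hB' v hv hv' =>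
    hPP B hB B' hB' v hv v hv' (Or.inl rfl)
  have hout : ∀ B ∈ P, ∀ v ∈ B, c.ρ X v ∉ B → c.ρ X v ∈ A := by
    intro B hB v hv hn
    have hne : c.ρ X v ≠ v := fun h => hn (by rwa [h])
    by_contra hA
    obtain ⟨B', hB', hv'⟩ := hcov _ (hρ.mem' hne) hA
    rw [hPP B hB B' hB' v hv _ hv' (Or.inr (hρ.adj v hne))] at hn
    exact hn hv'
  have hpos : ∀ B ∈ P, 1 ≤ (sg B).card := by
    intro B hB
    by_contra h
    have h0 : sg B = ∅ := by rw [← Finset.card_eq_zero]; omega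
    have h1 : ∀ v ∈ B, c.ρ X v ≠ v ∧ c.ρ X v ∈ B := by
      intro v hv
      have : v ∉ sg B := by rw [h0]; simp
      rw [hsg] at this
      simp only [Finset.mem_filter, not_and, not_or, not_not] at this
      exact this hv
    have h2 := even_card_of_invol (S := B) (fun v hv => (h1 v hv).2) (fun v _ => hρ.invol v)
      (fun v hv => (h1 v hv).1)
    exact Nat.not_even_iff_odd.2 (FactorCritical.odd (hP B hB).2.2.1 (hP B hB).2.2.2) h2
  have hsum : ∑ B ∈ P, (sg B).card + 2 * (A ∩ U).card ≤ U.card + A.card := by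
    rw [← Finset.card_biUnion]
    · have h1 : P.biUnion sg ⊆ (U \ A) ∪ (A \ U).image (c.ρ X) := by
        intro v hv
        obtain ⟨B, hB, hv⟩ := Finset.mem_biUnion.1 hv
        rw [hsg] at hv
        obtain ⟨hvB, h⟩ := Finset.mem_filter.1 hv
        have hvS : v ∈ S := (hP B hB).1 hvB
        have hvA : v ∉ A := Finset.disjoint_left.1 (hP B hB).2.1 hvB
        by_cases hf : c.ρ X v = v
        · exact Finset.mem_union_left _ (Finset.mem_sdiff.2 ⟨mem_fixedIn.2 ⟨hvS, hf⟩, hvA⟩)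
        · apply Finset.mem_union_right
          refine Finset.mem_image.2 ⟨c.ρ X v, Finset.mem_sdiff.2
            ⟨hout B hB v hvB (h.resolve_left hf), fun h => ?_⟩, hρ.invol v⟩
          have := (mem_fixedIn.1 h).2
          rw [hρ.invol] at this; exact hf this.symm
      have h2 := (Finset.card_le_card h1).trans (Finset.card_union_le _ _)
      have h3 : ((A \ U).image (c.ρ X)).card ≤ (A \ U).card := Finset.card_image_le
      have h4 := Finset.card_sdiff_add_card_inter A U
      have h5 := Finset.card_sdiff_add_card_inter U A
      rw [Finset.inter_comm U A] at h5
      omega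
    · intro B hB B' hB' hne
      rw [Function.onFun, Finset.disjoint_left]
      intro v hv hv'
      exact hne (hPd B hB B' hB' v (Finset.mem_filter.1 hv).1 (Finset.mem_filter.1 hv').1)
  have hPsum : P.card ≤ ∑ B ∈ P, (sg B).card := by
    rw [Finset.card_eq_sum_ones]; exact Finset.sum_le_sum hpos
  -- The counts of `sg` add up to at most |U| + |A|, which near-maximality bounds by |P| + G, while
  -- every part contributes at least 1.
  have hbad : (P.filter (fun B => (sg B).card ≠ 1)).card ≤ G := by
    have h1 : ∑ B ∈ P, (sg B).card = ∑ B ∈ P, ((sg B).card - 1) + P.card := by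
      rw [Finset.card_eq_sum_ones, ← Finset.sum_add_distrib]
      refine Finset.sum_congr rfl fun B hB => ?_
      have := hpos B hB; omega
    have h2 : (P.filter (fun B => (sg B).card ≠ 1)).card ≤ ∑ B ∈ P, ((sg B).card - 1) := by
      rw [Finset.card_filter]
      refine Finset.sum_le_sum fun B hB => ?_
      have := hpos B hB
      split_ifs <;> omega
    omega
  have hmvd : (S.filter (fun v => c.ρ X v ≠ v)).card ≤ M := by
    rw [← hM]
    apply Finset.card_le_card
    intro v hv
    rw [Finset.mem_filter] at hv ⊢
    obtain ⟨e, -, -⟩ := ρ_eq hv.2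
    exact ⟨Finset.mem_univ _, e ▸ hv.2⟩
  have hlarge : β * (P.filter (fun B => (sg B).card = 1 ∧ β < B.card)).card ≤ M := by
    refine le_trans ?_ hmvd
    have h1 : ∀ B ∈ P.filter (fun B => (sg B).card = 1 ∧ β < B.card), β ≤ (B \ sg B).card := by
      intro B hB
      obtain ⟨hB, h1, h2⟩ := Finset.mem_filter.1 hB
      have := Finset.card_sdiff_add_card_eq_card (s := sg B) (t := B) (Finset.filter_subset _ _)
      omega
    have h2 : β * (P.filter (fun B => (sg B).card = 1 ∧ β < B.card)).card ≤
        ∑ B ∈ P.filter (fun B => (sg B).card = 1 ∧ β < B.card), (B \ sg B).card := by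
      rw [mul_comm, ← smul_eq_mul]
      exact Finset.card_nsmul_le_sum _ _ _ h1
    refine h2.trans ?_
    rw [← Finset.card_biUnion]
    · apply Finset.card_le_card
      intro v hv
      obtain ⟨B, hB, hv⟩ := Finset.mem_biUnion.1 hv
      have hB := (Finset.mem_filter.1 hB).1
      obtain ⟨hvB, h⟩ := Finset.mem_sdiff.1 hv
      refine Finset.mem_filter.2 ⟨(hP B hB).1 hvB, fun hf => h (Finset.mem_filter.2 ⟨hvB, Or.inl hf⟩)⟩
    · intro B hB B' hB' hne
      rw [Function.onFun, Finset.disjoint_left]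
      intro v hv hv'
      exact hne (hPd B (Finset.mem_filter.1 hB).1 B' (Finset.mem_filter.1 hB').1 v
        (Finset.mem_sdiff.1 hv).1 (Finset.mem_sdiff.1 hv').1)
  set Gd := P.filter (fun B => (sg B).card = 1 ∧ B.card ≤ β) with hGd
  have hAM : A.card ≤ M + G := by
    have h1 : (A \ U).card ≤ M := by
      refine le_trans (Finset.card_le_card ?_) hmvd
      intro a ha
      obtain ⟨h1, h2⟩ := Finset.mem_sdiff.1 ha
      exact Finset.mem_filter.2 ⟨hAS h1, fun h => h2 (mem_fixedIn.2 ⟨hAS h1, h⟩)⟩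
    have h4 := Finset.card_sdiff_add_card_inter A U
    omega
  -- Discarding `A₀` with all adjacent parts costs at most |A₀|/q more parts than barrier vertices,
  -- and leaves an expanding remainder.
  obtain ⟨A₀, hA₀, hdefic, hexp⟩ := exists_max_deficient A Gd (fun a B => ∃ v ∈ B, c.K.Adj a v) q
  set D := Gd.filter (fun B => ¬ ∃ a ∈ A₀, ∃ v ∈ B, c.K.Adj a v) with hD
  have hDG : ∀ B ∈ D, B ∈ Gd := fun B hB => (Finset.mem_filter.1 hB).1
  have hDP : ∀ B ∈ D, B ∈ P := fun B hB => (Finset.mem_filter.1 (hDG B hB)).1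
  have hb : ∀ B, ∃ b, B ∈ Gd → sg B = {b} := by
    intro B
    by_cases hB : B ∈ Gd
    · obtain ⟨b, hb⟩ := Finset.card_eq_one.1 (Finset.mem_filter.1 hB).2.1
      exact ⟨b, fun _ => hb⟩
    · exact ⟨Classical.arbitrary V, fun h => absurd h hB⟩
  choose base hbase using hb
  have hbm : ∀ B ∈ D, base B ∈ B ∧ (c.ρ X (base B) = base B ∨ c.ρ X (base B) ∉ B) := by
    intro B hB
    have : base B ∈ sg B := by rw [hbase B (hDG B hB)]; simp
    exact Finset.mem_filter.1 this
  refine ⟨A \ A₀, D, base, ⟨fun B hB B' hB' => hPd B (hDP B hB) B' (hDP B' hB'),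
    fun B hB => (Finset.mem_filter.1 (hDG B hB)).2.2, fun B hB => (hP B (hDP B hB)).2.2.1,
    fun B hB v hv => (Finset.mem_sdiff.1 ((hP B (hDP B hB)).1 hv)).2,
    fun B hB v hv h => Finset.disjoint_left.1 (hP B (hDP B hB)).2.1 hv (Finset.mem_sdiff.1 h).1,
    fun B hB => (hbm B hB).1, ?_, ?_, fun a ha => (Finset.mem_sdiff.1 (hAS (Finset.mem_sdiff.1 ha).1)).2,
    fun A' hA' => by convert hexp A' hA'⟩, ?_, ?_⟩
  · intro B hB v hv hne
    have h1 : v ∉ sg B := by rw [hbase B (hDG B hB)]; simpa using hne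
    rw [hsg] at h1
    simp only [Finset.mem_filter, not_and, not_or, not_not] at h1
    obtain ⟨h2, h3⟩ := h1 hv
    rwa [(ρ_eq h2).1] at h3
  · intro B hB
    obtain ⟨h1, h2⟩ := hbm B hB
    have hX : base B ∉ X := (Finset.mem_sdiff.1 ((hP B (hDP B hB)).1 h1)).2
    by_cases h3 : c.ρ X (base B) = base B
    · exact Or.inl (ρ_root hX h3)
    · right
      have h4 := hout B (hDP B hB) _ h1 (h2.resolve_left h3)
      rw [(ρ_eq h3).1] at h4
      -- A base matched into `A₀` would make its part adjacent to `A₀`, and such parts were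
      -- discarded.
      refine Finset.mem_sdiff.2 ⟨h4, fun h5 => ?_⟩
      refine (Finset.mem_filter.1 hB).2 ⟨_, h5, base B, h1, ?_⟩
      have := hρ.adj _ h3
      rw [(ρ_eq h3).1] at this
      exact this.symm
  · intro B hB v hv y hyB hyA hyX hadj
    by_cases hy : y ∈ A
    · have h0 : y ∈ A₀ := by by_contra h; exact hyA (Finset.mem_sdiff.2 ⟨hy, h⟩)
      exact (Finset.mem_filter.1 hB).2 ⟨y, h0, v, hv, hadj⟩
    · obtain ⟨B', hB', hy'⟩ := hcov y (Finset.mem_sdiff.2 ⟨Finset.mem_univ _, hyX⟩) hy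
      exact hyB (hPP B (hDP B hB) B' hB' v hv y hy' (Or.inr hadj.symm) ▸ hy')
  · have hPD : P.card ≤ D.card + (P.filter (fun B => (sg B).card ≠ 1)).card +
        (P.filter (fun B => (sg B).card = 1 ∧ β < B.card)).card +
        (Gd.filter (fun B => ∃ a ∈ A₀, ∃ v ∈ B, c.K.Adj a v)).card := by
      have h1 : (Gd.filter (fun B => ∃ a ∈ A₀, ∃ v ∈ B, c.K.Adj a v)).card + D.card = Gd.card := by
        rw [hD]; convert Finset.card_filter_add_card_filter_not _
      have h2 : P ⊆ Gd ∪ (P.filter (fun B => (sg B).card ≠ 1) ∪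
          P.filter (fun B => (sg B).card = 1 ∧ β < B.card)) := by
        intro B hB
        simp only [hGd, Finset.mem_union, Finset.mem_filter]
        by_cases h3 : (sg B).card = 1
        · rcases le_or_gt B.card β with h4 | h4
          · exact Or.inl ⟨hB, h3, h4⟩
          · exact Or.inr (Or.inr ⟨hB, h3, h4⟩)
        · exact Or.inr (Or.inl ⟨hB, h3⟩)
      have h3 := (Finset.card_le_card h2).trans (Finset.card_union_le _ _)
      have h4 := Finset.card_union_le (P.filter (fun B => (sg B).card ≠ 1))
        (P.filter (fun B => (sg B).card = 1 ∧ β < B.card))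
      omega
    have hA0 := Finset.card_sdiff_add_card_eq_card hA₀
    set Lg := (P.filter (fun B => (sg B).card = 1 ∧ β < B.card)).card
    set Nb := (Gd.filter (fun B => ∃ a ∈ A₀, ∃ v ∈ B, c.K.Adj a v)).card
    have e1 : Fintype.card V + X.card + (A \ A₀).card + A₀.card ≤ D.card + M + 2 * G + Lg + Nb := by
      omega
    have e2 := Nat.mul_le_mul_left (β * q) e1
    have e3 := Nat.mul_le_mul_left q hlarge
    have e4 : β * (q * Nb) ≤ β * ((q + 1) * A₀.card) :=
      Nat.mul_le_mul_left β (by convert hdefic)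
    have e5 : β * A₀.card ≤ β * (M + G) := Nat.mul_le_mul_left _ (by omega)
    linarith

end Config
end RainbowMatching

/-! ### Counting edges that leave the parts, and enlarging X -/

namespace RainbowMatching
-- A largest subset of S containing no vertex along with its partner meets every pair, so it and its
-- image under σ cover S.
theorem exists_half {V : Type*} {σ : V → V} (hσ : ∀ v, σ (σ v) = v) {S : Finset V}
    (hS : ∀ v ∈ S, σ v ≠ v) :
    ∃ T ⊆ S, (∀ v ∈ T, σ v ∉ T) ∧ S.card ≤ 2 * T.card := by
  have hex : ∀ p : Finset V → Prop, p ∅ → ∃ T, (T ⊆ S ∧ p T) ∧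
      ∀ T', T' ⊆ S ∧ p T' → T'.card ≤ T.card := by
    intro p hp
    simpa only [Finset.mem_filter, Finset.mem_powerset] using Finset.exists_max_image
      (S.powerset.filter p) Finset.card ⟨∅, by simp [hp]⟩
  obtain ⟨T, hT, hmax⟩ := hex (fun T => ∀ v ∈ T, σ v ∉ T) (by simp)
  refine ⟨T, hT.1, hT.2, ?_⟩
  have h1 : S ⊆ T ∪ T.image σ := by
    intro v hv
    by_contra h
    rw [Finset.mem_union, not_or] at h
    have h2 : σ v ∉ T := fun h' => h.2 (Finset.mem_image.2 ⟨_, h', hσ v⟩)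
    have := hmax (insert v T) (by
      refine ⟨Finset.insert_subset hv hT.1, ?_⟩
      intro y hy
      rw [Finset.mem_insert, not_or]
      rcases Finset.mem_insert.1 hy with rfl | hy
      · exact ⟨hS y hv, h2⟩
      · refine ⟨fun e => h2 ?_, hT.2 y hy⟩
        rw [← e, hσ]; exact hy)
    rw [Finset.card_insert_of_notMem h.1] at this
    omega
  have h2 := (Finset.card_le_card h1).trans (Finset.card_union_le _ _)
  have h3 : (T.image σ).card ≤ T.card := Finset.card_image_le
  omega

namespace Config

variable {V ι : Type*} {c : Config V ι}

section
variable {X A : Finset V} {D : Finset (Finset V)} {base : Finset V → V} {β q : ℕ}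

/-- An involution that moves many vertices has many edges leaving the parts towards vertices
outside `X` and `A`. -/
theorem Parts.card_moved_le [Fintype V] (hP : c.Parts X A D base β q) {μ : V → V}
    (hμ : ∀ v, μ (μ v) = v) :
    (Finset.univ.filter (fun v => μ v ≠ v)).card + D.card ≤ Fintype.card V + X.card + A.card +
      (Finset.univ.filter (fun v => ∃ B ∈ D, v ∈ B ∧ μ v ∉ B ∧ μ v ∉ X ∧ μ v ∉ A)).card := by
  set F := Finset.univ.filter (fun v => ∃ B ∈ D, v ∈ B ∧ μ v ∉ B ∧ μ v ∉ X ∧ μ v ∉ A) with hF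
  set Dh := D.biUnion id with hDh
  set I : Finset V → Finset V := fun B => B.filter (fun v => μ v ≠ v ∧ μ v ∈ B) with hI
  have h1 : Finset.univ.filter (fun v => μ v ≠ v) ⊆
      ((X ∪ A) ∪ (X ∪ A).image μ) ∪ ((Finset.univ \ ((X ∪ A) ∪ Dh)) ∪ (D.biUnion I ∪ F)) := by
    intro v hv
    rw [Finset.mem_filter] at hv
    by_cases hvA : v ∈ X ∪ A
    · exact Finset.mem_union_left _ (Finset.mem_union_left _ hvA)
    by_cases hvA' : μ v ∈ X ∪ A
    · exact Finset.mem_union_left _ (Finset.mem_union_right _ (Finset.mem_image.2 ⟨_, hvA', hμ v⟩))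
    apply Finset.mem_union_right
    by_cases hvD : v ∈ Dh
    · obtain ⟨B, hB, hvB⟩ := Finset.mem_biUnion.1 hvD
      apply Finset.mem_union_right
      by_cases hvB' : μ v ∈ B
      · exact Finset.mem_union_left _ (Finset.mem_biUnion.2
          ⟨B, hB, Finset.mem_filter.2 ⟨hvB, hv.2, hvB'⟩⟩)
      · rw [Finset.mem_union, not_or] at hvA'
        exact Finset.mem_union_right _ (Finset.mem_filter.2
          ⟨Finset.mem_univ _, B, hB, hvB, hvB', hvA'⟩)
    · refine Finset.mem_union_left _ (Finset.mem_sdiff.2 ⟨Finset.mem_univ _, fun h => ?_⟩)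
      exact (Finset.mem_union.1 h).elim hvA hvD
  have h2 := Finset.card_le_card h1
  have h3 := Finset.card_union_le ((X ∪ A) ∪ (X ∪ A).image μ)
    ((Finset.univ \ ((X ∪ A) ∪ Dh)) ∪ (D.biUnion I ∪ F))
  have h4 := Finset.card_union_le (X ∪ A) ((X ∪ A).image μ)
  have h5 := Finset.card_union_le (Finset.univ \ ((X ∪ A) ∪ Dh)) (D.biUnion I ∪ F)
  have h6 := Finset.card_union_le (D.biUnion I) F
  have h7 : ((X ∪ A).image μ).card ≤ (X ∪ A).card := Finset.card_image_le
  have h8 := Finset.card_union_le X A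
  have h9 := Finset.card_sdiff_add_card_eq_card (Finset.subset_univ ((X ∪ A) ∪ Dh))
  have h10 : Disjoint (X ∪ A) Dh := by
    rw [Finset.disjoint_left]
    intro v hv hvD
    obtain ⟨B, hB, hvB⟩ := Finset.mem_biUnion.1 hvD
    rcases Finset.mem_union.1 hv with h | h
    · exact hP.notX B hB v hvB h
    · exact hP.notA B hB v hvB h
  rw [Finset.card_union_of_disjoint h10, Finset.card_univ] at h9
  have h11 : Dh.card = ∑ B ∈ D, B.card := by
    rw [hDh, Finset.card_biUnion]
    · rfl
    · intro B hB B' hB' hne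
      rw [Function.onFun, Finset.disjoint_left]
      exact fun v hv hv' => hne (hP.disj B hB B' hB' v hv hv')
  -- Edges of μ inside a part cover an even number of its vertices, hence at most |B| - 1 of them.
  -- This unit per part is the whole gain of the count.
  have h12 : (D.biUnion I).card + D.card ≤ ∑ B ∈ D, B.card := by
    have e : (D.biUnion I).card ≤ ∑ B ∈ D, (I B).card := Finset.card_biUnion_le
    have e2 : ∑ B ∈ D, ((I B).card + 1) ≤ ∑ B ∈ D, B.card := by
      refine Finset.sum_le_sum fun B hB => ?_
      have o := FactorCritical.odd (hP.fc B hB) ⟨_, hP.base_mem B hB⟩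
      have ev : Even (I B).card := by
        refine even_card_of_invol (m := μ) ?_ (fun v _ => hμ v) fun v hv => (Finset.mem_filter.1 hv).2.1
        intro v hv
        obtain ⟨k1, k2, k3⟩ := Finset.mem_filter.1 hv
        exact Finset.mem_filter.2 ⟨k3, by rw [hμ]; exact Ne.symm k2, by rwa [hμ]⟩
      have le : (I B).card ≤ B.card := Finset.card_filter_le _ _
      rcases le.lt_or_eq with h | h
      · exact h
      · rw [h] at ev; exact absurd ev (Nat.not_even_iff_odd.2 o)
    rw [Finset.sum_add_distrib, ← Finset.card_eq_sum_ones] at e2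
    omega
  omega

/-- A pair not adjacent in K is joined in fewer than t unused colours. -/
theorem card_colours_le {x : V} {T : Finset V} (hx : x ∉ T) (hT : ∀ y ∈ T, ¬ c.K.Adj x y) :
    (c.R.filter (fun r => c.μ r x ∈ T)).card ≤ c.t * T.card := by
  apply Finset.card_le_mul_card_image_of_maps_to (f := fun r => c.μ r x)
  · intro r hr; exact (Finset.mem_filter.1 hr).2
  · intro y hy
    by_contra h
    push Not at h
    refine hT y hy ⟨fun e => hx (e ▸ hy), Or.inr (h.le.trans (Finset.card_le_card ?_))⟩
    intro r hr
    rw [Finset.mem_filter, Finset.mem_filter] at hr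
    exact Finset.mem_filter.2 ⟨hr.1.1, hr.2⟩

theorem card_biUnion_parts_le {E : Finset (Finset V)} {s : ℕ} (hE : ∀ B ∈ E, B.card ≤ β)
    (hs : E.card ≤ s) : (E.biUnion id).card ≤ s * β :=
  (Finset.card_biUnion_le_card_mul _ _ _ hE).trans (Nat.mul_le_mul_right _ hs)

/-- The number of edges of unused colours between different parts. -/
theorem Parts.sum_between_le [Fintype V] (hP : c.Parts X A D base β q) {z b s w M : ℕ} {Y : Finset V}
    (hna : c.NoAug) (hX : c.Stage X z b)
    (hadj : ∀ B ∈ D, ∀ v ∈ B, ∀ y, y ∉ B → y ∉ A → y ∉ X → ¬ c.K.Adj y v)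
    (hM : (Finset.univ.filter (fun v => c.σ v ≠ v)).card = M)
    (hs : ∀ Z : Finset V, Z.card ≤ z → (D.filter (fun B => ¬ c.Patchable X Y Z w B)).card ≤ s)
    (hw : 1 ≤ w) (h1 : 2 * w + b + 1 ≤ z) (h2 : 2 * b + 2 * w ≤ c.t) :
    ∑ r ∈ c.R, (Finset.univ.filter (fun x => ∃ B ∈ D, x ∈ B ∧ c.μ r x ∉ B ∧
      c.μ r x ∈ D.biUnion id)).card ≤ 2 * (c.R.card * (s * β) + M * (c.t * (s * β))) := by
  set DD : ι → V → Prop := fun r x => ∃ B ∈ D, x ∈ B ∧ c.μ r x ∉ B ∧ c.μ r x ∈ D.biUnion id with hDD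
  have hsym : ∀ r x, DD r x → DD r (c.μ r x) := by
    rintro r x ⟨B, hB, hx, hn, hy⟩
    obtain ⟨B', hB', hy'⟩ := Finset.mem_biUnion.1 hy
    refine ⟨B', hB', hy', ?_, ?_⟩
    · rw [c.μ_invol]
      intro h
      rw [hP.disj B hB B' hB' x hx h] at hn; exact hn hy'
    · rw [c.μ_invol]; exact Finset.mem_biUnion.2 ⟨B, hB, hx⟩
  have hnX : ∀ x ∈ D.biUnion id, x ∉ X := by
    intro x hx
    obtain ⟨B, hB, hxB⟩ := Finset.mem_biUnion.1 hx
    exact hP.notX B hB x hxB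
  -- Two uncovered vertices are trivial pieces, so an unused colour cannot join them. Every edge
  -- counted therefore has an end among the M vertices covered by σ, and summing over those ends
  -- suffices.
  have htouch : ∀ r ∈ c.R, ∀ x, DD r x → c.σ x ≠ x ∨ c.σ (c.μ r x) ≠ c.μ r x := by
    rintro r hr x ⟨B, hB, hx, hn, hy⟩
    by_contra h
    push Not at h
    have e1 := singleton_isPiece (hP.notX B hB x hx) (Or.inl h.1)
    have e2 := singleton_isPiece (hnX _ hy) (Or.inl h.2)
    refine hX.no_edge hna e1 e2 ?_ ?_ ?_ hr rfl
    · rw [Finset.disjoint_singleton]; rintro e; exact hn (e ▸ hx)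
    · simp only [Finset.card_singleton]; omega
    · simp only [Finset.card_singleton]; omega
  set E := (D.filter (fun B => ¬ c.Patchable X Y ∅ w B)).biUnion id with hE
  have hEc : E.card ≤ s * β := card_biUnion_parts_le
    (fun B hB => hP.card_le B (Finset.mem_filter.1 hB).1) (hs ∅ (by simp))
  -- Fix a piece ending at x. Any part with pieces avoiding it sends no unused colour to x, so the
  -- other ends lie in few parts, each end taking fewer than t colours.
  have hx : ∀ x, x ∉ E → (c.R.filter (fun r => DD r x)).card ≤ c.t * (s * β) := by
    intro x hxE
    by_cases hxD : ∃ B ∈ D, x ∈ B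
    · obtain ⟨B, hB, hxB⟩ := hxD
      have hpat : c.Patchable X Y ∅ w B := by
        by_contra h
        exact hxE (Finset.mem_biUnion.2 ⟨B, Finset.mem_filter.2 ⟨hB, h⟩, hxB⟩)
      obtain ⟨W, θ, u, hp, -, hWc, -⟩ := hpat x hxB
      set T := (D.filter (fun B => ¬ c.Patchable X Y W w B)).biUnion id \ B with hT
      have hTc : T.card ≤ s * β := (Finset.card_le_card Finset.sdiff_subset).trans
        (card_biUnion_parts_le (fun B hB => hP.card_le B (Finset.mem_filter.1 hB).1)
          (hs W (by omega)))
      have hsub : c.R.filter (fun r => DD r x) ⊆ c.R.filter (fun r => c.μ r x ∈ T) := by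
        intro r hr
        obtain ⟨hr, B₁, hB₁, hx₁, hn, hy⟩ := Finset.mem_filter.1 hr
        obtain rfl := hP.disj B hB B₁ hB₁ x hxB hx₁
        obtain ⟨B', hB', hy'⟩ := Finset.mem_biUnion.1 hy
        refine Finset.mem_filter.2 ⟨hr, Finset.mem_sdiff.2 ⟨Finset.mem_biUnion.2
          ⟨B', Finset.mem_filter.2 ⟨hB', fun hpat' => ?_⟩, hy'⟩, hn⟩⟩
        obtain ⟨W', θ', u', hp', hd', hWc', -⟩ := hpat' _ hy'
        exact hX.no_edge hna hp hp' hd'.symm (by omega) (by omega) hr rfl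
      refine (Finset.card_le_card hsub).trans ((card_colours_le ?_ ?_).trans
        (Nat.mul_le_mul_left _ hTc))
      · simp [hT, hxB]
      · intro y hy hxy
        obtain ⟨hy1, hy2⟩ := Finset.mem_sdiff.1 hy
        obtain ⟨B', hB', hy'⟩ := Finset.mem_biUnion.1 hy1
        have hB' := (Finset.mem_filter.1 hB').1
        exact hadj B hB x hxB y hy2 (hP.notA B' hB' y hy') (hP.notX B' hB' y hy') hxy.symm
    · rw [Finset.card_eq_zero.2]
      · exact Nat.zero_le _
      · rw [Finset.filter_eq_empty_iff]
        rintro r - ⟨B, hB, hxB, -⟩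
        exact hxD ⟨B, hB, hxB⟩
  set Mv := Finset.univ.filter (fun v => c.σ v ≠ v) with hMv
  have hhalf : ∀ r ∈ c.R, (Finset.univ.filter (fun x => DD r x)).card ≤
      2 * (Mv.filter (fun x => DD r x)).card := by
    intro r hr
    have h3 : Finset.univ.filter (fun x => DD r x) ⊆
        Mv.filter (fun x => DD r x) ∪ (Mv.filter (fun x => DD r x)).image (c.μ r) := by
      intro x hx
      have hx := (Finset.mem_filter.1 hx).2
      rcases htouch r hr x hx with h | h
      · exact Finset.mem_union_left _ (Finset.mem_filter.2 ⟨Finset.mem_filter.2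
          ⟨Finset.mem_univ _, h⟩, hx⟩)
      · exact Finset.mem_union_right _ (Finset.mem_image.2 ⟨c.μ r x, Finset.mem_filter.2
          ⟨Finset.mem_filter.2 ⟨Finset.mem_univ _, h⟩, hsym r x hx⟩, c.μ_invol r x⟩)
    have h4 := (Finset.card_le_card h3).trans (Finset.card_union_le _ _)
    have h5 : ((Mv.filter (fun x => DD r x)).image (c.μ r)).card ≤ (Mv.filter (fun x => DD r x)).card :=
      Finset.card_image_le
    omega
  calc ∑ r ∈ c.R, (Finset.univ.filter (fun x => DD r x)).card
      ≤ ∑ r ∈ c.R, 2 * (Mv.filter (fun x => DD r x)).card := Finset.sum_le_sum hhalf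
    _ = 2 * ∑ r ∈ c.R, (Mv.filter (fun x => DD r x)).card := by rw [Finset.mul_sum]
    _ = 2 * ∑ x ∈ Mv, (c.R.filter (fun r => DD r x)).card := by
        congr 1
        exact Finset.sum_card_bipartiteAbove_eq_sum_card_bipartiteBelow (fun r x => DD r x)
    _ ≤ 2 * ∑ x ∈ Mv, ((if x ∈ E then c.R.card else 0) + c.t * (s * β)) := by
        gcongr with x _
        split_ifs with h
        · exact (Finset.card_filter_le _ _).trans (Nat.le_add_right _ _)
        · exact (hx x h).trans (Nat.le_add_left _ _)
    _ ≤ 2 * (c.R.card * (s * β) + M * (c.t * (s * β))) := by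
        rw [Finset.sum_add_distrib, Finset.sum_const, hM, smul_eq_mul, ← Finset.sum_filter,
          Finset.sum_const, smul_eq_mul, mul_comm c.R.card]
        gcongr
        refine le_trans (Finset.card_le_card ?_) hEc
        intro x hx; exact (Finset.mem_filter.1 hx).2

/-- The number of edges of unused colours leaving the parts. -/
theorem Parts.sum_leaving_le [Fintype V] (hP : c.Parts X A D base β q) {z b s w M : ℕ}
    (hna : c.NoAug) (hX : c.Stage X z b)
    (hM : (Finset.univ.filter (fun v => c.σ v ≠ v)).card = M)
    (hs : ∀ Z : Finset V, Z.card ≤ z →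
      (D.filter (fun B => ¬ c.Patchable X (A ∪ D.biUnion id) Z w B)).card ≤ s)
    (hw : 1 ≤ w) (h1 : 2 * w + b + 1 ≤ z) (h2 : 2 * b + 2 * w ≤ c.t) (h : ℕ) :
    ∑ r ∈ c.R, (Finset.univ.filter (fun x => x ∈ D.biUnion id ∧ c.μ r x ∉ X ∪ (A ∪ D.biUnion id))).card
      ≤ c.R.card * (s * β) + M * h + c.R.card * (Finset.univ.filter (fun y =>
        (y ∉ X ∪ (A ∪ D.biUnion id) ∧ c.σ y ≠ y ∧ c.σ y ∉ X) ∧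
          h < (c.R.filter (fun r => c.μ r y ∈ D.biUnion id)).card)).card := by
  set Dh := D.biUnion id with hDh
  set E := (D.filter (fun B => ¬ c.Patchable X (A ∪ Dh) ∅ w B)).biUnion id with hE
  have hEc : E.card ≤ s * β := card_biUnion_parts_le
    (fun B hB => hP.card_le B (Finset.mem_filter.1 hB).1) (hs ∅ (by simp))
  set C := Finset.univ \ (X ∪ (A ∪ Dh)) with hC
  have hCm : ∀ y, y ∈ C ↔ y ∉ X ∪ (A ∪ Dh) := fun y => by
    rw [hC, Finset.mem_sdiff]; exact ⟨fun h => h.2, fun h => ⟨Finset.mem_univ _, h⟩⟩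
  -- A root outside the parts is itself a piece, disjoint from all pieces inside A and the parts. So
  -- it can be joined only to parts that are not patchable.
  have hroot : ∀ r ∈ c.R, ∀ y ∈ C, (c.σ y = y ∨ c.σ y ∈ X) → c.μ r y ∈ Dh → c.μ r y ∈ E := by
    intro r hr y hy hroot hx
    obtain ⟨B, hB, hxB⟩ := Finset.mem_biUnion.1 hx
    refine Finset.mem_biUnion.2 ⟨B, Finset.mem_filter.2 ⟨hB, fun hpat => ?_⟩, hxB⟩
    rw [hCm, Finset.mem_union, not_or] at hy
    obtain ⟨W, θ, u, hp, -, hWc, hWY⟩ := hpat _ hxB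
    refine hX.no_edge hna (singleton_isPiece hy.1 hroot) hp ?_ ?_ ?_ hr rfl
    · rw [Finset.disjoint_singleton_left]; exact fun hh => hy.2 (hWY hh)
    · rw [Finset.card_singleton]; omega
    · rw [Finset.card_singleton]; omega
  set C₁ := C.filter (fun y => c.σ y = y ∨ c.σ y ∈ X) with hC₁
  set C₂ := C.filter (fun y => ¬ (c.σ y = y ∨ c.σ y ∈ X)) with hC₂
  set Pp := C₂.filter (fun y => h < (c.R.filter (fun r => c.μ r y ∈ Dh)).card) with hPp
  have hPpe : Finset.univ.filter (fun y => (y ∉ X ∪ (A ∪ Dh) ∧ c.σ y ≠ y ∧ c.σ y ∉ X) ∧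
      h < (c.R.filter (fun r => c.μ r y ∈ Dh)).card) = Pp := by
    ext y
    rw [hPp, Finset.mem_filter, Finset.mem_filter, hC₂, Finset.mem_filter, hCm, not_or]
    simp only [Finset.mem_univ, true_and]
  rw [hPpe]
  have hterm : ∀ r ∈ c.R, (Finset.univ.filter (fun x => x ∈ Dh ∧ c.μ r x ∉ X ∪ (A ∪ Dh))).card ≤
      s * β + (C₂.filter (fun y => c.μ r y ∈ Dh)).card := by
    intro r hr
    have e1 : (Finset.univ.filter (fun x => x ∈ Dh ∧ c.μ r x ∉ X ∪ (A ∪ Dh))).card ≤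
        (C.filter (fun y => c.μ r y ∈ Dh)).card := by
      refine Finset.card_le_card_of_injOn (c.μ r) ?_ ?_
      · intro x hx
        obtain ⟨-, k1, k2⟩ := Finset.mem_filter.1 hx
        exact Finset.mem_filter.2 ⟨(hCm _).2 k2, by rwa [c.μ_invol]⟩
      · intro x _ x' _ e
        rw [← c.μ_invol r x, e, c.μ_invol]
    have e2 : C.filter (fun y => c.μ r y ∈ Dh) ⊆
        C₁.filter (fun y => c.μ r y ∈ Dh) ∪ C₂.filter (fun y => c.μ r y ∈ Dh) := by
      intro y hy
      obtain ⟨k1, k2⟩ := Finset.mem_filter.1 hy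
      by_cases hy : c.σ y = y ∨ c.σ y ∈ X
      · exact Finset.mem_union_left _ (Finset.mem_filter.2 ⟨Finset.mem_filter.2 ⟨k1, hy⟩, k2⟩)
      · exact Finset.mem_union_right _ (Finset.mem_filter.2 ⟨Finset.mem_filter.2 ⟨k1, hy⟩, k2⟩)
    have e3 : (C₁.filter (fun y => c.μ r y ∈ Dh)).card ≤ E.card := by
      refine Finset.card_le_card_of_injOn (c.μ r) ?_ ?_
      · intro y hy
        obtain ⟨k1, k2⟩ := Finset.mem_filter.1 hy
        obtain ⟨k3, k4⟩ := Finset.mem_filter.1 k1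
        exact hroot r hr y k3 k4 k2
      · intro x _ x' _ e
        rw [← c.μ_invol r x, e, c.μ_invol]
    have e4 := (Finset.card_le_card e2).trans (Finset.card_union_le _ _)
    omega
  have hC₂M : C₂.card ≤ M := by
    rw [← hM]
    apply Finset.card_le_card
    intro y hy
    have := (Finset.mem_filter.1 hy).2
    exact Finset.mem_filter.2 ⟨Finset.mem_univ _, fun e => this (Or.inl e)⟩
  calc ∑ r ∈ c.R, (Finset.univ.filter (fun x => x ∈ Dh ∧ c.μ r x ∉ X ∪ (A ∪ Dh))).card
      ≤ ∑ r ∈ c.R, (s * β + (C₂.filter (fun y => c.μ r y ∈ Dh)).card) := Finset.sum_le_sum hterm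
    _ = c.R.card * (s * β) + ∑ r ∈ c.R, (C₂.filter (fun y => c.μ r y ∈ Dh)).card := by
        rw [Finset.sum_add_distrib, Finset.sum_const, smul_eq_mul]
    _ = c.R.card * (s * β) + ∑ y ∈ C₂, (c.R.filter (fun r => c.μ r y ∈ Dh)).card := by
        congr 1
        exact Finset.sum_card_bipartiteAbove_eq_sum_card_bipartiteBelow (fun r y => c.μ r y ∈ Dh)
    _ ≤ c.R.card * (s * β) + ∑ y ∈ C₂, (h + if h < (c.R.filter (fun r => c.μ r y ∈ Dh)).card
          then c.R.card else 0) := by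
        gcongr with y _
        split_ifs with hh
        · exact (Finset.card_filter_le _ _).trans (Nat.le_add_left _ _)
        · omega
    _ ≤ c.R.card * (s * β) + M * h + c.R.card * Pp.card := by
        rw [Finset.sum_add_distrib, Finset.sum_const, smul_eq_mul, ← Finset.sum_filter,
          Finset.sum_const, smul_eq_mul, add_assoc, mul_comm c.R.card Pp.card]
        gcongr

theorem Freed.mono {Z : Finset V} {Φ : Finset ι} {b b' : ℕ} {x : V} (h : c.Freed Z Φ b x)
    (hb : b ≤ b') : c.Freed Z Φ b' x := by
  obtain ⟨W, τ, γ, h1, h2, h3, h4⟩ := h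
  exact ⟨W, τ, γ, h1, h2, h3.trans hb, h4⟩

/-- Vertices sending many colours to the parts can be added to `X`. -/
theorem Parts.stage_union (hP : c.Parts X A D base β q) {z b s w h : ℕ} {T : Finset V}
    (hX : c.Stage X z b)
    (hadj : ∀ B ∈ D, ∀ v ∈ B, ∀ y, y ∉ B → y ∉ A → y ∉ X → ¬ c.K.Adj y v)
    (hs : ∀ Z : Finset V, Z.card ≤ z →
      (D.filter (fun B => ¬ c.Patchable X (A ∪ D.biUnion id) Z w B)).card ≤ s)
    (hw : w + 2 ≤ z) (hh : z + c.t * (s * β) ≤ h)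
    (hT : ∀ y ∈ T, (y ∉ X ∪ (A ∪ D.biUnion id) ∧ c.σ y ≠ y ∧ c.σ y ∉ X) ∧
          h < (c.R.filter (fun r => c.μ r y ∈ D.biUnion id)).card)
    (hTs : ∀ v ∈ T, c.σ v ∉ T) : c.Stage (X ∪ T) (z - (w + 2)) (b + w + 3) := by
  refine ⟨?_, ?_, ?_⟩
  · intro a ha
    rcases Finset.mem_union.1 ha with h | h
    · exact hX.moved a h
    · exact (hT a h).1.2.1
  · intro a ha
    rw [Finset.mem_union, not_or]
    rcases Finset.mem_union.1 ha with h | h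
    · refine ⟨hX.single a h, fun h' => (hT _ h').1.2.2 ?_⟩
      rwa [c.σ_invol]
    · exact ⟨(hT a h).1.2.2, hTs a h⟩
  · intro u hu hroot Z Φ hZ hZc hΦ huZ
    rw [Finset.mem_union, not_or] at hu
    by_cases hold : c.σ u = u ∨ c.σ u ∈ X
    · exact (hX.freed u hu.1 hold Z Φ hZ (by omega) (by omega) huZ).mono (by omega)
    · have hy : c.σ u ∈ T := by
        rcases hroot with h' | h'
        · exact absurd (Or.inl h') hold
        · exact (Finset.mem_union.1 h').resolve_left fun h'' => hold (Or.inr h'')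
      obtain ⟨⟨hyC, hym, hyX⟩, hcol⟩ := hT _ hy
      rw [Finset.mem_union, Finset.mem_union, not_or, not_or] at hyC
      set y := c.σ u with hyu
      have hσy : c.σ y = u := c.σ_invol u
      set Z' := Z ∪ {y, u} with hZ'
      have hZ'c : Z'.card ≤ z := by
        have := Finset.card_union_le Z {y, u}
        have h3 : ({y, u} : Finset V).card ≤ 2 := Finset.card_le_two
        rw [hZ']
        omega
      set Bd := (D.filter (fun B => ¬ c.Patchable X (A ∪ D.biUnion id) Z' w B)).biUnion id with hBd
      have hBdc : Bd.card ≤ s * β := card_biUnion_parts_le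
        (fun B hB => hP.card_le B (Finset.mem_filter.1 hB).1) (hs Z' hZ'c)
      have h3 : (c.R.filter (fun r => c.μ r y ∈ Bd)).card ≤ c.t * (s * β) := by
        refine (card_colours_le ?_ ?_).trans (Nat.mul_le_mul_left _ hBdc)
        · intro h'
          obtain ⟨B, hB, hyB⟩ := Finset.mem_biUnion.1 h'
          exact hyC.2.2 (Finset.mem_biUnion.2 ⟨B, (Finset.mem_filter.1 hB).1, hyB⟩)
        · intro x hx
          obtain ⟨B, hB, hxB⟩ := Finset.mem_biUnion.1 hx
          have hB := (Finset.mem_filter.1 hB).1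
          exact hadj B hB x hxB y (fun h' => hyC.2.2 (Finset.mem_biUnion.2 ⟨B, hB, h'⟩)) hyC.2.1 hyC.1
      -- More than h colours lead from y to the parts. At most t·sβ of them lead to bad parts and at
      -- most z are forbidden, so a usable colour remains by the choice of h.
      obtain ⟨r, hr, hrn⟩ : ∃ r ∈ c.R.filter (fun r => c.μ r y ∈ D.biUnion id),
          r ∉ c.R.filter (fun r => c.μ r y ∈ Bd) ∪ Φ := by
        by_contra hcon
        push Not at hcon
        have k1 := Finset.card_le_card (s := c.R.filter (fun r => c.μ r y ∈ D.biUnion id)) hcon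
        have k2 := Finset.card_union_le (c.R.filter (fun r => c.μ r y ∈ Bd)) Φ
        omega
      obtain ⟨hrR, hx⟩ := Finset.mem_filter.1 hr
      rw [Finset.mem_union, not_or] at hrn
      obtain ⟨B, hB, hxB⟩ := Finset.mem_biUnion.1 hx
      have hpat : c.Patchable X (A ∪ D.biUnion id) Z' w B := by
        by_contra hp
        exact hrn.1 (Finset.mem_filter.2 ⟨hrR, Finset.mem_biUnion.2
          ⟨B, Finset.mem_filter.2 ⟨hB, hp⟩, hxB⟩⟩)
      obtain ⟨W, θ, u', hp, hd, hWc, -⟩ := hpat _ hxB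
      have hdZ : Disjoint W Z := Disjoint.mono_right Finset.subset_union_left hd
      have hyW : y ∉ W := fun h' => Finset.disjoint_left.1 hd h' (by simp [hZ'])
      have huW : u ∉ W := fun h' => Finset.disjoint_left.1 hd h' (by simp [hZ'])
      have hyZ : y ∉ Z := fun h' => huZ (hσy ▸ hZ y h')
      have := hX.freed_partner hp hym hyW (by rwa [hσy]) hZ hyZ hdZ (by omega) (by omega)
        hrR hrn.2 rfl
      rw [hσy] at this
      exact this.mono (by omega)

end

/-- One step of the construction of larger and larger stages. -/
theorem Stage.step [Fintype V] [Nonempty V] {X : Finset V} {z b M N β q L l G T h : ℕ}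
    (hna : c.NoAug) (hX : c.Stage X z b)
    (hM : (Finset.univ.filter (fun v => c.σ v ≠ v)).card = M)
    (hR : ∀ r ∈ c.R, N ≤ (Finset.univ.filter (fun v => c.μ r v ≠ v)).card)
    (hβ : 0 < β) (hq : 0 < q)
    (hL : (2 * q) ^ L * (M + 2 * z) < (2 * q + 1) ^ L)
    (hz : 2 * ((L + 1) * (β + 1)) + b + 1 ≤ z) (ht : 2 * b + 2 * ((L + 1) * (β + 1)) ≤ c.t)
    (hlz : 2 * (l + 1) + b + 3 ≤ z) (hlt : 2 * b + 2 + 2 * (l + 1) ≤ c.t)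
    (hG : M ≤ (l + 1) * G) (hh : z + c.t * (4 * z * (q + 1) * β) ≤ h)
    (hT : β * q * (M + 2 * G + T) + q * M + β * (M + G) ≤ β * q * N) :
    ∃ X', X ⊆ X' ∧ c.Stage X' (z - ((L + 1) * (β + 1) + 2)) (b + (L + 1) * (β + 1) + 3) ∧
      c.R.card * T + 2 * c.R.card * X.card ≤ 3 * c.R.card * (4 * z * (q + 1) * β) +
        2 * c.R.card * X'.card + M * (2 * c.t * (4 * z * (q + 1) * β) + h) := by
  set w := (L + 1) * (β + 1) with hw
  set s := 4 * z * (q + 1) with hs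
  have hw1 : 1 ≤ w := Nat.mul_pos (Nat.succ_pos _) (Nat.succ_pos _)
  obtain ⟨A, D, base, hP, hadj, hcount⟩ := exists_parts (c := c) hX.moved hX.single hM β q G (by
    intro m hm
    by_contra hlt'
    push Not at hlt'
    -- The restriction of σ covers at most M vertices, and M ≤ (l + 1)G. A matching gaining more
    -- than G over its deficiency would thus yield an augmenting path on at most 2(l + 1) vertices.
    refine hX.not_shortAug hna hm hlz hlt (exists_shortAug (ρ_isMat X) hm l ?_)
    have e1 := card_fixedIn_ρ hX.moved hX.single
    rw [hM] at e1
    have e2 := Finset.card_sdiff_add_card_eq_card (Finset.subset_univ X)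
    rw [Finset.card_univ] at e2
    set fm := (fixedIn (Finset.univ \ X) m).card
    set fr := (fixedIn (Finset.univ \ X) (c.ρ X)).card
    have e3 : (l + 1) * (fm + G + 1) ≤ (l + 1) * fr := Nat.mul_le_mul_left _ hlt'
    rw [Nat.mul_add, Nat.mul_add] at e3
    have e4 : (l + 2) * fr = (l + 1) * fr + fr := by ring
    omega)
  have hpat : ∀ Z : Finset V, Z.card ≤ z →
      (D.filter (fun B => ¬ c.Patchable X (A ∪ D.biUnion id) Z w B)).card ≤ s :=
    fun Z hZ => hP.card_not_patchable hM.le hL hZ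
  set Pp := Finset.univ.filter (fun y => (y ∉ X ∪ (A ∪ D.biUnion id) ∧ c.σ y ≠ y ∧ c.σ y ∉ X) ∧
          h < (c.R.filter (fun r => c.μ r y ∈ D.biUnion id)).card) with hPp
  have hPpm : ∀ y ∈ Pp, _ := fun y hy => (Finset.mem_filter.1 hy).2
  -- X may contain at most one end of each σ-edge, so only half of the vertices with many colours
  -- are added. This is the origin of the factor 2 in front of |X'|.
  obtain ⟨T', hT', hT's, hT'c⟩ := exists_half c.σ_invol (S := Pp) fun y hy => (hPpm y hy).1.2.1
  have hdis : Disjoint X T' := by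
    rw [Finset.disjoint_left]
    intro v hv hv'
    exact (hPpm v (hT' hv')).1.1 (Finset.mem_union_left _ hv)
  refine ⟨X ∪ T', Finset.subset_union_left, hP.stage_union hX hadj hpat (by omega) hh
    (fun y hy => hPpm y (hT' hy)) hT's, ?_⟩
  have hcross : ∀ r ∈ c.R, T ≤ (Finset.univ.filter (fun x => ∃ B ∈ D, x ∈ B ∧ c.μ r x ∉ B ∧
      c.μ r x ∈ D.biUnion id)).card + (Finset.univ.filter (fun x => x ∈ D.biUnion id ∧
        c.μ r x ∉ X ∪ (A ∪ D.biUnion id))).card := by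
    intro r hr
    have e1 := hP.card_moved_le (c.μ_invol r)
    have e2 := hR r hr
    set F := Finset.univ.filter (fun v => ∃ B ∈ D, v ∈ B ∧ c.μ r v ∉ B ∧ c.μ r v ∉ X ∧ c.μ r v ∉ A)
    have e3 : T ≤ F.card := by
      have e4 : N + D.card ≤ Fintype.card V + X.card + A.card + F.card := by omega
      have e5 := Nat.mul_le_mul_left (β * q) e4
      have e6 : β * q * T ≤ β * q * F.card := by
        simp only [Nat.mul_add] at e5 hT hcount ⊢
        omega
      exact Nat.le_of_mul_le_mul_left e6 (Nat.mul_pos hβ hq)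
    refine e3.trans (le_trans (Finset.card_le_card ?_) (Finset.card_union_le _ _))
    intro x hx
    obtain ⟨-, B, hB, hxB, hn, hnX, hnA⟩ := Finset.mem_filter.1 hx
    rw [Finset.mem_union, Finset.mem_filter, Finset.mem_filter]
    by_cases hD : c.μ r x ∈ D.biUnion id
    · exact Or.inl ⟨Finset.mem_univ _, B, hB, hxB, hn, hD⟩
    · refine Or.inr ⟨Finset.mem_univ _, Finset.mem_biUnion.2 ⟨B, hB, hxB⟩, ?_⟩
      rw [Finset.mem_union, Finset.mem_union]
      tauto
  have hsum := Finset.card_nsmul_le_sum _ _ _ hcross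
  rw [Finset.sum_add_distrib, smul_eq_mul] at hsum
  have k1 := hP.sum_between_le hna hX hadj hM hpat hw1 hz ht
  have k2 := hP.sum_leaving_le hna hX hM hpat hw1 hz ht h
  rw [Finset.card_union_of_disjoint hdis]
  have k3 : c.R.card * Pp.card ≤ c.R.card * (2 * T'.card) := Nat.mul_le_mul_left _ hT'c
  have k4 : c.R.card * T ≤ 2 * (c.R.card * (s * β) + M * (c.t * (s * β))) +
      (c.R.card * (s * β) + M * h + c.R.card * Pp.card) := hsum.trans (Nat.add_le_add k1 k2)
  linarith

end Config
end RainbowMatching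

/-! ### Iteration of the stages and choice of the constants -/

namespace RainbowMatching
namespace Config

variable {V ι : Type*} {c : Config V ι}

theorem stage_empty [Nonempty ι] (z : ℕ) : c.Stage ∅ z 1 := by
  refine ⟨by simp, by simp, ?_⟩
  intro u _ hu Z Φ _ _ _ huZ
  have hu : c.σ u = u := hu.resolve_right (Finset.notMem_empty _)
  obtain ⟨i⟩ := ‹Nonempty ι›
  refine ⟨{u}, id, fun _ => i, ⟨⟨fun v hv => hv, fun _ _ => rfl, fun v _ h => absurd rfl h.1,
    fun v _ w _ h => absurd rfl h.1⟩, ?_⟩, by simpa using huZ, by simp, fun v _ h => absurd rfl h.1,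
    by simp, rfl, ?_⟩
  · intro v hv; rw [Finset.mem_singleton] at hv ⊢; rw [hv, hu]
  · apply Finset.card_le_card
    intro v hv
    rw [mem_fixedIn] at hv ⊢
    refine ⟨hv.1, ?_⟩
    rw [Finset.mem_singleton.1 hv.1, hu]

/-- X and its set of partners are disjoint and covered by σ. This is the bound that stops the
iteration. -/
theorem Stage.two_mul_card_le [Fintype V] {X : Finset V} {z b : ℕ} (hX : c.Stage X z b) :
    2 * X.card ≤ (Finset.univ.filter (fun v => c.σ v ≠ v)).card := by
  have h := card_fixedIn_ρ hX.moved hX.single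
  have h2 := Finset.card_sdiff_add_card_eq_card (Finset.subset_univ X)
  rw [Finset.card_univ] at h2
  have h3 : (fixedIn (Finset.univ \ X) (c.ρ X)).card ≤ (Finset.univ \ X).card :=
    Finset.card_filter_le _ _
  omega

/-- Iterating the construction of stages bounds the number of unused colours. -/
theorem NoAug.iterate [Fintype V] [Nonempty V] [Nonempty ι] (hna : c.NoAug) {z M N β q L l G T h J : ℕ}
    (hM : (Finset.univ.filter (fun v => c.σ v ≠ v)).card = M)
    (hR : ∀ r ∈ c.R, N ≤ (Finset.univ.filter (fun v => c.μ r v ≠ v)).card)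
    (hβ : 0 < β) (hq : 0 < q)
    (hL : (2 * q) ^ L * (M + 2 * z) < (2 * q + 1) ^ L)
    (hz : 2 * ((L + 1) * (β + 1)) + (J * ((L + 1) * (β + 1) + 3) + 1) + 1 +
      J * ((L + 1) * (β + 1) + 2) ≤ z)
    (ht : 2 * (J * ((L + 1) * (β + 1) + 3) + 1) + 2 * ((L + 1) * (β + 1)) ≤ c.t)
    (hlz : 2 * (l + 1) + (J * ((L + 1) * (β + 1) + 3) + 1) + 3 + J * ((L + 1) * (β + 1) + 2) ≤ z)
    (hlt : 2 * (J * ((L + 1) * (β + 1) + 3) + 1) + 2 + 2 * (l + 1) ≤ c.t)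
    (hG : M ≤ (l + 1) * G) (hh : z + c.t * (4 * z * (q + 1) * β) ≤ h)
    (hT : β * q * (M + 2 * G + T) + q * M + β * (M + G) ≤ β * q * N) :
    J * (c.R.card * T) ≤ c.R.card * M + J * (3 * c.R.card * (4 * z * (q + 1) * β) +
        M * (2 * c.t * (4 * z * (q + 1) * β) + h)) := by
  set w := (L + 1) * (β + 1) with hw
  have key : ∀ j ≤ J, ∃ X, c.Stage X (z - j * (w + 2)) (j * (w + 3) + 1) ∧
      j * (c.R.card * T) ≤ 2 * c.R.card * X.card + j * (3 * c.R.card * (4 * z * (q + 1) * β) +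
        M * (2 * c.t * (4 * z * (q + 1) * β) + h)) := by
    intro j
    induction j with
    | zero => intro _; exact ⟨∅, by simpa using stage_empty z, by simp⟩
    | succ j ih =>
      intro hj
      obtain ⟨X, hX, hc⟩ := ih (by omega)
      have e1 : j * (w + 3) ≤ J * (w + 3) := Nat.mul_le_mul_right _ (by omega)
      have e2 : j * (w + 2) ≤ J * (w + 2) := Nat.mul_le_mul_right _ (by omega)
      have hzle : z - j * (w + 2) ≤ z := Nat.sub_le _ _
      have e3 : 4 * (z - j * (w + 2)) * (q + 1) * β ≤ 4 * z * (q + 1) * β := by gcongr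
      obtain ⟨X', -, hX', hc'⟩ := hX.step (L := L) (l := l) (G := G) (T := T) (h := h) hna hM hR hβ hq
        (lt_of_le_of_lt (by gcongr) hL) (by omega) (by omega) (by omega) (by omega) hG
        (le_trans (by gcongr) hh) hT
      refine ⟨X', ?_, ?_⟩
      · convert hX' using 1
        · rw [Nat.sub_sub]; congr 1; ring
        · rw [← hw]; ring
      · have e4 : 3 * c.R.card * (4 * (z - j * (w + 2)) * (q + 1) * β) ≤
            3 * c.R.card * (4 * z * (q + 1) * β) := by gcongr
        have e5 : M * (2 * c.t * (4 * (z - j * (w + 2)) * (q + 1) * β) + h) ≤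
            M * (2 * c.t * (4 * z * (q + 1) * β) + h) := by gcongr
        rw [Nat.add_mul, Nat.add_mul, one_mul, one_mul]
        omega
  obtain ⟨X, hX, hc⟩ := key J le_rfl
  have h1 := hX.two_mul_card_le
  rw [hM] at h1
  have h2 := Nat.mul_le_mul_left c.R.card h1
  have h3 : 2 * c.R.card * X.card = c.R.card * (2 * X.card) := by ring
  omega

/-- By Bernoulli, (1 + 1/(24Q))^(24Q) ≥ 2, and the Q-th power of this exceeds m. Hence 24Q² search
steps suffice for the expansion rate belonging to q = 12Q. -/
theorem growth {Q m : ℕ} (hQ : 0 < Q) (hm : m < 2 ^ Q) :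
    (2 * (12 * Q)) ^ (24 * Q ^ 2) * m < (2 * (12 * Q) + 1) ^ (24 * Q ^ 2) := by
  have h1 : (2 * (12 * Q)) ^ (24 * Q) * 2 ≤ (2 * (12 * Q) + 1) ^ (24 * Q) := by
    have key : ∀ a m : ℕ, a ^ m * (a + m) ≤ (a + 1) ^ m * a := by
      intro a m
      induction m with
      | zero => simp
      | succ m ih =>
        calc a ^ (m + 1) * (a + (m + 1)) = a ^ m * (a * (a + (m + 1))) := by ring
          _ ≤ a ^ m * ((a + 1) * (a + m)) := Nat.mul_le_mul_left _ (by nlinarith)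
          _ = (a + 1) * (a ^ m * (a + m)) := by ring
          _ ≤ (a + 1) * ((a + 1) ^ m * a) := by gcongr
          _ = _ := by ring
    have e : 2 * (12 * Q) = 24 * Q := by ring
    rw [e]
    refine Nat.le_of_mul_le_mul_right (c := 24 * Q) ?_ (by omega)
    calc (24 * Q) ^ (24 * Q) * 2 * (24 * Q) = (24 * Q) ^ (24 * Q) * (24 * Q + 24 * Q) := by ring
      _ ≤ _ := key _ _
  have h2 : 24 * Q ^ 2 = 24 * Q * Q := by ring
  have h3 : 0 < (2 * (12 * Q)) ^ (24 * Q * Q) := by positivity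
  calc (2 * (12 * Q)) ^ (24 * Q ^ 2) * m < (2 * (12 * Q)) ^ (24 * Q * Q) * 2 ^ Q := by
        rw [h2]; exact Nat.mul_lt_mul_of_pos_left hm h3
    _ = ((2 * (12 * Q)) ^ (24 * Q) * 2) ^ Q := by
        rw [mul_pow (_ ^ (24 * Q)), ← pow_mul]
    _ ≤ ((2 * (12 * Q) + 1) ^ (24 * Q)) ^ Q := by gcongr
    _ = _ := by rw [← pow_mul, h2]

set_option maxHeartbeats 1000000 in
/-- A rainbow matching without small augmentations misses few colours. -/
theorem NoAug.card_lt [Fintype V] [Nonempty V] (hna : c.NoAug) {Q n N : ℕ} (hQ : 10 ^ 13 ≤ Q)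
    (hn : Q ^ 15 ≤ n) (hn' : 4 * n < 2 ^ Q)
    (hM : (Finset.univ.filter (fun v => c.σ v ≠ v)).card ≤ 2 * n) (ht : c.t = 10 ^ 4 * Q ^ 4)
    (hN : 2 * n * (Q + 1) ≤ Q * N)
    (hR : ∀ r ∈ c.R, N ≤ (Finset.univ.filter (fun v => c.μ r v ≠ v)).card) :
    c.R.card < Q ^ 12 := by
  obtain ⟨M, hMe⟩ : ∃ M, (Finset.univ.filter (fun v => c.σ v ≠ v)).card = M := ⟨_, rfl⟩
  rw [hMe] at hM
  set w := (24 * Q ^ 2 + 1) * (12 * Q + 1) with hw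
  by_contra hk
  push Not at hk
  have p1 : 10 ^ 13 * Q ^ 3 ≤ Q ^ 4 := by rw [pow_succ Q 3, mul_comm]; gcongr
  have p2 : 1 ≤ Q := le_trans (by norm_num) hQ
  have p3 : Q ≤ Q ^ 3 := Nat.le_self_pow (by norm_num) _
  have p4 : Q ^ 2 ≤ Q ^ 3 := Nat.pow_le_pow_right p2 (by norm_num)
  have hw' : w ≤ 325 * Q ^ 3 := by rw [hw]; ring_nf; omega
  have hJ2 : 8 * Q * (w + 2) ≤ 2616 * Q ^ 4 := by
    calc 8 * Q * (w + 2) ≤ 8 * Q * (327 * Q ^ 3) := by gcongr; omega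
      _ = _ := by ring
  have hJ3 : 8 * Q * (w + 3) ≤ 2624 * Q ^ 4 := by
    calc 8 * Q * (w + 3) ≤ 8 * Q * (328 * Q ^ 3) := by gcongr; omega
      _ = _ := by ring
  have hn3 : 48 * Q ≤ n := by
    refine le_trans ?_ hn
    rw [pow_succ]
    gcongr
    calc 48 ≤ 10 ^ 13 := by norm_num
      _ ≤ Q := hQ
      _ ≤ Q ^ 14 := Nat.le_self_pow (by norm_num) _
  have hQ15 : Q ^ 4 * 10 ^ 13 ≤ Q ^ 15 := by
    calc Q ^ 4 * 10 ^ 13 ≤ Q ^ 4 * Q := by gcongr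
      _ ≤ Q ^ 4 * Q ^ 11 := by gcongr; exact Nat.le_self_pow (by norm_num) _
      _ = Q ^ 15 := by ring
  set G := M / (48 * Q) + 1 with hG
  have hG1 : M ≤ 48 * Q * G := by rw [hG]; exact (Nat.lt_mul_div_succ M (by omega)).le
  have hG2 : 48 * Q * G ≤ 2 * n + 48 * Q := by
    have := Nat.mul_div_le M (48 * Q)
    rw [hG, Nat.mul_add]; omega
  set T := n / Q with hT
  have hT1 : Q * T ≤ n := Nat.mul_div_le n Q
  have hT2 : n < Q * (T + 1) := Nat.lt_mul_div_succ n (by omega)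
  set e := 4 * (10 ^ 4 * Q ^ 4) * (12 * Q + 1) * (12 * Q) with he
  set h := 10 ^ 4 * Q ^ 4 + c.t * e with hh
  have hι : Nonempty ι := by
    by_contra hι
    have : c.R = ∅ := Finset.eq_empty_of_forall_notMem fun r _ => hι ⟨r⟩
    rw [this, Finset.card_empty] at hk
    have : 0 < Q ^ 12 := by positivity
    omega
  -- Pieces have size w of order Q³, so 8Q steps use sizes of order Q⁴, which fit into z = t =
  -- 10⁴Q⁴. With β = q = 12Q and l + 1 = 48Q, all losses in the count of parts are small against the
  -- surplus 2n/Q, leaving T = n/Q for each colour.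
  have main := hna.iterate (z := 10 ^ 4 * Q ^ 4) (β := 12 * Q) (q := 12 * Q) (L := 24 * Q ^ 2)
    (l := 48 * Q - 1) (G := G) (T := T) (h := h) (J := 8 * Q) hMe hR (by omega) (by omega)
    (growth p2 (by omega)) (by rw [← hw]; omega) (by rw [← hw]; omega) (by rw [← hw]; omega)
    (by rw [← hw]; omega)
    (by rwa [Nat.sub_add_cancel (by omega)]) le_rfl (by
      have k1 : 12 * Q * (M + 2 * G + T) + M + (M + G) ≤ 12 * Q * N := by
        have a1 : Q * M ≤ Q * (2 * n) := Nat.mul_le_mul_left _ hM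
        have a2 : G ≤ Q * G := Nat.le_mul_of_pos_left _ p2
        nlinarith
      calc 12 * Q * (12 * Q) * (M + 2 * G + T) + 12 * Q * M + 12 * Q * (M + G)
          = 12 * Q * (12 * Q * (M + 2 * G + T) + M + (M + G)) := by ring
        _ ≤ 12 * Q * (12 * Q * N) := Nat.mul_le_mul_left _ k1
        _ = _ := by ring)
  rw [← he] at main
  set k := c.R.card with hkd
  have q6 : e ≤ 6240000 * Q ^ 6 := by
    calc e ≤ 4 * (10 ^ 4 * Q ^ 4) * (13 * Q) * (12 * Q) := by rw [he]; gcongr; omega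
      _ = _ := by ring
  have q7 : 8 * Q * (3 * e) ≤ n := by
    refine le_trans ?_ hn
    calc 8 * Q * (3 * e) ≤ 8 * Q * (3 * (6240000 * Q ^ 6)) := by gcongr
      _ = 149760000 * Q ^ 7 := by ring
      _ ≤ Q * Q ^ 7 := by gcongr; omega
      _ = Q ^ 8 := by ring
      _ ≤ Q ^ 15 := Nat.pow_le_pow_right p2 (by norm_num)
  have q8 : c.t * e ≤ 62400000000 * Q ^ 10 := by
    calc c.t * e ≤ 10 ^ 4 * Q ^ 4 * (6240000 * Q ^ 6) := by rw [ht]; gcongr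
      _ = _ := by ring
  -- This is where Q^12 and 10^13 come from: e has order Q⁶ and t·e order Q^10, and 16Q times the
  -- error is at most 3.2·10^12·Q^11. In the end 8kn, up to a small loss, would be at most 2kn + kn
  -- + kn.
  have q9 : 16 * Q * (2 * c.t * e + h) ≤ k := by
    have r1 : Q ^ 4 ≤ Q ^ 10 := Nat.pow_le_pow_right p2 (by norm_num)
    have r2 : 2 * c.t * e = 2 * (c.t * e) := by ring
    calc 16 * Q * (2 * c.t * e + h) ≤ 16 * Q * (200000000000 * Q ^ 10) := by
          gcongr; rw [hh, r2]; omega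
      _ = 3200000000000 * Q ^ 11 := by ring
      _ ≤ Q * Q ^ 11 := by gcongr; omega
      _ = Q ^ 12 := by ring
      _ ≤ k := hk
  have b1 : 8 * (k * n) ≤ 8 * Q * (k * T) + 8 * (k * Q) := by
    calc 8 * (k * n) ≤ 8 * (k * (Q * (T + 1))) := by gcongr
      _ = _ := by ring
  have b2 : 48 * (k * Q) ≤ k * n := by
    calc 48 * (k * Q) = k * (48 * Q) := by ring
      _ ≤ k * n := by gcongr
  have b3 : k * M ≤ 2 * (k * n) := by
    calc k * M ≤ k * (2 * n) := by gcongr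
      _ = _ := by ring
  have b4 : 8 * Q * (3 * k * e) ≤ k * n := by
    calc 8 * Q * (3 * k * e) = k * (8 * Q * (3 * e)) := by ring
      _ ≤ k * n := by gcongr
  have b5 : 8 * Q * (M * (2 * c.t * e + h)) ≤ k * n := by
    have s1 := Nat.mul_le_mul_right n q9
    calc 8 * Q * (M * (2 * c.t * e + h)) ≤ 8 * Q * (2 * n * (2 * c.t * e + h)) := by gcongr
      _ = 16 * Q * (2 * c.t * e + h) * n := by ring
      _ ≤ k * n := s1
  have b6 : 0 < k * n := by
    have : 0 < Q ^ 12 := by positivity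
    exact Nat.mul_pos (by omega) (by omega)
  rw [Nat.mul_add] at main
  omega

end Config
end RainbowMatching

namespace RainbowMatching

variable {V ι : Type*}

/-- A matching `σ` with edges coloured by `col`, such that the colours are distinct and every edge
belongs to the class of its colour. -/
structure IsRainbow (μ : ι → V → V) (σ : V → V) (col : V → ι) : Prop where
  invol : ∀ v, σ (σ v) = v
  edge : ∀ v, σ v ≠ v → μ (col v) v = σ v ∧ col (σ v) = col v
  inj : ∀ v w, σ v ≠ v → σ w ≠ w → col v = col w → w = v ∨ w = σ v

theorem IsRainbow.card_moved_le [Fintype V] [Fintype ι] {μ : ι → V → V} {σ : V → V} {col : V → ι}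
    (h : IsRainbow μ σ col) :
    (Finset.univ.filter (fun v => σ v ≠ v)).card ≤ 2 * Fintype.card ι := by
  rw [← Finset.card_univ]
  apply Finset.card_le_mul_card_image_of_maps_to (f := col) (fun _ _ => Finset.mem_univ _)
  intro i _
  by_contra hlt
  push Not at hlt
  obtain ⟨v, hv⟩ := Finset.card_pos.1 (Nat.zero_lt_of_lt hlt)
  have h1 : (Finset.univ.filter (fun v => σ v ≠ v)).filter (fun v => col v = i) ⊆ {v, σ v} := by
    intro w hw
    simp only [Finset.mem_filter, Finset.mem_univ, true_and] at hv hw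
    rw [Finset.mem_insert, Finset.mem_singleton]
    exact h.inj v w hv.1 hw.1 (hv.2.trans hw.2.symm)
  have := (Finset.card_le_card h1).trans Finset.card_le_two
  omega

namespace Config

variable {c : Config V ι}

/-- The edges of a small patch can be given distinct unused colours, apart from the edges of `σ`. -/
theorem IsPatch.exists_colouring {W : Finset V} {τ : V → V} {γ : V → ι} (h : c.IsPatch W τ γ)
    (hW : W.card ≤ c.t) : ∃ δ : V → ι,
      (∀ v ∈ W, τ v ≠ v → τ v ≠ c.σ v → δ v ∈ c.R ∧ c.μ (δ v) v = τ v ∧ δ (τ v) = δ v) ∧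
      ∀ v ∈ W, ∀ w ∈ W, τ v ≠ v → τ v ≠ c.σ v → τ w ≠ w → τ w ≠ c.σ w → δ v = δ w →
        w = v ∨ w = τ v := by
  set N : V → Prop := fun v => τ v ≠ v ∧ τ v ≠ c.σ v with hN
  set p : Finset V → Prop := fun S => (∀ v ∈ W, c.Thin τ v → v ∈ S) ∧ (∀ v ∈ S, τ v ∈ S) ∧
    ∃ δ : V → ι, (∀ v ∈ S, N v → δ v ∈ c.R ∧ c.μ (δ v) v = τ v ∧ δ (τ v) = δ v) ∧
      ∀ v ∈ S, ∀ w ∈ S, N v → N w → δ v = δ w → w = v ∨ w = τ v with hp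
  have hτm : ∀ v ∈ W, c.Thin τ v → c.Thin τ (τ v) := by
    intro v hv ht
    refine ⟨?_, ?_⟩
    · rw [h.invol v hv]; exact ht.1.symm
    · rw [h.invol v hv]; exact fun hh => ht.2 hh.symm
  have hp0 : p (W.filter (fun v => c.Thin τ v)) := by
    refine ⟨fun v hv ht => Finset.mem_filter.2 ⟨hv, ht⟩, ?_, γ, ?_, ?_⟩
    · intro v hv
      obtain ⟨h1, h2⟩ := Finset.mem_filter.1 hv
      exact Finset.mem_filter.2 ⟨h.maps v h1, hτm v h1 h2⟩
    · intro v hv _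
      obtain ⟨h1, h2⟩ := Finset.mem_filter.1 hv
      exact h.thin v h1 h2
    · intro v hv w hw _ _ e
      obtain ⟨h1, h2⟩ := Finset.mem_filter.1 hv
      obtain ⟨h3, h4⟩ := Finset.mem_filter.1 hw
      exact h.inj v h1 w h3 h2 h4 e
  -- Greedy colouring, phrased as a largest union of edges that contains all edges outside K and has
  -- a valid colouring.
  obtain ⟨S, hS, hmax⟩ : ∃ S, (S ⊆ W ∧ p S) ∧ ∀ S', S' ⊆ W ∧ p S' → S'.card ≤ S.card := by
    simpa only [Finset.mem_filter, Finset.mem_powerset] using Finset.exists_max_image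
      (W.powerset.filter p) Finset.card
      ⟨_, Finset.mem_filter.2 ⟨Finset.mem_powerset.2 (Finset.filter_subset _ _), hp0⟩⟩
  obtain ⟨hSW, hthin, hcl, δ, hδ, hδi⟩ := hS
  have hSeq : S = W := by
    refine Finset.Subset.antisymm hSW fun v hv => ?_
    by_contra hvS
    have hτv := h.maps v hv
    have hτvS : τ v ∉ S := fun hh => hvS (by have := hcl _ hh; rwa [h.invol v hv] at this)
    set S' := insert v (insert (τ v) S) with hS'
    have hcard : S.card < S'.card := Finset.card_lt_card ⟨fun x hx => by simp [hS', hx],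
      fun hh => hvS (hh (by simp [hS']))⟩
    have hm' : ∀ x, x ∈ S' ↔ x = v ∨ x = τ v ∨ x ∈ S := by
      intro x; rw [hS', Finset.mem_insert, Finset.mem_insert]
    suffices hpS' : p S' by
      have := hmax S' ⟨?_, hpS'⟩
      · omega
      · intro x hx
        rcases (hm' x).1 hx with rfl | rfl | hx
        · exact hv
        · exact hτv
        · exact hSW hx
    refine ⟨fun x hx ht => (hm' x).2 (Or.inr (Or.inr (hthin x hx ht))), ?_, ?_⟩
    · intro x hx
      rcases (hm' x).1 hx with rfl | rfl | hx
      · exact (hm' _).2 (Or.inr (Or.inl rfl))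
      · rw [h.invol v hv]; exact (hm' _).2 (Or.inl rfl)
      · exact (hm' _).2 (Or.inr (Or.inr (hcl x hx)))
    have hNτ : N (τ v) → N v := by
      rintro ⟨h1, h2⟩
      rw [h.invol v hv] at h1 h2
      exact ⟨h1.symm, fun e => h2 (by rw [e, c.σ_invol])⟩
    by_cases hNv : N v
    · have hfat : c.K.Adj v (τ v) := by
        by_contra hh; exact hvS (hthin v hv ⟨hNv.1, hh⟩)
      have hlarge := hfat.2.resolve_left (fun e => hNv.2 e.symm)
      -- The pair is joined in at least t unused colours, and fewer than |W| ≤ t colours have been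
      -- used so far.
      obtain ⟨r, hr, hrS⟩ : ∃ r ∈ c.R.filter (fun r => c.μ r v = τ v), r ∉ S.image δ := by
        by_contra hcon
        push Not at hcon
        have k1 := Finset.card_le_card hcon
        have k2 : (S.image δ).card ≤ S.card := Finset.card_image_le
        have k3 : S.card < W.card := Finset.card_lt_card ⟨hSW, fun hh => hvS (hh hv)⟩
        have k4 := hlarge.trans k1
        omega
      obtain ⟨hrR, hrv⟩ := Finset.mem_filter.1 hr
      set δ' : V → ι := fun x => if x ∈ S then δ x else r with hδ'
      have e1 : ∀ x ∈ S, δ' x = δ x := fun x hx => by simp [hδ', hx]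
      have e2 : ∀ x, x ∉ S → δ' x = r := fun x hx => by simp [hδ', hx]
      refine ⟨δ', ?_, ?_⟩
      · intro x hx hNx
        by_cases hxS : x ∈ S
        · rw [e1 x hxS, e1 _ (hcl x hxS)]; exact hδ x hxS hNx
        · rcases (hm' x).1 hx with rfl | rfl | hx
          · rw [e2 _ hxS, e2 _ hτvS]; exact ⟨hrR, hrv, rfl⟩
          · rw [e2 _ hxS, h.invol v hv, e2 _ hvS]
            refine ⟨hrR, ?_, rfl⟩
            rw [← hrv, c.μ_invol]
          · exact absurd hx hxS
      · intro x hx y hy hNx hNy e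
        by_cases hxS : x ∈ S
        · by_cases hyS : y ∈ S
          · rw [e1 x hxS, e1 y hyS] at e; exact hδi x hxS y hyS hNx hNy e
          · rw [e1 x hxS, e2 y hyS] at e
            exact absurd (Finset.mem_image.2 ⟨x, hxS, e⟩) hrS
        · by_cases hyS : y ∈ S
          · rw [e2 x hxS, e1 y hyS] at e
            exact absurd (Finset.mem_image.2 ⟨y, hyS, e.symm⟩) hrS
          · have hx' := (hm' x).1 hx
            have hy' := (hm' y).1 hy
            have hττ := h.invol v hv
            rcases hx' with rfl | rfl | hx'
            · rcases hy' with rfl | rfl | hy'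
              · exact Or.inl rfl
              · exact Or.inr rfl
              · exact absurd hy' hyS
            · rcases hy' with rfl | rfl | hy'
              · exact Or.inr hττ.symm
              · exact Or.inl rfl
              · exact absurd hy' hyS
            · exact absurd hx' hxS
    · refine ⟨δ, ?_, ?_⟩
      · intro x hx hNx
        rcases (hm' x).1 hx with rfl | rfl | hx
        · exact absurd hNx hNv
        · exact absurd (hNτ hNx) hNv
        · exact hδ x hx hNx
      · intro x hx y hy hNx hNy e
        rcases (hm' x).1 hx with rfl | rfl | hx
        · exact absurd hNx hNv
        · exact absurd (hNτ hNx) hNv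
        · rcases (hm' y).1 hy with rfl | rfl | hy
          · exact absurd hNy hNv
          · exact absurd (hNτ hNy) hNv
          · exact hδi x hx y hy hNx hNy e
  subst hSeq
  exact ⟨δ, fun v hv h1 h2 => hδ v hv ⟨h1, h2⟩,
    fun v hv w hw h1 h2 h3 h4 => hδi v hv w hw ⟨h1, h2⟩ ⟨h3, h4⟩⟩

end Config

/-- A rainbow matching of maximum size admits no small augmentations. -/
theorem exists_rainbow_noAug [Fintype V] [Fintype ι] [Nonempty ι] {μ : ι → V → V}
    (hμ : ∀ i v, μ i (μ i v) = v) (t : ℕ) :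
    ∃ (σ : V → V) (col : V → ι) (h : IsRainbow μ σ col), (Config.mk σ
      (Finset.univ.filter (fun i => ∀ v, σ v ≠ v → col v ≠ i)) μ t h.invol hμ).NoAug := by
  have hid : IsRainbow μ id (fun _ => Classical.arbitrary ι) :=
    ⟨fun _ => rfl, fun v h => absurd rfl h, fun v w h => absurd rfl h⟩
  have hex : ∃ d, ∃ σ col, IsRainbow μ σ col ∧ (fixedIn Finset.univ σ).card = d :=
    ⟨_, id, _, hid, rfl⟩
  obtain ⟨σ, col, hσ, hd⟩ := Nat.find_spec hex
  have hmin : ∀ σ' col', IsRainbow μ σ' col' →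
      (fixedIn Finset.univ σ).card ≤ (fixedIn Finset.univ σ').card := fun σ' col' h' =>
    hd.le.trans (Nat.find_min' hex ⟨σ', col', h', rfl⟩)
  refine ⟨σ, col, hσ, ?_⟩
  set c : Config V ι := Config.mk σ
      (Finset.univ.filter (fun i => ∀ v, σ v ≠ v → col v ≠ i)) μ t hσ.invol hμ with hc
  intro W τ γ hpat hW
  by_contra hlt
  push Not at hlt
  obtain ⟨δ, hδ, hδi⟩ := hpat.exists_colouring hW
  have hclosed : ∀ v ∈ W, σ v ∈ W := hpat.closed
  have hout : ∀ v, v ∉ W → σ v ∉ W := fun v hv h => hv (by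
    have := hclosed _ h; rwa [hσ.invol] at this)
  have hR : ∀ i ∈ c.R, ∀ v, σ v ≠ v → i ≠ col v := fun i hi v hv e =>
    (Finset.mem_filter.1 hi).2 v hv e.symm
  set σ' : V → V := fun v => if v ∈ W then τ v else σ v with hσ'
  -- Edges that τ shares with σ keep their old colour. All other edges of the patch receive colours
  -- unused by σ, so no clash can occur.
  set N : V → Prop := fun v => v ∈ W ∧ τ v ≠ σ v with hN
  set col' : V → ι := fun v => if N v then δ v else col v with hcol'
  have s1 : ∀ v ∈ W, σ' v = τ v := fun v hv => by simp [hσ', hv]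
  have s2 : ∀ v, v ∉ W → σ' v = σ v := fun v hv => by simp [hσ', hv]
  have c1 : ∀ v, N v → col' v = δ v := fun v hv => by simp only [hcol', if_pos hv]
  have c2 : ∀ v, ¬ N v → col' v = col v := fun v hv => by simp only [hcol', if_neg hv]
  have sN : ∀ v, ¬ N v → σ' v = σ v := by
    intro v hv
    by_cases hvW : v ∈ W
    · rw [s1 v hvW]; by_contra hh; exact hv ⟨hvW, hh⟩
    · exact s2 v hvW
  have hNτ : ∀ v, N v → N (τ v) := by
    rintro v ⟨h1, h2⟩
    refine ⟨hpat.maps v h1, fun e => h2 ?_⟩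
    rw [hpat.invol v h1] at e
    rw [e, hσ.invol, ← e]
  have hNσ : ∀ v, ¬ N v → ¬ N (σ v) := by
    rintro v hv ⟨h1, h2⟩
    have h3 : v ∈ W := by have := hclosed _ h1; rwa [hσ.invol] at this
    have h4 : τ v = σ v := by by_contra hh; exact hv ⟨h3, hh⟩
    apply h2
    rw [← h4, hpat.invol v h3, h4, hσ.invol]
  have hnew : IsRainbow μ σ' col' := by
    refine ⟨?_, ?_, ?_⟩
    · intro v
      by_cases hv : v ∈ W
      · rw [s1 v hv, s1 _ (hpat.maps v hv), hpat.invol v hv]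
      · rw [s2 v hv, s2 _ (hout v hv), hσ.invol]
    · intro v hv
      by_cases hNv : N v
      · rw [s1 v hNv.1] at hv ⊢
        rw [c1 v hNv, c1 _ (hNτ v hNv)]
        exact (hδ v hNv.1 hv hNv.2).2
      · rw [sN v hNv] at hv ⊢
        rw [c2 v hNv, c2 _ (hNσ v hNv)]
        exact hσ.edge v hv
    · intro v w hv hw e
      by_cases hNv : N v
      · rw [s1 v hNv.1] at hv ⊢
        by_cases hNw : N w
        · rw [s1 w hNw.1] at hw
          rw [c1 v hNv, c1 w hNw] at e
          exact hδi v hNv.1 w hNw.1 hv hNv.2 hw hNw.2 e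
        · rw [sN w hNw] at hw
          rw [c1 v hNv, c2 w hNw] at e
          exact absurd e (hR _ (hδ v hNv.1 hv hNv.2).1 w hw)
      · rw [sN v hNv] at hv ⊢
        by_cases hNw : N w
        · rw [s1 w hNw.1] at hw
          rw [c2 v hNv, c1 w hNw] at e
          exact absurd e.symm (hR _ (hδ w hNw.1 hw hNw.2).1 v hv)
        · rw [sN w hNw] at hw
          rw [c2 v hNv, c2 w hNw] at e
          exact hσ.inj v w hv hw e
  have h1 := hmin σ' col' hnew
  have hsplit : ∀ θ : V → V, (fixedIn Finset.univ θ).card =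
      (fixedIn W θ).card + (fixedIn (Finset.univ \ W) θ).card := by
    intro θ
    rw [← Config.card_fixed_union Finset.disjoint_sdiff, Finset.union_sdiff_of_subset
      (Finset.subset_univ W)]
  have e1 : fixedIn W σ' = fixedIn W τ := Finset.filter_congr fun v hv => by rw [s1 v hv]
  have e2 : fixedIn (Finset.univ \ W) σ' = fixedIn (Finset.univ \ W) σ :=
    Finset.filter_congr fun v hv => by rw [s2 v (Finset.mem_sdiff.1 hv).2]
  rw [hsplit σ, hsplit σ', e1, e2] at h1
  have : (fixedIn W τ).card < (fixedIn W σ).card := hlt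
  omega

/-- If all colour classes are slightly larger than the number of colours, then there is a rainbow
matching that misses few colours. -/
theorem exists_rainbow_almost_full [Fintype V] [Fintype ι] {μ : ι → V → V}
    (hμ : ∀ i v, μ i (μ i v) = v) {Q n N : ℕ} (hn : Fintype.card ι = n) (hQ : 10 ^ 13 ≤ Q)
    (hQn : Q ^ 15 ≤ n) (hn' : 4 * n < 2 ^ Q) (hN : 2 * n * (Q + 1) ≤ Q * N)
    (hμN : ∀ i, N ≤ (Finset.univ.filter (fun v => μ i v ≠ v)).card) :
    ∃ (σ : V → V) (col : V → ι), IsRainbow μ σ col ∧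
      (Finset.univ.filter (fun i => ∀ v, σ v ≠ v → col v ≠ i)).card < Q ^ 12 := by
  have hQ0 : 0 < Q := by omega
  have hn0 : 0 < n := lt_of_lt_of_le (by positivity) hQn
  have : Nonempty ι := Fintype.card_pos_iff.1 (by omega)
  have hV : Nonempty V := by
    have h1 := hμN (Classical.arbitrary ι)
    have h2 : 0 < N := by
      rcases Nat.eq_zero_or_pos N with rfl | h
      · have : 0 < 2 * n * (Q + 1) := by positivity
        omega
      · exact h
    obtain ⟨v, -⟩ := Finset.card_pos.1 (h2.trans_le h1)
    exact ⟨v⟩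
  obtain ⟨σ, col, h, hna⟩ := exists_rainbow_noAug hμ (10 ^ 4 * Q ^ 4)
  refine ⟨σ, col, h, ?_⟩
  exact hna.card_lt hQ hQn hn' (hn ▸ h.card_moved_le) rfl hN (fun r _ => hμN r)

end RainbowMatching

/-! ### Random splitting of the vertex set -/

namespace RainbowMatching

variable {V ι : Type*}

/-- The function `f` is affine in each coordinate. -/
def IsMultiaffine (f : (V → ℝ) → ℝ) : Prop := ∀ (t : V → ℝ) (v : V) (s : ℝ),
  f (Function.update t v s) = s * f (Function.update t v 1) + (1 - s) * f (Function.update t v 0)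

/-- At the constant point p a multiaffine function equals its mean over a random set with density p.
Fixing the coordinates one at a time never needs to increase the value; this derandomisation
replaces a probability space. -/
theorem IsMultiaffine.exists_le [Fintype V] {f : (V → ℝ) → ℝ} (hf : IsMultiaffine f) {p : ℝ}
    (h0 : 0 ≤ p) (h1 : p ≤ 1) :
    ∃ F : Finset V, f (fun v => if v ∈ F then 1 else 0) ≤ f (fun _ => p) := by
  have key : ∀ S : Finset V, ∃ F : Finset V,
      f (fun v => if v ∈ S then (if v ∈ F then 1 else 0) else p) ≤ f (fun _ => p) := by
    intro S
    induction S using Finset.induction_on with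
    | empty => exact ⟨∅, by simp⟩
    | insert a S ha ih =>
      obtain ⟨F, hF⟩ := ih
      set t : V → ℝ := fun v => if v ∈ S then (if v ∈ F then 1 else 0) else p with ht
      have e1 : Function.update t a p = t := by
        rw [Function.update_eq_self_iff]; simp [ht, ha]
      have e2 : Function.update t a 1 = fun v => if v ∈ insert a S then
          (if v ∈ insert a F then 1 else 0) else p := by
        ext v
        by_cases hv : v = a
        · subst hv; simp
        · simp [ht, hv]
      have e3 : Function.update t a 0 = fun v => if v ∈ insert a S then
          (if v ∈ F.erase a then 1 else 0) else p := by
        ext v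
        by_cases hv : v = a
        · subst hv; simp
        · simp [ht, hv]
      have h := hf t a p
      rw [e1] at h
      by_cases hle : f (Function.update t a 1) ≤ f (fun _ => p)
      · exact ⟨insert a F, by rwa [← e2]⟩
      · refine ⟨F.erase a, ?_⟩
        rw [← e3]
        by_contra hlt
        push Not at hle hlt
        rcases h0.eq_or_lt with rfl | hp
        · rw [zero_mul, zero_add, sub_zero, one_mul] at h
          linarith
        · have h2 := mul_lt_mul_of_pos_left hle hp
          have h3 := mul_le_mul_of_nonneg_left hlt.le (sub_nonneg.2 h1)
          linarith
  obtain ⟨F, hF⟩ := key Finset.univ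
  exact ⟨F, by simpa using hF⟩

theorem IsMultiaffine.add {f g : (V → ℝ) → ℝ} (hf : IsMultiaffine f) (hg : IsMultiaffine g) :
    IsMultiaffine (fun t => f t + g t) := fun t v s => by
  simp only; rw [hf t v s, hg t v s]; ring

theorem IsMultiaffine.const_mul {f : (V → ℝ) → ℝ} (hf : IsMultiaffine f) (a : ℝ) :
    IsMultiaffine (fun t => a * f t) := fun t v s => by
  simp only; rw [hf t v s]; ring

theorem IsMultiaffine.sum {κ : Type*} {s : Finset κ} {f : κ → (V → ℝ) → ℝ}
    (hf : ∀ i ∈ s, IsMultiaffine (f i)) : IsMultiaffine (fun t => ∑ i ∈ s, f i t) := fun t v a => by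
  rw [Finset.mul_sum, Finset.mul_sum, ← Finset.sum_add_distrib]
  exact Finset.sum_congr rfl fun i hi => hf i hi t v a

/-- T contains at most one end of each edge, so every coordinate occurs in at most one factor. -/
theorem IsMultiaffine.prod_matching {μ : V → V} (hμ : ∀ v, μ (μ v) = v) {T : Finset V}
    (hT : ∀ v ∈ T, μ v ∉ T) {g : ℝ → ℝ → ℝ}
    (h1 : ∀ s b, g s b = s * g 1 b + (1 - s) * g 0 b)
    (h2 : ∀ s b, g b s = s * g b 1 + (1 - s) * g b 0) :
    IsMultiaffine (fun t : V → ℝ => ∏ w ∈ T, g (t w) (t (μ w))) := by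
  intro t v s
  have hne : ∀ w ∈ T, μ w ≠ w := fun w hw e => hT w hw (by rwa [e])
  have hconst : ∀ S ⊆ T, v ∉ S → μ v ∉ S → ∀ a : ℝ, ∏ w ∈ S, g (Function.update t v a w)
      (Function.update t v a (μ w)) = ∏ w ∈ S, g (t w) (t (μ w)) := by
    intro S _ hv hv' a
    refine Finset.prod_congr rfl fun w hw => ?_
    rw [Function.update_of_ne (fun e => hv (by rwa [← e])),
      Function.update_of_ne (fun e => hv' (by rwa [← e, hμ]))]
  simp only
  by_cases hv : v ∈ T
  · have hv' := hT v hv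
    have hs : ∀ a : ℝ, ∏ w ∈ T, g (Function.update t v a w) (Function.update t v a (μ w)) =
        g a (t (μ v)) * ∏ w ∈ T.erase v, g (t w) (t (μ w)) := by
      intro a
      rw [← Finset.mul_prod_erase T _ hv, hconst _ (Finset.erase_subset _ _) (by simp)
        (fun h => hv' (Finset.mem_of_mem_erase h)), Function.update_self,
        Function.update_of_ne (hne v hv)]
    rw [hs, hs, hs, h1]; ring
  · by_cases hv' : μ v ∈ T
    · have hs : ∀ a : ℝ, ∏ w ∈ T, g (Function.update t v a w) (Function.update t v a (μ w)) =
          g (t (μ v)) a * ∏ w ∈ T.erase (μ v), g (t w) (t (μ w)) := by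
        intro a
        have hn := hne _ hv'
        rw [hμ] at hn
        rw [← Finset.mul_prod_erase T _ hv', hconst _ (Finset.erase_subset _ _)
          (fun h => hv (Finset.mem_of_mem_erase h)) (by simp), hμ, Function.update_self,
          Function.update_of_ne hn.symm]
      rw [hs, hs, hs, h2]; ring
    · rw [hconst T subset_rfl hv hv', hconst T subset_rfl hv hv', hconst T subset_rfl hv hv']; ring

theorem card_half_filter_le {μ : V → V} (hμ : ∀ v, μ (μ v) = v) {T S : Finset V}
    (hT : ∀ v ∈ T, μ v ∉ T) {p : V → Prop} [DecidablePred p] (hp : ∀ v, p v → p (μ v))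
    (hS : ∀ v, v ∈ S ↔ p v ∧ μ v ≠ v) : 2 * (T.filter p).card ≤ S.card := by
  have h1 : T.filter p ∪ (T.filter p).image μ ⊆ S := by
    intro v hv
    rcases Finset.mem_union.1 hv with h | h
    · obtain ⟨h1, h2⟩ := Finset.mem_filter.1 h
      exact (hS v).2 ⟨h2, fun e => hT v h1 (by rwa [e])⟩
    · obtain ⟨w, hw, rfl⟩ := Finset.mem_image.1 h
      obtain ⟨h1, h2⟩ := Finset.mem_filter.1 hw
      refine (hS _).2 ⟨hp w h2, fun e => hT w h1 ?_⟩
      rw [hμ] at e; rwa [← e]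
  have h2 : Disjoint (T.filter p) ((T.filter p).image μ) := by
    rw [Finset.disjoint_left]
    intro v hv hv'
    obtain ⟨w, hw, rfl⟩ := Finset.mem_image.1 hv'
    exact hT w (Finset.mem_filter.1 hw).1 (Finset.mem_filter.1 hv).1
  have h3 := Finset.card_le_card h1
  rw [Finset.card_union_of_disjoint h2, Finset.card_image_of_injective _
    (fun a b e => by rw [← hμ a, e, hμ])] at h3
  omega

theorem prod_ite_eq_pow {T : Finset V} {p : V → Prop} [DecidablePred p] {f : V → ℝ} {a : ℝ}
    (h1 : ∀ v ∈ T, p v → f v = a) (h2 : ∀ v ∈ T, ¬ p v → f v = 1) :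
    ∏ v ∈ T, f v = a ^ (T.filter p).card := by
  rw [← Finset.prod_filter_mul_prod_filter_not T p, Finset.prod_eq_pow_card
    (b := a) (fun v hv => h1 v (Finset.mem_filter.1 hv).1 (Finset.mem_filter.1 hv).2),
    Finset.prod_eq_one (fun v hv => h2 v (Finset.mem_filter.1 hv).1 (Finset.mem_filter.1 hv).2),
    mul_one]

theorem inv_one_sub_le_exp {l : ℝ} (h0 : 0 ≤ l) (h1 : l ≤ 1 / 2) : (1 - l)⁻¹ ≤ Real.exp (l + l ^ 2) := by
  refine le_trans ?_ (Real.quadratic_le_exp_of_nonneg (by positivity))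
  rw [inv_le_iff_one_le_mul₀ (by linarith)]
  have h2 : l ≤ (1 + l) ^ 2 * (1 - l) / 2 := by nlinarith [mul_nonneg h0 h0]
  nlinarith [mul_le_mul_of_nonneg_left h2 (sq_nonneg l)]

/-- The estimate that makes the random splitting work. -/
theorem splitting_estimate {Q n N : ℕ} (hQ : 10 ^ 13 ≤ Q) (hQn : Q ^ 15 ≤ n) (hn' : 4 * n < 2 ^ Q)
    (hN : n * (Q + 20) ≤ Q * N) :
    (n : ℝ) * (2 ^ (2 * Q ^ 12) * (1 - 1 / 2 * (1 / Q : ℝ) * (1 / Q)) ^ N +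
      ((1 - 1 / Q : ℝ)⁻¹) ^ (n + n / Q + 1) * (1 - 1 / Q * (1 - 1 / Q : ℝ) * (1 - 1 / Q)) ^ N) < 1 := by
  have hQ0 : 0 < Q := by omega
  set q : ℝ := (Q : ℝ) with hq
  have hq13 : (10 : ℝ) ^ 13 ≤ q := by rw [hq]; exact_mod_cast hQ
  have hq1 : 1 ≤ q := le_trans (by norm_num) hq13
  have hq0 : 0 < q := by linarith
  have hn15 : q ^ 15 ≤ n := by rw [hq]; exact_mod_cast hQn
  have hn0 : (0 : ℝ) < n := lt_of_lt_of_le (by positivity) hn15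
  set l : ℝ := 1 / q with hl
  have hl0 : 0 < l := by positivity
  have hlq : l * q = 1 := by rw [hl]; field_simp
  have hl1 : l ≤ 1 / 40 := by
    rw [hl]; exact one_div_le_one_div_of_le (by norm_num) (by linarith)
  have hNr : (n : ℝ) * (1 + 20 * l) ≤ N := by
    have h1 : (n : ℝ) * (q + 20) ≤ q * N := by rw [hq]; exact_mod_cast hN
    have h2 := mul_le_mul_of_nonneg_left h1 hl0.le
    calc (n : ℝ) * (1 + 20 * l) = n * (l * q + 20 * l) := by rw [hlq]
      _ = l * (n * (q + 20)) := by ring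
      _ ≤ l * (q * N) := h2
      _ = l * q * N := by ring
      _ = N := by rw [hlq, one_mul]
  have hln : q ^ 13 ≤ l ^ 2 * n := by
    calc q ^ 13 = (l * q) ^ 2 * q ^ 13 := by rw [hlq]; ring
      _ = l ^ 2 * q ^ 15 := by ring
      _ ≤ l ^ 2 * n := by gcongr
  have hq12 : 10 * q ^ 12 ≤ q ^ 13 := by
    rw [pow_succ q 12, mul_comm]; gcongr; linarith
  have hqq : q ≤ q ^ 12 := le_self_pow₀ hq1 (by norm_num)
  have hexp : 4 * (n : ℝ) < Real.exp q := by
    calc 4 * (n : ℝ) < 2 ^ Q := by exact_mod_cast hn'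
      _ ≤ (Real.exp 1) ^ Q := by gcongr; linarith [Real.add_one_le_exp 1]
      _ = Real.exp q := by rw [← Real.exp_nat_mul, mul_one]
  have hfirst : 2 ^ (2 * Q ^ 12) * (1 - 1 / 2 * l * l) ^ N ≤ Real.exp (-q) := by
    have hpos : 0 ≤ 1 - 1 / 2 * l * l := by nlinarith
    calc (2 : ℝ) ^ (2 * Q ^ 12) * (1 - 1 / 2 * l * l) ^ N
        ≤ (Real.exp 1) ^ (2 * Q ^ 12) * (Real.exp (-(1 / 2 * l * l))) ^ N := by
          gcongr
          · linarith [Real.add_one_le_exp 1]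
          · exact Real.one_sub_le_exp_neg _
      _ = Real.exp (2 * q ^ 12 - 1 / 2 * l ^ 2 * N) := by
          rw [← Real.exp_nat_mul, ← Real.exp_nat_mul, ← Real.exp_add]
          congr 1; push_cast; ring
      _ ≤ Real.exp (-q) := by
          apply Real.exp_le_exp.2
          have h1 : l ^ 2 * n ≤ l ^ 2 * N := by
            gcongr
            nlinarith
          linarith
  have hsecond : ((1 - l)⁻¹) ^ (n + n / Q + 1) * (1 - l * (1 - l) * (1 - l)) ^ N ≤
      Real.exp (-q) := by
    have hB : ((n + n / Q + 1 : ℕ) : ℝ) ≤ n * (1 + l) + 1 := by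
      push_cast
      have : ((n / Q : ℕ) : ℝ) ≤ n / q := Nat.cast_div_le
      have e : (n : ℝ) / q = n * l := by rw [hl]; ring
      linarith
    have hpos : 0 ≤ 1 - l * (1 - l) * (1 - l) := by nlinarith
    calc ((1 - l)⁻¹) ^ (n + n / Q + 1) * (1 - l * (1 - l) * (1 - l)) ^ N
        ≤ (Real.exp (l + l ^ 2)) ^ (n + n / Q + 1) * (Real.exp (-(l * (1 - l) * (1 - l)))) ^ N := by
          gcongr
          · exact inv_nonneg.2 (by linarith)
          · exact inv_one_sub_le_exp hl0.le (by linarith)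
          · exact Real.one_sub_le_exp_neg _
      _ = Real.exp (((n + n / Q + 1 : ℕ) : ℝ) * (l + l ^ 2) - N * (l * (1 - l) * (1 - l))) := by
          rw [← Real.exp_nat_mul, ← Real.exp_nat_mul, ← Real.exp_add]
          congr 1; ring
      _ ≤ Real.exp (-q) := by
          apply Real.exp_le_exp.2
          have h1 : ((n + n / Q + 1 : ℕ) : ℝ) * (l + l ^ 2) ≤ (n * (1 + l) + 1) * (l + l ^ 2) := by
            gcongr
          have h2 : n * (1 + 20 * l) * (l * (1 - l) * (1 - l)) ≤ N * (l * (1 - l) * (1 - l)) := by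
            have : 0 ≤ 1 - l := by linarith
            gcongr
          -- The terms of order n l cancel and those of order n l² sum to -16. The surplus 20 in the
          -- hypothesis pays for the removal of the vertices of F; the remaining l²n ≥ Q^13 dwarfs
          -- Q.
          have h3 : (n * (1 + l) + 1) * (l + l ^ 2) - n * (1 + 20 * l) * (l * (1 - l) * (1 - l)) =
              l ^ 2 * n * (-16 + 40 * l - 20 * l ^ 2) + (l + l ^ 2) := by ring
          have h4 : l ^ 2 * n * (-16 + 40 * l - 20 * l ^ 2) ≤ l ^ 2 * n * (-15) := by
            gcongr
            nlinarith
          have h5 : l + l ^ 2 ≤ 1 := by nlinarith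
          linarith
  have hfin : (n : ℝ) * (Real.exp (-q) + Real.exp (-q)) < 1 := by
    rw [Real.exp_neg, ← two_mul, ← mul_assoc, ← div_eq_mul_inv, div_lt_one (Real.exp_pos _)]
    linarith
  exact lt_of_le_of_lt (mul_le_mul_of_nonneg_left (add_le_add hfirst hsecond) hn0.le) hfin

/-- There is a set of vertices that contains many edges of each colour and whose complement contains
almost all edges of each colour. -/
theorem exists_splitting [Fintype V] [Fintype ι] {μ : ι → V → V}
    (hμ : ∀ i v, μ i (μ i v) = v) {Q n : ℕ} (hn : Fintype.card ι = n) (hQ : 10 ^ 13 ≤ Q)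
    (hQn : Q ^ 15 ≤ n) (hn' : 4 * n < 2 ^ Q)
    (hμN : ∀ i, 2 * n * (Q + 20) ≤ Q * (Finset.univ.filter (fun v => μ i v ≠ v)).card) :
    ∃ F : Finset V, ∀ i, 4 * Q ^ 12 ≤ (F.filter (fun v => μ i v ∈ F ∧ μ i v ≠ v)).card ∧
      2 * (n + n / Q + 1) ≤
        (Finset.univ.filter (fun v => (v ∉ F ∧ μ i v ∉ F) ∧ μ i v ≠ v)).card := by
  have hQ0 : (0 : ℝ) < Q := by
    have : 0 < Q := by omega
    exact_mod_cast this
  have hQ1 : (1 : ℝ) / Q ≤ 1 / 2 := by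
    apply one_div_le_one_div_of_le (by norm_num)
    have : 2 ≤ Q := by omega
    exact_mod_cast this
  have hQ2 : 0 < (1 : ℝ) / Q := by positivity
  set l : ℝ := 1 / Q with hl
  have hhalf : ∀ i, ∃ T : Finset V, (∀ v ∈ T, μ i v ∉ T) ∧ n * (Q + 20) ≤ Q * T.card := by
    intro i
    obtain ⟨T, -, h1, h2⟩ := exists_half (hμ i) (S := Finset.univ.filter (fun v => μ i v ≠ v))
      (fun v hv => (Finset.mem_filter.1 hv).2)
    refine ⟨T, h1, ?_⟩
    have h3 := hμN i
    have h4 := Nat.mul_le_mul_left Q h2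
    nlinarith
  choose T hT hTc using hhalf
  -- Exponential moments: on indicator vectors the products are (1/2)^(edges inside F) and (1 -
  -- l)^(edges avoiding F). The weights in `f` make a term at least 1 when its colour has too few
  -- such edges, so f < 1 excludes all bad events at once.
  set g₁ : ℝ → ℝ → ℝ := fun a b => 1 - 1 / 2 * a * b with hg₁
  set g₂ : ℝ → ℝ → ℝ := fun a b => 1 - l * (1 - a) * (1 - b) with hg₂
  set f : (V → ℝ) → ℝ := fun t => ∑ i : ι, (2 ^ (2 * Q ^ 12) * ∏ v ∈ T i, g₁ (t v) (t (μ i v)) +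
    ((1 - l)⁻¹) ^ (n + n / Q + 1) * ∏ v ∈ T i, g₂ (t v) (t (μ i v))) with hf
  have hmulti : IsMultiaffine f := by
    refine IsMultiaffine.sum fun i _ => IsMultiaffine.add (IsMultiaffine.const_mul ?_ _)
      (IsMultiaffine.const_mul ?_ _)
    · exact IsMultiaffine.prod_matching (hμ i) (hT i) (fun s b => by simp only [hg₁]; ring)
        (fun s b => by simp only [hg₁]; ring)
    · exact IsMultiaffine.prod_matching (hμ i) (hT i) (fun s b => by simp only [hg₂]; ring)
        (fun s b => by simp only [hg₂]; ring)
  obtain ⟨F, hF⟩ := hmulti.exists_le hQ2.le (hQ1.trans (by norm_num))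
  have hι : 0 < n := lt_of_lt_of_le (by have : 0 < Q := by omega
                                        positivity) hQn
  have hsmall : f (fun _ => l) < 1 := by
    have : ∀ i ∈ (Finset.univ : Finset ι), 2 ^ (2 * Q ^ 12) * ∏ v ∈ T i, g₁ l l +
        ((1 - l)⁻¹) ^ (n + n / Q + 1) * ∏ v ∈ T i, g₂ l l < 1 / n := by
      intro i _
      rw [Finset.prod_const, Finset.prod_const, lt_div_iff₀ (by exact_mod_cast hι), mul_comm]
      exact splitting_estimate hQ hQn hn' (hTc i)
    have hne : (Finset.univ : Finset ι).Nonempty := by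
      rw [← Finset.card_pos, Finset.card_univ]; omega
    refine (Finset.sum_lt_sum_of_nonempty hne this).trans_eq ?_
    rw [Finset.sum_const, Finset.card_univ, hn, nsmul_eq_mul, mul_one_div, div_self]
    exact_mod_cast hι.ne'
  have hlt := hF.trans_lt hsmall
  refine ⟨F, fun i => ?_⟩
  set t : V → ℝ := fun v => if v ∈ F then 1 else 0 with ht
  have hl1 : 0 < 1 - l := by linarith
  have e1 : ∀ i, ∏ v ∈ T i, g₁ (t v) (t (μ i v)) =
      (1 / 2) ^ ((T i).filter (fun v => v ∈ F ∧ μ i v ∈ F)).card := by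
    intro i
    apply prod_ite_eq_pow
    · rintro v - ⟨h1, h2⟩; simp only [hg₁, ht, h1, h2, if_true]; norm_num
    · intro v _ h
      simp only [hg₁, ht]
      by_cases h1 : v ∈ F
      · have h2 : μ i v ∉ F := fun h2 => h ⟨h1, h2⟩
        simp [h2]
      · simp [h1]
  have e2 : ∀ i, ∏ v ∈ T i, g₂ (t v) (t (μ i v)) =
      (1 - l) ^ ((T i).filter (fun v => v ∉ F ∧ μ i v ∉ F)).card := by
    intro i
    apply prod_ite_eq_pow
    · rintro v - ⟨h1, h2⟩; simp [hg₂, ht, h1, h2]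
    · intro v _ h
      simp only [hg₂, ht]
      by_cases h1 : v ∈ F
      · simp [h1]
      · have h2 : μ i v ∈ F := by by_contra h2; exact h ⟨h1, h2⟩
        simp [h2]
  have hterm : 2 ^ (2 * Q ^ 12) * (1 / 2 : ℝ) ^ ((T i).filter (fun v => v ∈ F ∧ μ i v ∈ F)).card +
      ((1 - l)⁻¹) ^ (n + n / Q + 1) * (1 - l) ^ ((T i).filter (fun v => v ∉ F ∧ μ i v ∉ F)).card < 1 := by
    refine lt_of_le_of_lt ?_ hlt
    simp only [hf]
    rw [← e1, ← e2]
    refine Finset.single_le_sum (f := fun i => 2 ^ (2 * Q ^ 12) * ∏ v ∈ T i, g₁ (t v) (t (μ i v)) +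
      ((1 - l)⁻¹) ^ (n + n / Q + 1) * ∏ v ∈ T i, g₂ (t v) (t (μ i v))) ?_ (Finset.mem_univ i)
    intro j _
    simp only [e1, e2]
    positivity
  constructor
  · refine le_trans ?_ (card_half_filter_le (hμ i) (hT i) (p := fun v => v ∈ F ∧ μ i v ∈ F) ?_ ?_)
    · by_contra hcon
      push Not at hcon
      have h1 : ((T i).filter (fun v => v ∈ F ∧ μ i v ∈ F)).card ≤ 2 * Q ^ 12 := by omega
      have h2 : 1 ≤ 2 ^ (2 * Q ^ 12) * (1 / 2 : ℝ) ^ ((T i).filter (fun v => v ∈ F ∧ μ i v ∈ F)).card := by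
        rw [one_div, inv_pow, ← div_eq_mul_inv, one_le_div (by positivity)]
        exact pow_le_pow_right₀ (by norm_num) h1
      have h3 : 0 < ((1 - l)⁻¹) ^ (n + n / Q + 1) *
        (1 - l) ^ ((T i).filter (fun v => v ∉ F ∧ μ i v ∉ F)).card := by positivity
      linarith
    · rintro v ⟨h1, h2⟩; exact ⟨h2, by rwa [hμ]⟩
    · intro v; rw [Finset.mem_filter]; tauto
  · refine le_trans ?_ (card_half_filter_le (hμ i) (hT i) (p := fun v => v ∉ F ∧ μ i v ∉ F) ?_ ?_)
    · by_contra hcon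
      push Not at hcon
      have h1 : ((T i).filter (fun v => v ∉ F ∧ μ i v ∉ F)).card ≤ n + n / Q + 1 := by omega
      have h2 : 1 ≤ ((1 - l)⁻¹) ^ (n + n / Q + 1) *
          (1 - l) ^ ((T i).filter (fun v => v ∉ F ∧ μ i v ∉ F)).card := by
        rw [inv_pow, mul_comm, ← div_eq_mul_inv, one_le_div (by positivity)]
        exact pow_le_pow_of_le_one hl1.le (by linarith) h1
      have h3 : 0 < 2 ^ (2 * Q ^ 12) *
          (1 / 2 : ℝ) ^ ((T i).filter (fun v => v ∈ F ∧ μ i v ∈ F)).card := by positivity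
      linarith
    · rintro v ⟨h1, h2⟩; exact ⟨h2, by rwa [hμ]⟩
    · intro v; simp

/-! ### Greedy completion -/

/-- A rainbow matching can be completed greedily. -/
theorem IsRainbow.complete [Fintype V] [Fintype ι] {μ : ι → V → V} (hμ : ∀ i v, μ i (μ i v) = v)
    {F : Finset V} {k : ℕ} (hF : ∀ i, 4 * k ≤ (F.filter (fun v => μ i v ∈ F ∧ μ i v ≠ v)).card) :
    ∀ (m : ℕ) (σ : V → V) (col : V → ι), IsRainbow μ σ col →
      (Finset.univ.filter (fun i => ∀ v, σ v ≠ v → col v ≠ i)).card = m →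
      (F.filter (fun v => σ v ≠ v)).card + 2 * m ≤ 2 * k →
      ∃ σ' col', IsRainbow μ σ' col' ∧ ∀ i, ∃ v, σ' v ≠ v ∧ col' v = i := by
  intro m
  induction m with
  | zero =>
    intro σ col h hm _
    refine ⟨σ, col, h, fun i => ?_⟩
    by_contra hcon
    push Not at hcon
    rw [Finset.card_eq_zero] at hm
    exact Finset.notMem_empty i (hm ▸ Finset.mem_filter.2 ⟨Finset.mem_univ _, hcon⟩)
  | succ m ih =>
    intro σ col h hm hk
    obtain ⟨i, hi⟩ := Finset.card_pos.1 (by rw [hm]; omega :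
      0 < (Finset.univ.filter (fun i => ∀ v, σ v ≠ v → col v ≠ i)).card)
    have hi' := (Finset.mem_filter.1 hi).2
    set U := F.filter (fun v => σ v ≠ v) with hU
    -- A covered vertex of F spoils at most itself and its partner in colour i. Fewer than 2k
    -- vertices of F are covered, so one of the 4k endpoints survives.
    obtain ⟨x, hx, hxU⟩ : ∃ x ∈ F.filter (fun v => μ i v ∈ F ∧ μ i v ≠ v), x ∉ U ∪ U.image (μ i) := by
      by_contra hcon
      push Not at hcon
      have k1 := Finset.card_le_card hcon
      have k2 := Finset.card_union_le U (U.image (μ i))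
      have k3 : (U.image (μ i)).card ≤ U.card := Finset.card_image_le
      have k4 := hF i
      omega
    obtain ⟨hxF, hyF, hyx⟩ := Finset.mem_filter.1 hx
    rw [Finset.mem_union, not_or] at hxU
    have hσx : σ x = x := by
      by_contra hh; exact hxU.1 (Finset.mem_filter.2 ⟨hxF, hh⟩)
    obtain ⟨y, hy⟩ : ∃ y, μ i x = y := ⟨_, rfl⟩
    rw [hy] at hyF hyx
    have hyμ : μ i y = x := by rw [← hy, hμ]
    have hσy : σ y = y := by
      by_contra hh
      exact hxU.2 (Finset.mem_image.2 ⟨y, Finset.mem_filter.2 ⟨hyF, hh⟩, hyμ⟩)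
    set σ' : V → V := fun v => if v = x then y else if v = y then x else σ v with hσ'
    set col' : V → ι := fun v => if v = x ∨ v = y then i else col v with hcol'
    have sx : σ' x = y := by simp [hσ']
    have sy : σ' y = x := by simp [hσ', hyx]
    have so : ∀ v, v ≠ x → v ≠ y → σ' v = σ v := fun v h1 h2 => by simp [hσ', h1, h2]
    have cx : col' x = i := by simp [hcol']
    have cy : col' y = i := by simp [hcol']
    have co : ∀ v, v ≠ x → v ≠ y → col' v = col v := fun v h1 h2 => by simp [hcol', h1, h2]
    have hσn : ∀ v, v ≠ x → v ≠ y → σ v ≠ x ∧ σ v ≠ y := by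
      intro v h1 h2
      exact ⟨fun e => h1 (by rw [← h.invol v, e, hσx]), fun e => h2 (by rw [← h.invol v, e, hσy])⟩
    have hr : IsRainbow μ σ' col' := by
      refine ⟨?_, ?_, ?_⟩
      · intro v
        by_cases h1 : v = x
        · rw [h1, sx, sy]
        by_cases h2 : v = y
        · rw [h2, sy, sx]
        obtain ⟨h3, h4⟩ := hσn v h1 h2
        rw [so v h1 h2, so _ h3 h4, h.invol]
      · intro v hv
        by_cases h1 : v = x
        · rw [h1, sx, cx, cy]; exact ⟨hy, rfl⟩
        by_cases h2 : v = y
        · rw [h2, sy, cx, cy]; exact ⟨hyμ, rfl⟩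
        obtain ⟨h3, h4⟩ := hσn v h1 h2
        rw [so v h1 h2] at hv ⊢
        rw [co v h1 h2, co _ h3 h4]
        exact h.edge v hv
      · intro v w hv hw e
        by_cases h1 : v = x ∨ v = y
        · have e1 : col' v = i := by rcases h1 with rfl | rfl <;> assumption
          by_cases h2 : w = x ∨ w = y
          · rcases h1 with rfl | rfl <;> rcases h2 with rfl | rfl <;> simp [sx, sy]
          · rw [not_or] at h2
            rw [e1, co w h2.1 h2.2] at e
            rw [so w h2.1 h2.2] at hw
            exact absurd e.symm (hi' w hw)
        · rw [not_or] at h1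
          rw [so v h1.1 h1.2] at hv ⊢
          rw [co v h1.1 h1.2] at e
          by_cases h2 : w = x ∨ w = y
          · have e1 : col' w = i := by rcases h2 with rfl | rfl <;> assumption
            rw [e1] at e
            exact absurd e (hi' v hv)
          · rw [not_or] at h2
            rw [co w h2.1 h2.2] at e
            rw [so w h2.1 h2.2] at hw
            exact h.inj v w hv hw e
    refine ih σ' col' hr ?_ ?_
    · have : Finset.univ.filter (fun j => ∀ v, σ' v ≠ v → col' v ≠ j) =
          (Finset.univ.filter (fun j => ∀ v, σ v ≠ v → col v ≠ j)).erase i := by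
        ext j
        simp only [Finset.mem_filter, Finset.mem_univ, true_and, Finset.mem_erase]
        constructor
        · intro hj
          refine ⟨fun e => hj x (by rw [sx]; exact hyx) (by rw [cx, e]), fun v hv => ?_⟩
          have h1 : v ≠ x := by rintro rfl; exact hv hσx
          have h2 : v ≠ y := by rintro rfl; exact hv hσy
          have := hj v (by rwa [so v h1 h2])
          rwa [co v h1 h2] at this
        · rintro ⟨hji, hj⟩ v hv
          by_cases h1 : v = x ∨ v = y
          · have e1 : col' v = i := by rcases h1 with rfl | rfl <;> assumption
            rw [e1]; exact hji.symm
          · rw [not_or] at h1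
            rw [so v h1.1 h1.2] at hv
            rw [co v h1.1 h1.2]; exact hj v hv
      rw [this, Finset.card_erase_of_mem hi, hm]; rfl
    · have : F.filter (fun v => σ' v ≠ v) ⊆ U ∪ {x, y} := by
        intro v hv
        obtain ⟨h1, h2⟩ := Finset.mem_filter.1 hv
        by_cases h3 : v = x
        · simp [h3]
        by_cases h4 : v = y
        · simp [h4]
        rw [so v h3 h4] at h2
        exact Finset.mem_union_left _ (Finset.mem_filter.2 ⟨h1, h2⟩)
      have h1 := (Finset.card_le_card this).trans (Finset.card_union_le _ _)
      have h2 : ({x, y} : Finset V).card ≤ 2 := Finset.card_le_two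
      omega

/-- The theorem for colour classes that are given by involutions. -/
theorem exists_full_rainbow [Fintype V] [Fintype ι] {μ : ι → V → V}
    (hμ : ∀ i v, μ i (μ i v) = v) {Q n : ℕ} (hn : Fintype.card ι = n) (hQ : 10 ^ 13 ≤ Q)
    (hQn : Q ^ 15 ≤ n) (hn' : 4 * n < 2 ^ Q)
    (hμN : ∀ i, 2 * n * (Q + 20) ≤ Q * (Finset.univ.filter (fun v => μ i v ≠ v)).card) :
    ∃ (σ : V → V) (col : V → ι), IsRainbow μ σ col ∧ ∀ i, ∃ v, σ v ≠ v ∧ col v = i := by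
  obtain ⟨F, hF⟩ := exists_splitting hμ hn hQ hQn hn' hμN
  set ν : ι → V → V := fun i v => if v ∉ F ∧ μ i v ∉ F then μ i v else v with hν
  have hν1 : ∀ i v, ν i v ≠ v → ν i v = μ i v ∧ v ∉ F ∧ μ i v ∉ F := by
    intro i v hv
    by_cases h : v ∉ F ∧ μ i v ∉ F
    · exact ⟨by simp only [hν, if_pos h], h⟩
    · simp only [hν, if_neg h] at hv; exact absurd rfl hv
  have hνi : ∀ i v, ν i (ν i v) = v := by
    intro i v
    by_cases h : v ∉ F ∧ μ i v ∉ F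
    · have h' : μ i v ∉ F ∧ μ i (μ i v) ∉ F := by rw [hμ]; exact ⟨h.2, h.1⟩
      simp only [hν, if_pos h, if_pos h', hμ]
    · simp only [hν, if_neg h]
  -- Using only edges that avoid F keeps all of F uncovered, which is what the greedy completion
  -- requires.
  obtain ⟨σ, col, h, hm⟩ := exists_rainbow_almost_full hνi (N := 2 * (n + n / Q + 1)) hn hQ hQn hn' (by
    have := Nat.lt_mul_div_succ n (by omega : 0 < Q)
    nlinarith) (fun i => by
    refine (hF i).2.trans (Finset.card_le_card ?_)
    intro v hv
    obtain ⟨-, h1, h2⟩ := Finset.mem_filter.1 hv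
    refine Finset.mem_filter.2 ⟨Finset.mem_univ _, ?_⟩
    simp only [hν, if_pos h1]; exact h2)
  have h' : IsRainbow μ σ col := by
    refine ⟨h.invol, fun v hv => ?_, h.inj⟩
    obtain ⟨h1, h2⟩ := h.edge v hv
    rw [← h1] at hv
    exact ⟨(hν1 _ v hv).1 ▸ h1, h2⟩
  refine h'.complete hμ (fun i => (hF i).1) _ σ col rfl ?_
  have : F.filter (fun v => σ v ≠ v) = ∅ := by
    rw [Finset.filter_eq_empty_iff]
    intro v hvF hv
    rw [← (h.edge v hv).1] at hv
    exact (hν1 _ v hv).2.1 hvF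
  rw [this, Finset.card_empty]
  omega

end RainbowMatching

/-! ### Multigraphs and the choice of Q -/

namespace RainbowMatching

/-- A colour class is recovered from its involution: an end and a colour determine the edge.
Parallel edges have different colours here, so nothing is lost by recording only ends and colours.
-/
theorem exists_fullRainbowMatching_of_card {α β : Type*} {G : Graph α β} {n Q : ℕ} {c : β → Fin n}
    (hQ : 10 ^ 13 ≤ Q) (hQn : Q ^ 15 ≤ n) (hn' : 4 * n < 2 ^ Q)
    (hm : ∀ i, G.IsMatching (G.colourClass c i)) (E : Fin n → Finset β)
    (hE : ∀ i, ∀ e ∈ E i, e ∈ G.colourClass c i) (hcard : ∀ i, n * (Q + 20) ≤ Q * (E i).card) :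
    ∃ M : Set β, G.IsFullRainbowMatching c M := by
  have hn0 : 0 < n := lt_of_lt_of_le (pow_pos (by omega) _) hQn
  have huniq : ∀ i, ∀ e ∈ E i, ∀ f ∈ E i, ∀ x, G.Inc e x → G.Inc f x → e = f := fun i e he f hf =>
    (hm i).2.2 e (hE i e he) f (hE i f hf)
  have hnl : ∀ i, ∀ e ∈ E i, ∀ x y, G.IsLink e x y → x ≠ y := by
    rintro i e he x y h rfl
    exact (hm i).2.1 e (hE i e he) x h
  have hα : Nonempty α := by
    have h1 := hcard ⟨0, hn0⟩
    have h2 : 0 < n * (Q + 20) := Nat.mul_pos hn0 (by omega)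
    obtain ⟨e, he⟩ := Finset.card_pos.1 (Nat.pos_of_mul_pos_left (h2.trans_le h1))
    obtain ⟨x, -⟩ := G.exists_isLink_of_mem_edgeSet (hE _ e he).1
    exact ⟨x⟩
  have hends : ∀ e, ∃ x y, e ∈ G.edgeSet → G.IsLink e x y := by
    intro e
    by_cases he : e ∈ G.edgeSet
    · obtain ⟨x, y, h⟩ := G.exists_isLink_of_mem_edgeSet he
      exact ⟨x, y, fun _ => h⟩
    · exact ⟨Classical.arbitrary α, Classical.arbitrary α, fun h => absurd h he⟩
  choose a b hab using hends
  have habE : ∀ i, ∀ e ∈ E i, G.IsLink e (a e) (b e) := fun i e he => hab e (hE i e he).1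
  have hpart : ∀ (i : Fin n) (v : α), ∃ w, (∃ e ∈ E i, G.IsLink e v w) ∨
      (w = v ∧ ¬ ∃ e ∈ E i, ∃ w', G.IsLink e v w') := by
    intro i v
    by_cases h : ∃ e ∈ E i, ∃ w', G.IsLink e v w'
    · obtain ⟨e, he, w, hw⟩ := h
      exact ⟨w, Or.inl ⟨e, he, hw⟩⟩
    · exact ⟨v, Or.inr ⟨rfl, h⟩⟩
  choose ν hν using hpart
  have hνlink : ∀ i, ∀ e ∈ E i, ∀ v w, G.IsLink e v w → ν i v = w := by
    intro i e he v w h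
    rcases hν i v with ⟨f, hf, h'⟩ | ⟨-, h'⟩
    · obtain rfl := huniq i e he f hf v h.inc_left h'.inc_left
      exact h'.right_unique h
    · exact absurd ⟨e, he, w, h⟩ h'
  have hνmoved : ∀ i v, ν i v ≠ v → ∃ e ∈ E i, G.IsLink e v (ν i v) := by
    intro i v hv
    rcases hν i v with h | ⟨h, -⟩
    · exact h
    · exact absurd h hv
  have hνν : ∀ i v, ν i (ν i v) = v := by
    intro i v
    by_cases h : ν i v = v
    · rw [h, h]
    · obtain ⟨e, he, h'⟩ := hνmoved i v h
      exact hνlink i e he _ _ h'.symm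
  -- The vertex set may be infinite; the ends of the selected edges form a finite set preserved by
  -- every involution.
  set W : Finset α := Finset.univ.biUnion (fun i => (E i).image a ∪ (E i).image b) with hW
  have hWm : ∀ i, ∀ e ∈ E i, ∀ x, G.Inc e x → x ∈ W := by
    intro i e he x hx
    refine Finset.mem_biUnion.2 ⟨i, Finset.mem_univ _, ?_⟩
    rcases hx.eq_or_eq_of_isLink (habE i e he) with rfl | rfl
    · exact Finset.mem_union_left _ (Finset.mem_image_of_mem _ he)
    · exact Finset.mem_union_right _ (Finset.mem_image_of_mem _ he)
  have hνW : ∀ i v, v ∈ W → ν i v ∈ W := by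
    intro i v hv
    by_cases h : ν i v = v
    · rwa [h]
    · obtain ⟨e, he, h'⟩ := hνmoved i v h
      exact hWm i e he _ h'.inc_right
  set μ : Fin n → W → W := fun i v => ⟨ν i v, hνW i v v.2⟩ with hμ
  have hcount : ∀ i, 2 * (E i).card ≤ (Finset.univ.filter (fun v => μ i v ≠ v)).card := by
    intro i
    have hinjA : ((E i).image a).card = (E i).card := Finset.card_image_of_injOn fun e he f hf h =>
      huniq i e he f hf (a e) (habE i e he).inc_left (by
        have h : a e = a f := h
        rw [h]; exact (habE i f hf).inc_left)
    have hinjB : ((E i).image b).card = (E i).card := Finset.card_image_of_injOn fun e he f hf h =>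
      huniq i e he f hf (b e) (habE i e he).inc_right (by
        have h : b e = b f := h
        rw [h]; exact (habE i f hf).inc_right)
    have hdis : Disjoint ((E i).image a) ((E i).image b) := by
      rw [Finset.disjoint_left]
      intro x hx hx'
      obtain ⟨e, he, rfl⟩ := Finset.mem_image.1 hx
      obtain ⟨f, hf, h⟩ := Finset.mem_image.1 hx'
      obtain rfl := huniq i e he f hf (a e) (habE i e he).inc_left (h ▸ (habE i f hf).inc_right)
      exact hnl i e he _ _ (habE i e he) h.symm
    have hsub : (E i).image a ∪ (E i).image b ⊆
        (Finset.univ.filter (fun v => μ i v ≠ v)).image Subtype.val := by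
      intro x hx
      obtain ⟨e, he, y, h⟩ : ∃ e ∈ E i, ∃ y, G.IsLink e x y := by
        rcases Finset.mem_union.1 hx with hx | hx
        · obtain ⟨e, he, rfl⟩ := Finset.mem_image.1 hx
          exact ⟨e, he, _, habE i e he⟩
        · obtain ⟨e, he, rfl⟩ := Finset.mem_image.1 hx
          exact ⟨e, he, _, (habE i e he).symm⟩
      refine Finset.mem_image.2 ⟨⟨x, hWm i e he x h.inc_left⟩, Finset.mem_filter.2
        ⟨Finset.mem_univ _, fun h' => ?_⟩, rfl⟩
      have h' : ν i x = x := congrArg Subtype.val h'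
      rw [hνlink i e he x y h] at h'
      exact hnl i e he x y h h'.symm
    have h1 := (Finset.card_le_card hsub).trans Finset.card_image_le
    rw [Finset.card_union_of_disjoint hdis, hinjA, hinjB] at h1
    omega
  obtain ⟨σ, col, hσ, hfull⟩ := exists_full_rainbow (μ := μ)
    (fun i v => Subtype.ext (hνν i v)) (Fintype.card_fin n) hQ hQn hn' (fun i => by
      calc 2 * n * (Q + 20) = 2 * (n * (Q + 20)) := by ring
        _ ≤ 2 * (Q * (E i).card) := Nat.mul_le_mul_left _ (hcard i)
        _ = Q * (2 * (E i).card) := by ring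
        _ ≤ _ := by convert Nat.mul_le_mul_left Q (hcount i))
  set M : Set β := {e | ∃ v : W, σ v ≠ v ∧ e ∈ E (col v) ∧ G.IsLink e v (σ v)} with hM
  have hsame : ∀ e f : β, ∀ v w : W, σ v ≠ v → σ w ≠ w → e ∈ E (col v) → f ∈ E (col w) →
      G.IsLink e v (σ v) → G.IsLink f w (σ w) → (w = v ∨ w = σ v) → e = f := by
    intro e f v w hv hw he hf hev hfw h
    rcases h with rfl | rfl
    · exact huniq _ e he f hf _ hev.inc_left hfw.inc_left
    · rw [(hσ.edge v hv).2] at hf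
      exact huniq _ e he f hf _ hev.inc_right hfw.inc_left
  have hcol : ∀ i, ∀ e ∈ E i, c e = i := fun i e he => (hE i e he).2
  refine ⟨M, ⟨?_, ?_, ?_⟩, ?_, ?_⟩
  · rintro e ⟨v, -, he, -⟩; exact (hE _ e he).1
  · rintro e ⟨v, -, he, -⟩ x; exact (hm _).2.1 e (hE _ e he) x
  · rintro e ⟨v, hv, he, hev⟩ f ⟨w, hw, hf, hfw⟩ x hex hfx
    refine hsame e f v w hv hw he hf hev hfw ?_
    rcases hex.eq_or_eq_of_isLink hev with h1 | h1 <;>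
      rcases hfx.eq_or_eq_of_isLink hfw with h2 | h2
    · exact Or.inl (Subtype.ext (h2.symm.trans h1))
    · right
      have : v = σ w := Subtype.ext (h1.symm.trans h2)
      rw [this, hσ.invol]
    · exact Or.inr (Subtype.ext (h2.symm.trans h1))
    · left
      have : σ v = σ w := Subtype.ext (h1.symm.trans h2)
      rw [← hσ.invol w, ← this, hσ.invol]
  · rintro e ⟨v, hv, he, hev⟩ f ⟨w, hw, hf, hfw⟩ hc
    rw [hcol _ e he, hcol _ f hf] at hc
    exact hsame e f v w hv hw he hf hev hfw (hσ.inj v w hv hw hc)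
  · intro i
    obtain ⟨v, hv, rfl⟩ := hfull i
    have h1 : ν (col v) v = σ v := congrArg Subtype.val (hσ.edge v hv).1
    obtain ⟨e, he, hev⟩ := hνmoved (col v) v (by rw [h1]; exact fun h => hv (Subtype.ext h))
    rw [h1] at hev
    exact ⟨e, ⟨v, hv, he, hev⟩, hcol _ e he⟩

/-- From Q < 2^(5 + Q/32) one gets Q^32 < 2^(160 + Q), and Q^16 ≥ 2^162 absorbs the constants. -/
theorem four_mul_pow_lt_two_pow {Q : ℕ} (hQ : 10 ^ 13 ≤ Q) : 4 * Q ^ 16 < 2 ^ Q := by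
  have h1 : Q < 2 ^ 5 * 2 ^ (Q / 32) := by
    have h2 : Q / 32 + 1 ≤ 2 ^ (Q / 32) := Nat.lt_two_pow_self
    omega
  have h2 : Q ^ 32 < 2 ^ 160 * 2 ^ Q := by
    calc Q ^ 32 < (2 ^ 5 * 2 ^ (Q / 32)) ^ 32 := Nat.pow_lt_pow_left h1 (by norm_num)
      _ = 2 ^ 160 * 2 ^ (Q / 32 * 32) := by rw [mul_pow, ← pow_mul, ← pow_mul]
      _ ≤ 2 ^ 160 * 2 ^ Q := by
        gcongr
        · norm_num
        · exact Nat.div_mul_le_self _ _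
  have h3 : 2 ^ 160 * (4 * Q ^ 16) ≤ Q ^ 32 := by
    calc 2 ^ 160 * (4 * Q ^ 16) = 2 ^ 162 * Q ^ 16 := by ring
      _ ≤ (10 ^ 13) ^ 16 * Q ^ 16 := Nat.mul_le_mul_right _ (by norm_num)
      _ ≤ Q ^ 16 * Q ^ 16 := by gcongr
      _ = Q ^ 32 := by ring
  exact Nat.lt_of_mul_lt_mul_left (h3.trans_lt h2)

/-- Take Q = ⌈x⌉ with x = n^(1/16). Then Q ≤ 2x gives Q^15 ≤ 2^15·x^15 ≤ x^16 = n, and n ≤ Q^16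
gives the exponential bound. -/
theorem exists_scale {n : ℕ} (hn : (10 ^ 13) ^ 16 ≤ n) : ∃ Q : ℕ, 10 ^ 13 ≤ Q ∧ Q ^ 15 ≤ n ∧
    4 * n < 2 ^ Q ∧ (n : ℝ) ≤ Q * (n : ℝ) ^ (1 - 1 / 16 : ℝ) := by
  have hn0 : (0 : ℝ) < n := by
    have : 0 < n := lt_of_lt_of_le (by norm_num) hn
    exact_mod_cast this
  set x : ℝ := (n : ℝ) ^ (1 / 16 : ℝ) with hx
  have hx16 : x ^ 16 = n := by
    rw [hx, ← Real.rpow_natCast, ← Real.rpow_mul hn0.le]; norm_num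
  have hx0 : 0 < x := Real.rpow_pos_of_pos hn0 _
  have hx1 : (10 : ℝ) ^ 13 ≤ x := by
    refine le_of_pow_le_pow_left₀ (n := 16) (by norm_num) hx0.le ?_
    rw [hx16]; exact_mod_cast hn
  have hle : x ≤ (⌈x⌉₊ : ℝ) := Nat.le_ceil x
  have hlt : (⌈x⌉₊ : ℝ) < x + 1 := Nat.ceil_lt_add_one hx0.le
  have hQ : 10 ^ 13 ≤ ⌈x⌉₊ := by
    have : ((10 ^ 13 : ℕ) : ℝ) ≤ (⌈x⌉₊ : ℝ) := by push_cast; linarith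
    exact_mod_cast this
  refine ⟨⌈x⌉₊, hQ, ?_, ?_, ?_⟩
  · have h1 : ((⌈x⌉₊ : ℝ)) ^ 15 ≤ n := by
      have h2 : (⌈x⌉₊ : ℝ) ≤ 2 * x := by linarith
      calc ((⌈x⌉₊ : ℝ)) ^ 15 ≤ (2 * x) ^ 15 := by gcongr
        _ = 2 ^ 15 * x ^ 15 := by ring
        _ ≤ x * x ^ 15 := by gcongr; linarith
        _ = n := by rw [← hx16]; ring
    exact_mod_cast h1
  · have h1 : (n : ℝ) ≤ (⌈x⌉₊ : ℝ) ^ 16 := by rw [← hx16]; gcongr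
    have h2 : n ≤ ⌈x⌉₊ ^ 16 := by exact_mod_cast h1
    have h3 := four_mul_pow_lt_two_pow hQ
    omega
  · have h1 : (n : ℝ) = x * (n : ℝ) ^ (1 - 1 / 16 : ℝ) := by
      rw [hx, ← Real.rpow_add hn0]; norm_num
    have h2 : 0 ≤ (n : ℝ) ^ (1 - 1 / 16 : ℝ) := Real.rpow_nonneg hn0.le _
    calc (n : ℝ) = x * (n : ℝ) ^ (1 - 1 / 16 : ℝ) := h1
      _ ≤ _ := by gcongr

/-- A colour class may be infinite, so a finite subset with exactly ⌈r⌉ elements is selected. -/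
theorem exists_finset_of_ofReal_le_encard {β : Type*} {s : Set β} {r : ℝ}
    (h : ENNReal.ofReal r ≤ (s.encard : ℝ≥0∞)) :
    ∃ E : Finset β, (∀ e ∈ E, e ∈ s) ∧ r ≤ E.card := by
  have hk : ((⌈r⌉₊ : ℕ) : ℕ∞) ≤ s.encard := by
    induction hs : s.encard using ENat.recTopCoe with
    | top => exact le_top
    | coe m =>
      rw [hs, ENat.toENNReal_coe, ENNReal.ofReal_le_natCast] at h
      exact_mod_cast Nat.ceil_le.2 h
  obtain ⟨t, hts, ht⟩ := Set.exists_subset_encard_eq hk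
  have hfin : t.Finite := Set.finite_of_encard_eq_coe ht
  refine ⟨hfin.toFinset, fun e he => hts (hfin.mem_toFinset.1 he), ?_⟩
  have h2 : hfin.toFinset.card = ⌈r⌉₊ := by
    rw [hfin.encard_eq_coe_toFinset_card] at ht
    exact_mod_cast ht
  rw [h2]; exact Nat.le_ceil r

end RainbowMatching
end

theorem theorem1p2 :
    ∃ N : ℕ, ∀ n : ℕ, N ≤ n →
      ∀ (α β : Type*) (G : Graph α β) (c : β → Fin n),
        (∀ i : Fin n, G.IsMatching (G.colourClass c i) ∧
          ENNReal.ofReal ((n : ℝ) + 20 * (n : ℝ) ^ (1 - 1 / 16 : ℝ)) ≤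
            ((G.colourClass c i).encard : ℝ≥0∞)) →
        ∃ M : Set β, G.IsFullRainbowMatching c M := by
  refine ⟨(10 ^ 13) ^ 16, fun n hn α β G c h => ?_⟩
  obtain ⟨Q, hQ, hQn, hn', hle⟩ := RainbowMatching.exists_scale hn
  choose E hE hcard using fun i => RainbowMatching.exists_finset_of_ofReal_le_encard (h i).2
  refine RainbowMatching.exists_fullRainbowMatching_of_card hQ hQn hn' (fun i => (h i).1) E hE
    fun i => ?_
  -- As n ≤ Q·n^(15/16), the surplus 20·n^(15/16) is at least 20n/Q.
  have h1 : (n : ℝ) * (Q + 20) ≤ Q * (E i).card := by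
    have h2 := mul_le_mul_of_nonneg_left (hcard i) (Nat.cast_nonneg (α := ℝ) Q)
    linarith
  exact_mod_cast h1
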